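/- Lemma 5.2 (Main technical lemma). Conventions. $\log$ is to the base $2$. Let $\mathbb F$ be a finite field. For $x,y\in\mathbb F^n$ and a string $S=(S_1,\dots,S_n)$ of subsets of $\mathbb F$, $\operatorname{dist}(x,y)$ is the fraction of the $i\in[n]$ with $x_i\ne y_i$, and $\operatorname{dist}(x,S)$ is the fraction of the $i\in[n]$ with $x_i\notin S_i$; $\binom{\mathbb F}{\ell}$ is the set of $\ell$-element subsets of $\mathbb F$. A linear code is an injective linear map $C:\mathbb F^k\to\mathbb F^n$ with generating matrix $G_C$ (so $C(x)=G_Cx$); its relative distance is the minimum of $\operatorname{dist}(C(x),C(y))$ over $x\neq y$. It is $(\alpha,\ell,L)$-(globally) list recoverable if for every $S\in\binom{\mathbb F}{\ell}^n$ at most $L$ messages $x$ satisfy $\operatorname{dist}(C(x),S)\le\alpha$. The tensor product of two linear codes is $(C_1\otimes C_2)(M)=G_{C_1}MG_{C_2}^{T}$, and $C^{\otimes1}=C$, $C^{\otimes t}=C\otimes C^{\otimes(t-1)}$. A code $C:\mathbb F^k\to\mathbb F^n$ is $(Q,\alpha,\varepsilon,\ell,L)$-approximately locally list recoverable if there is a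 randomized algorithm $A$ (the preprocessing, which does not see $S$) that outputs descriptions of at most $L$ deterministic algorithms $A_1,A_2,\dots$, each of which takes a coordinate $i\in[n]$, has oracle access to a string $S\in\binom{\mathbb F}{\ell}^n$, and queries at most $Q$ coordinates of $S$ (it sees at most $Q$ of the lists $S_i$), such that for every $S\in\binom{\mathbb F}{\ell}^n$ and every codeword $C(x)$ with $\operatorname{dist}(C(x),S)\le\alpha$, with probability at least $1-\varepsilon$ over the randomness of $A$ there is a $j$ with $\Pr_{i\in[n]}[A_j(i)=C(x)_i]\ge1-\varepsilon$. The preprocessing time is the time that $A$ takes to output the descriptions; the running time is the maximum of the running times of the $A_j$. Algorithms for a given code are programs, which may depend on the code, of a unit-cost random access machine with addition, truncated subtraction and indirect addressing. Field elements are represented by numbers $0,\dots,|\mathbb F|-1$ through an arbitrary fixed numbering. An oracle step returns one entry of one list $S_i$; a random step returns a fresh or stored uniform random symbol from $\{0,\dots,N-1\}$, for a number $N$ chosen by the algorithm, and costs as many steps as $N$ has binary digits. A description of a local algorithm is a string that is read by one fixed program. A (global) list recovery algorithm for $C$ is a deterministic program that, given oracle access to $S\in\binom{\mathbb F}{\ell}^n$,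 writes out a list of at most $L$ codewords of $C$ that contains every codeword $C(x)$ with $\operatorname{dist}(C(x),S)\le\alpha$. Statement. There is an absolute constant $c\in\{1,2,3,\dots\}$ such that the following holds. Let $\mathbb F$ be a finite field, let $n\ge2$, $t\ge1$, $\ell\ge1$, $L\ge2$ be integers, let $0<\alpha\le1$, and let $C:\mathbb F^k\to\mathbb F^n$ be a linear code of relative distance $\delta>0$ that is $(\alpha,\ell,L)$-list recoverable. Let $\tilde\varepsilon>0$ and put $$B=\frac{\log^tL}{(\alpha\tilde\varepsilon)^{ct}\,(\delta/c)^{ct^2}},\qquad \tilde\alpha=\alpha\cdot\tilde\varepsilon\cdot(\delta/c)^{ct},\qquad \tilde Q=n\cdot B,\qquad \tilde L=2^{B}.$$ Then $C^{\otimes t}:\mathbb F^{k^t}\to\mathbb F^{n^t}$ is $(\tilde Q,\tilde\alpha,\tilde\varepsilon,\ell,\tilde L)$-approximately locally list recoverable by an algorithm with preprocessing time at most $\log n\cdot2^{B}$. Moreover, for every integer $T\geq 0$, if $C$ has a (global) list recovery algorithm that runs in time $T$, then such an algorithm exists (with the same $\tilde Q,\tilde\alpha,\tilde\varepsilon,\ell,\tilde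 L$ and the same bound on the preprocessing time) that also has running time at most $T\cdot B$. -/

import Mathlib

namespace LLR

/-! ### A random access machine with unit-cost steps

The instruction set is that of the additive unit-cost RAM: an unbounded memory of natural numbers,
all zero at the start, with constants, addition, truncated subtraction and indirect addressing (there is
no multiplication), together with a read-only input, an oracle for a string of lists, a random tape and
an output tape that is divided into rows.  Control flow is structured (sequence, branch, loop). -/

/-- The elementary instructions. `M` denotes the memory. -/
inductive Op : Type
  | const (a v : ℕ)    -- `M[a] := v`
  | add (a b c : ℕ)    -- `M[a] := M[b] + M[c]`
  | sub (a b c : ℕ)    -- `M[a] := M[b] - M[c]`, truncated at `0`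
  | load (a b : ℕ)     -- `M[a] := M[M[b]]`
  | store (a b : ℕ)    -- `M[M[a]] := M[b]`
  | read (a b : ℕ)     -- `M[a] :=` input word number `M[b]` (`0` beyond the end of the input)
  | query (a b c : ℕ)  -- `M[a] :=` entry number `M[c]` of the list that stands at coordinate `M[b]`
  | rand (a b : ℕ)     -- `M[a] :=` symbol number `M[b]` of the random tape
  | emit (a : ℕ)       -- append the word `M[a]` to the current output row
  | endRow             -- close the current output row and start a new one

/-- Programs. A test succeeds when the tested word is nonzero. -/
inductive Prog : Type
  | nop
  | op (o : Op)
  | seq (p q : Prog)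
  | ite (a : ℕ) (p q : Prog)
  | loop (a : ℕ) (p : Prog)

/-- What a program can access but not change. Reading one symbol of the random tape costs
`coinCost` steps. -/
structure Env : Type where
  input : List ℕ
  oracle : ℕ → ℕ → ℕ
  coin : ℕ → ℕ
  coinCost : ℕ

/-- Memory, current output row, closed output rows (first row first), set of the coordinates at which
the oracle has been queried, and number of steps made so far. -/
structure State : Type where
  mem : ℕ → ℕ
  row : List ℕ
  out : List (List ℕ)
  asked : Finset ℕ
  time : ℕ

/-- The state in which every run starts. -/
def State.init : State := ⟨fun _ => 0, [], [], ∅, 0⟩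

/-- `M[a] := v`. -/
def State.set (s : State) (a v : ℕ) : State := { s with mem := Function.update s.mem a v }

/-- Charge `k` steps. -/
def State.tick (s : State) (k : ℕ) : State := { s with time := s.time + k }

/-- The effect of an elementary instruction. Each costs one step, except that reading a random symbol
costs `coinCost` steps. -/
def Op.exec (E : Env) (s : State) : Op → State
  | .const a v => (s.set a v).tick 1
  | .add a b c => (s.set a (s.mem b + s.mem c)).tick 1
  | .sub a b c => (s.set a (s.mem b - s.mem c)).tick 1
  | .load a b => (s.set a (s.mem (s.mem b))).tick 1
  | .store a b => (s.set (s.mem a) (s.mem b)).tick 1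
  | .read a b => (s.set a (E.input.getD (s.mem b) 0)).tick 1
  | .query a b c =>
      { (s.set a (E.oracle (s.mem b) (s.mem c))).tick 1 with asked := insert (s.mem b) s.asked }
  | .rand a b => (s.set a (E.coin (s.mem b))).tick E.coinCost
  | .emit a => { s.tick 1 with row := s.row ++ [s.mem a] }
  | .endRow => { s.tick 1 with row := [], out := s.out ++ [s.row] }

/-- `Exec E p s s'`: the program `p`, started in state `s`, halts in state `s'`.
Every test costs one step. -/
inductive Exec (E : Env) : Prog → State → State → Prop
  | nop (s : State) : Exec E .nop s s
  | op (o : Op) (s : State) : Exec E (.op o) s (o.exec E s)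
  | seq {p q : Prog} {s s' s'' : State} :
      Exec E p s s' → Exec E q s' s'' → Exec E (.seq p q) s s''
  | iteTrue {a : ℕ} {p q : Prog} {s s' : State} :
      s.mem a ≠ 0 → Exec E p (s.tick 1) s' → Exec E (.ite a p q) s s'
  | iteFalse {a : ℕ} {p q : Prog} {s s' : State} :
      s.mem a = 0 → Exec E q (s.tick 1) s' → Exec E (.ite a p q) s s'
  | loopStop {a : ℕ} {p : Prog} {s : State} :
      s.mem a = 0 → Exec E (.loop a p) s (s.tick 1)
  | loopStep {a : ℕ} {p : Prog} {s s' s'' : State} :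
      s.mem a ≠ 0 → Exec E p (s.tick 1) s' → Exec E (.loop a p) s' s'' → Exec E (.loop a p) s s''

/-- Programs are deterministic: the halting state is unique if it exists. -/
theorem Exec.unique {E : Env} {p : Prog} {s u : State} (h : Exec E p s u) :
    ∀ {v : State}, Exec E p s v → u = v := by
  induction h with
  | nop s => intro v hv; cases hv; rfl
  | op o s => intro v hv; cases hv; rfl
  | seq _ _ ih₁ ih₂ =>
    intro v hv
    cases hv with
    | seq h₁ h₂ => cases ih₁ h₁; exact ih₂ h₂
  | iteTrue ha _ ih =>
    intro v hv
    cases hv with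
    | iteTrue _ h => exact ih h
    | iteFalse hb _ => exact absurd hb ha
  | iteFalse ha _ ih =>
    intro v hv
    cases hv with
    | iteTrue hb _ => exact absurd ha hb
    | iteFalse _ h => exact ih h
  | loopStop ha =>
    intro v hv
    cases hv with
    | loopStop _ => rfl
    | loopStep hb _ _ => exact absurd ha hb
  | loopStep ha _ _ ih₁ ih₂ =>
    intro v hv
    cases hv with
    | loopStop hb => exact absurd hb ha
    | loopStep _ h₁ h₂ => cases ih₁ h₁; exact ih₂ h₂

/-- `p` halts in state `s` when it is run from the initial state. -/
def Halts (E : Env) (p : Prog) (s : State) : Prop := Exec E p State.init s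

/-! ### Codes -/

/-- The fraction of the elements of a finite type that satisfy `P`; equivalently, the probability of `P`
for a uniformly random element. -/
noncomputable def frac {X : Type*} (P : X → Prop) : ℝ := (Nat.card {a // P a} : ℝ) / (Nat.card X : ℝ)

/-- A linear code with message length `k` and block length `n`, as an encoding map. -/
abbrev LinCode (F : Type*) [Field F] (k n : ℕ) : Type _ := (Fin k → F) →ₗ[F] (Fin n → F)

/-- A string of `n` sets of symbols. -/
abbrev ListString (F : Type*) (n : ℕ) : Type _ := Fin n → Finset F

section Codes

variable {F : Type*} [Field F] {k n k₁ n₁ k₂ n₂ : ℕ}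

/-- The distance of a string from a string of lists. -/
noncomputable def listDist (w : Fin n → F) (S : ListString F n) : ℝ := frac fun i => w i ∉ S i

/-- `δ` is the relative distance of `C`: the minimum of the relative Hamming distances of the encodings
of two distinct messages. -/
def HasRelDist (C : LinCode F k n) (δ : ℝ) : Prop :=
  IsLeast {d : ℝ | ∃ x y : Fin k → F, x ≠ y ∧ d = frac fun i => C x i ≠ C y i} δ

/-- `C` is `(α, ℓ, L)`-list recoverable. -/
def ListRecoverable (C : LinCode F k n) (α : ℝ) (ℓ L : ℕ) : Prop :=
  ∀ S : ListString F n, (∀ i, (S i).card = ℓ) →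
    {x : Fin k → F | listDist (C x) S ≤ α}.Finite ∧ {x : Fin k → F | listDist (C x) S ≤ α}.ncard ≤ L

/-- The tensor code `M ↦ G₁ * M * G₂ᵀ`, where `G₁`, `G₂` are the generating matrices; the matrices `M` and
`G₁ * M * G₂ᵀ` are written as vectors row by row (entry `(a, b)` of a matrix with `m` columns stands at
position `a * m + b`). -/
noncomputable def tensorCode (C₁ : LinCode F k₁ n₁) (C₂ : LinCode F k₂ n₂) :
    LinCode F (k₁ * k₂) (n₁ * n₂) where
  toFun M := fun i =>
    (LinearMap.toMatrix' C₁ * (Matrix.of fun a b => M (finProdFinEquiv (a, b))) *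
      (LinearMap.toMatrix' C₂).transpose) (finProdFinEquiv.symm i).1 (finProdFinEquiv.symm i).2
  map_add' M N := by
    funext i
    simp only [Pi.add_apply]
    rw [← Matrix.add_apply, ← Matrix.add_mul, ← Matrix.mul_add]
    rfl
  map_smul' r M := by
    funext i
    simp only [Pi.smul_apply, RingHom.id_apply]
    rw [← Matrix.smul_apply, ← Matrix.smul_mul, ← Matrix.mul_smul]
    rfl

/-- Rewriting of the message length and the block length of a code along equalities. -/
def recast (C : LinCode F k₁ n₁) (hk : k₁ = k₂) (hn : n₁ = n₂) : LinCode F k₂ n₂ :=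
  (LinearMap.funLeft F F (finCongr hn.symm)).comp (C.comp (LinearMap.funLeft F F (finCongr hk)))

/-- The `t`-fold tensor power: `C^{⊗1} = C` and `C^{⊗t} = C ⊗ C^{⊗(t-1)}` for `t ≥ 2`
(`t = 0` gives the identity code of length one). -/
noncomputable def tensorPow (C : LinCode F k n) : (t : ℕ) → LinCode F (k ^ t) (n ^ t)
  | 0 => recast (LinearMap.id : LinCode F 1 1) (pow_zero k).symm (pow_zero n).symm
  | 1 => recast C (pow_one k).symm (pow_one n).symm
  | t + 2 => recast (tensorCode C (tensorPow C (t + 1))) (pow_succ' k (t + 1)).symm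
      (pow_succ' n (t + 1)).symm

end Codes

/-! ### List recovery algorithms

Field elements are represented in the machine by a numbering `φ` of the field. -/

section Algorithms

variable {F : Type*} {q n : ℕ}

/-- Oracle access to a string `S` of lists: entry `j` of the list at coordinate `x` is (the number of) the
`j`-th element of `S x` in increasing order, and `0` if there is none. -/
def listOracle (φ : F ≃ Fin q) (S : ListString F n) (x j : ℕ) : ℕ :=
  if h : x < n then
    ((((S ⟨x, h⟩).map (φ.toEmbedding.trans Fin.valEmbedding)).sort (· ≤ ·)).getD j 0)
  else 0

/-- The machine word sequence that represents a string over `F`. -/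
def encodeWord (φ : F ≃ Fin q) (w : Fin n → F) : List ℕ := List.ofFn fun i => (φ (w i) : ℕ)

/-- The environment of a deterministic program with input `inp` and oracle access to `S`. -/
def listEnv (φ : F ≃ Fin q) (S : ListString F n) (inp : List ℕ) : Env where
  input := inp
  oracle := listOracle φ S
  coin := fun _ => 0
  coinCost := 1

/-- A (global) list recovery algorithm for `C` that runs in time `T`: with oracle access to a string `S` of
lists of size `ℓ`, it halts within `T` steps and its output rows are at most `L` codewords, among them every
codeword that is `α`-close to `S`. -/
def GlobalListRecoveryInTime [Field F] {k : ℕ} (φ : F ≃ Fin q) (C : LinCode F k n) (α : ℝ) (ℓ L T : ℕ) :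
    Prop :=
  ∃ G : Prog, ∀ S : ListString F n, (∀ i, (S i).card = ℓ) →
    ∃ s : State, Halts (listEnv φ S []) G s ∧ s.time ≤ T ∧ s.out.length ≤ L ∧
      (∀ r ∈ s.out, ∃ x, r = encodeWord φ (C x)) ∧
      ∀ x, listDist (C x) S ≤ α → encodeWord φ (C x) ∈ s.out

/-- A randomized algorithm that outputs deterministic local algorithms. The preprocessing `pre` has a random
tape of `seedLen` independent uniform symbols from `{0, …, radix - 1}`, no input and no oracle; its output rows
are the descriptions of the local algorithms. The local algorithm with description `d` is the program `loc`
on an input of the form `i :: d`, where `i` is the given coordinate. -/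
structure LocalListAlg : Type where
  pre : Prog
  loc : Prog
  radix : ℕ
  radix_pos : 0 < radix
  seedLen : ℕ

namespace LocalListAlg

/-- The random tapes of the preprocessing. -/
abbrev Seed (A : LocalListAlg) : Type := Fin A.seedLen → Fin A.radix

/-- The environment of the preprocessing: reading one random symbol costs as many steps as it has binary
digits, and the oracle gives no information. -/
def preEnv (A : LocalListAlg) (ω : A.Seed) : Env where
  input := []
  oracle := fun _ _ => 0
  coin := fun j => if h : j < A.seedLen then (ω ⟨j, h⟩ : ℕ) else 0
  coinCost := Nat.size A.radix

/-- On the random tape `ω` the preprocessing halts and outputs the list `D` of descriptions. -/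
def Outputs (A : LocalListAlg) (ω : A.Seed) (D : List (List ℕ)) : Prop :=
  ∃ s : State, Halts (A.preEnv ω) A.pre s ∧ s.out = D

/-- The local algorithm described by `d` halts in state `s` on coordinate `i` with oracle `S`. -/
def LocalHalts (A : LocalListAlg) (φ : F ≃ Fin q) (S : ListString F n) (d : List ℕ) (i : Fin n) (s : State) :
    Prop :=
  Halts (listEnv φ S ((i : ℕ) :: d)) A.loc s

/-- The local algorithm described by `d` answers `v` on coordinate `i` with oracle `S`. -/
def Answers (A : LocalListAlg) (φ : F ≃ Fin q) (S : ListString F n) (d : List ℕ) (i : Fin n) (v : F) : Prop :=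
  ∃ s : State, A.LocalHalts φ S d i s ∧ s.out = [[(φ v : ℕ)]]

/-- `A` witnesses that `C` is `(Q, α, ε, ℓ, L)`-approximately locally list recoverable. -/
structure ApproxLocallyListRecovers [Field F] {k : ℕ} (A : LocalListAlg) (φ : F ≃ Fin q) (C : LinCode F k n)
    (Q α ε : ℝ) (ℓ : ℕ) (L : ℝ) : Prop where
  /-- the preprocessing always outputs at most `L` local algorithms -/
  preprocessing : ∀ ω : A.Seed, ∃ D, A.Outputs ω D ∧ (D.length : ℝ) ≤ L
  /-- each of them halts on every coordinate and queries at most `Q` coordinates of the oracle -/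
  queries : ∀ (ω : A.Seed) (D : List (List ℕ)), A.Outputs ω D → ∀ d ∈ D,
    ∀ S : ListString F n, (∀ i, (S i).card = ℓ) → ∀ i : Fin n,
      ∃ s : State, A.LocalHalts φ S d i s ∧ (s.asked.card : ℝ) ≤ Q
  /-- for every `S` and every codeword that is `α`-close to `S`, with probability at least `1 - ε` one of
  them computes correctly at least a `1 - ε` fraction of the coordinates of the codeword -/
  correct : ∀ S : ListString F n, (∀ i, (S i).card = ℓ) → ∀ x : Fin k → F, listDist (C x) S ≤ α →
    1 - ε ≤ frac fun ω : A.Seed => ∃ D, A.Outputs ω D ∧ ∃ d ∈ D,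
      1 - ε ≤ frac fun i : Fin n => A.Answers φ S d i (C x i)

/-- `A` has preprocessing time at most `T`. -/
def PreprocessingTime (A : LocalListAlg) (T : ℝ) : Prop :=
  ∀ ω : A.Seed, ∃ s : State, Halts (A.preEnv ω) A.pre s ∧ (s.time : ℝ) ≤ T

/-- `A` has running time at most `T`: each local algorithm in its output halts within `T` steps. -/
def RunningTime (A : LocalListAlg) (φ : F ≃ Fin q) (n ℓ : ℕ) (T : ℝ) : Prop :=
  ∀ (ω : A.Seed) (D : List (List ℕ)), A.Outputs ω D → ∀ d ∈ D,
    ∀ S : ListString F n, (∀ i, (S i).card = ℓ) → ∀ i : Fin n,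
      ∃ s : State, A.LocalHalts φ S d i s ∧ (s.time : ℝ) ≤ T

end LocalListAlg

end Algorithms

/-- `log₂^t L / ((α ε)^{c t} (δ / c)^{c t²})`. -/
noncomputable def costFactor (c t L : ℕ) (α ε δ : ℝ) : ℝ :=
  Real.logb 2 L ^ t / ((α * ε) ^ (c * t) * (δ / c) ^ (c * t ^ 2))

end LLR

/-! A word of `C^{⊗(s+1)}` is a matrix with `n` rows in `C^{⊗s}` and all columns in `C`. To evaluate
it at a coordinate, list recover the column through that coordinate. This reads `n` lists and leaves
at most `L` candidates, among them the true column if that column is close to its lists. To choose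
among them, use `m` random rows, fixed once for all coordinates: evaluate recursively the entries
where these rows meet the column, and keep a candidate that disagrees with at most about `δm/4` of
the values found. At the bottom the word is a single codeword of `C`, and the choice is made by
advice, an index below `L`. The recursion has `m^(t-1)` leaves, so the preprocessing draws the
random rows and outputs one description for each of the `L^(m^(t-1))` advice strings.

The induction step is `levelCorrect_succ`. By Markov most rows are close to their lists, and on a
close row the recursion rarely fails, so by a Chernoff bound fewer than `δm/8` of the sampled rows
are bad. By averaging, in all but an `ε/4` fraction of the columns at most `δm/8` of the good
samples give a wrong value. By the distance of `C` and a union bound over the list, for most tapes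
all but an `ε/4` fraction of the columns have the property that every wrong candidate differs from
the true column in more than `δm/2` of the samples. At most an `ε/4` fraction of the columns is far
from the lists. On every other column the true candidate passes the test and all wrong ones fail.
`levelCorrect` iterates this, losing factors `δ/64` in error and closeness at each level;
`exists_samples` finds an `m` of order `log L / (δ ε (δ/64)^t)` that suffices at all levels.

On the machine, the list recovery program is an arbitrary program that expects zero memory, so every
call of it is simulated in memory of its own (`Reloc.tr_sim`). `Params.eval_tri` shows that the
compiled recursion computes the function `ev` that the probabilistic analysis is about, and
`Params.alg_recovers` joins the two sides. If no list recovery program is given, `exists_globalProg`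
supplies a decision tree. The cost factors are dominated by powers of `32m` with exponent at most
`t`, and `le_costFactor` compares `(32m)^t` with `B`.

Work linear in `n` is covered by `T·B` only if `n ≤ T`. If `T < n`, list recovery cannot even write
one codeword, so no word is close to any admissible `S` and an empty list of descriptions is
correct. The empty list also settles `ε ≥ 1`. -/

namespace LLR

/-! ### Fractions and tail bounds -/

/-- The indicator of a proposition. -/
noncomputable def ind (P : Prop) : ℝ := by
  classical exact if P then 1 else 0

theorem ind_of {P : Prop} (h : P) : ind P = 1 := by simp [ind, h]

theorem ind_of_not {P : Prop} (h : ¬P) : ind P = 0 := by simp [ind, h]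

theorem ind_nonneg (P : Prop) : 0 ≤ ind P := by
  by_cases h : P <;> simp [ind, h]

theorem ind_le_one (P : Prop) : ind P ≤ 1 := by
  by_cases h : P <;> simp [ind, h]

theorem ind_mono {P Q : Prop} (h : P → Q) : ind P ≤ ind Q := by
  by_cases hP : P
  · rw [ind_of hP, ind_of (h hP)]
  · rw [ind_of_not hP]; exact ind_nonneg Q

theorem ind_or_le (P Q : Prop) : ind (P ∨ Q) ≤ ind P + ind Q := by
  by_cases hP : P
  · rw [ind_of (Or.inl hP), ind_of hP]; linarith [ind_nonneg Q]
  · rw [ind_of_not hP, zero_add]; exact ind_mono fun h => h.resolve_left hP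

theorem frac_eq {X : Type*} [Fintype X] (P : X → Prop) :
    frac P = (∑ x, ind (P x)) / Fintype.card X := by
  classical
  unfold frac ind
  rw [Nat.card_eq_fintype_card, Nat.card_eq_fintype_card, Fintype.card_subtype]
  simp

theorem frac_nonneg {X : Type*} (P : X → Prop) : 0 ≤ frac P := by unfold frac; positivity

section Fractions

variable {X Y : Type*} [Fintype X] [Fintype Y]

theorem frac_mul_card (P : X → Prop) : frac P * Fintype.card X = ∑ x, ind (P x) := by
  rw [frac_eq]
  rcases isEmpty_or_nonempty X with h | h
  · simp
  · field_simp

theorem frac_eq_zero {P : X → Prop} (h : ∀ x, ¬P x) : frac P = 0 := by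
  rw [frac_eq, Finset.sum_eq_zero fun x _ => ind_of_not (h x), zero_div]

theorem frac_mono {P Q : X → Prop} (h : ∀ x, P x → Q x) : frac P ≤ frac Q := by
  rw [frac_eq, frac_eq]
  gcongr with x
  exact ind_mono (h x)

theorem frac_or_le (P Q : X → Prop) : frac (fun x => P x ∨ Q x) ≤ frac P + frac Q := by
  rw [frac_eq, frac_eq, frac_eq, ← add_div, ← Finset.sum_add_distrib]
  gcongr with x
  exact ind_or_le _ _

theorem frac_not [Nonempty X] (P : X → Prop) : frac (fun x => ¬P x) = 1 - frac P := by
  have h : ∀ x, ind (¬P x) = 1 - ind (P x) := fun x => by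
    by_cases h : P x
    · rw [ind_of h, ind_of_not (not_not.2 h)]; ring
    · rw [ind_of h, ind_of_not h]; ring
  rw [frac_eq, frac_eq]
  simp_rw [h, Finset.sum_sub_distrib]
  simp [sub_div]

theorem frac_le_one (P : X → Prop) : frac P ≤ 1 := by
  rw [frac_eq]
  apply div_le_one_of_le₀ _ (by positivity)
  calc ∑ x, ind (P x) ≤ ∑ _x : X, (1 : ℝ) := Finset.sum_le_sum fun x _ => ind_le_one _
    _ = _ := by simp

theorem frac_equiv (e : X ≃ Y) (P : Y → Prop) : frac (fun x => P (e x)) = frac P := by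
  rw [frac_eq, frac_eq, Fintype.card_congr e, e.sum_comp fun y => ind (P y)]

/-- Markov's inequality. -/
theorem frac_lt_mul_le {f : X → ℝ} (hf : ∀ x, 0 ≤ f x) {a b : ℝ} (hb : 0 ≤ b)
    (h : ∑ x, f x ≤ b * Fintype.card X) : frac (fun x => a < f x) * a ≤ b := by
  rcases isEmpty_or_nonempty X with hX | hX
  · rw [frac_eq]; simpa using hb
  · have hc : (0 : ℝ) < Fintype.card X := by positivity
    refine le_of_mul_le_mul_right (le_trans ?_ h) hc
    rw [mul_right_comm, frac_mul_card, Finset.sum_mul]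
    refine Finset.sum_le_sum fun x _ => ?_
    by_cases hx : a < f x
    · rw [ind_of hx]; linarith
    · rw [ind_of_not hx]; simpa using hf x

theorem sum_frac_prod (P : X → Y → Prop) :
    ∑ x, frac (P x) = frac (fun p : X × Y => P p.1 p.2) * Fintype.card X := by
  rw [frac_eq]
  simp_rw [frac_eq]
  rw [← Finset.sum_div, Fintype.sum_prod_type, Fintype.card_prod]
  rcases isEmpty_or_nonempty X with hX | hX
  · simp
  · push_cast; field_simp

theorem frac_prod_fst [Nonempty Y] (P : X → Prop) : frac (fun p : X × Y => P p.1) = frac P := by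
  rw [frac_eq, frac_eq, Fintype.sum_prod_type, Fintype.card_prod]
  simp only [Finset.sum_const, Finset.card_univ, nsmul_eq_mul, ← Finset.mul_sum]
  push_cast
  rw [mul_comm, mul_div_mul_right]
  positivity

theorem frac_prod_le {P : X × Y → Prop} {b : ℝ} (h : ∀ x, frac (fun y => P (x, y)) ≤ b) (hb : 0 ≤ b) :
    frac P ≤ b := by
  rcases isEmpty_or_nonempty X with hX | hX
  · rw [frac_eq]; simpa using hb
  · have h1 := sum_frac_prod fun (x : X) (y : Y) => P (x, y)
    have h2 : ∑ x, frac (fun y => P (x, y)) ≤ ∑ _x : X, b := Finset.sum_le_sum fun x _ => h x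
    rw [h1] at h2
    simp only [Finset.sum_const, Finset.card_univ, nsmul_eq_mul] at h2
    have hc : (0 : ℝ) < Fintype.card X := by positivity
    rw [mul_comm] at h2
    exact le_of_mul_le_mul_left h2 hc

theorem frac_exists_le {ι : Type*} [Fintype ι] (P : ι → X → Prop) :
    frac (fun x => ∃ j, P j x) ≤ ∑ j, frac (P j) := by
  simp_rw [frac_eq]
  rw [← Finset.sum_div, Finset.sum_comm]
  gcongr with x
  by_cases h : ∃ j, P j x
  · rw [ind_of h]
    obtain ⟨j, hj⟩ := h
    rw [← ind_of hj]
    exact Finset.single_le_sum (f := fun j => ind (P j x)) (fun j _ => ind_nonneg _) (Finset.mem_univ j)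
  · rw [ind_of_not h]; exact Finset.sum_nonneg fun j _ => ind_nonneg _

theorem frac_swap (P : X × Y → Prop) : frac (fun p : Y × X => P (p.2, p.1)) = frac P :=
  frac_equiv (Equiv.prodComm Y X) P

/-- The exponential moment method for independent uniform samples. -/
theorem frac_sum_ge_le [Nonempty Y] (m : ℕ) (f : Y → ℝ) (a b : ℝ)
    (h : ∑ y, Real.exp (f y) ≤ Real.exp b * Fintype.card Y) :
    frac (fun v : Fin m → Y => a ≤ ∑ k, f (v k)) ≤ Real.exp (m * b - a) := by
  have hc : (0 : ℝ) < Fintype.card (Fin m → Y) := by positivity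
  rw [frac_eq, div_le_iff₀ hc]
  calc ∑ v : Fin m → Y, ind (a ≤ ∑ k, f (v k))
      ≤ ∑ v : Fin m → Y, Real.exp (-a) * ∏ k, Real.exp (f (v k)) := by
        refine Finset.sum_le_sum fun v _ => ?_
        rw [← Real.exp_sum, ← Real.exp_add]
        by_cases hv : a ≤ ∑ k, f (v k)
        · rw [ind_of hv]; exact Real.one_le_exp (by linarith)
        · rw [ind_of_not hv]; positivity
    _ = Real.exp (-a) * (∑ y, Real.exp (f y)) ^ m := by
        rw [← Finset.mul_sum, Fintype.sum_pow]
    _ ≤ Real.exp (-a) * (Real.exp b * Fintype.card Y) ^ m := by gcongr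
    _ = Real.exp (m * b - a) * Fintype.card (Fin m → Y) := by
        rw [mul_pow, ← Real.exp_nat_mul, ← mul_assoc, ← Real.exp_add]
        simp [sub_eq_add_neg, add_comm]

/-- Since `e ≤ 3`, the exponential of an indicator is at most `1 + 2 * ind`, whose mean is at most
`1 + 2μ ≤ exp (2μ)`. -/
theorem frac_many_le [Nonempty Y] (m : ℕ) (P : Y → Prop) {μ : ℝ} (hμ : frac P ≤ μ) (a : ℝ) :
    frac (fun v : Fin m → Y => a ≤ ∑ k, ind (P (v k))) ≤ Real.exp (m * (2 * μ) - a) := by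
  refine frac_sum_ge_le m (fun y => ind (P y)) a _ ?_
  have h1 : ∀ y, Real.exp (ind (P y)) ≤ 1 + 2 * ind (P y) := fun y => by
    by_cases h : P y
    · rw [ind_of h]; linarith [Real.exp_one_lt_d9]
    · rw [ind_of_not h]; simp
  calc ∑ y, Real.exp (ind (P y)) ≤ ∑ y, (1 + 2 * ind (P y)) := Finset.sum_le_sum fun y _ => h1 y
    _ = (1 + 2 * frac P) * Fintype.card Y := by
        rw [Finset.sum_add_distrib, ← Finset.mul_sum, ← frac_mul_card]; simp; ring
    _ ≤ _ := by
        gcongr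
        linarith [Real.add_one_le_exp (2 * μ)]

/-- Since `e⁻¹ ≤ 2/5`, the mean of `exp (-ind)` is at most `1 - 3p/5`. The constant `3/5` exceeds
`1/2`, so the threshold `a = pm/2` still leaves the bound `exp (-pm/10)`. -/
theorem frac_few_le [Nonempty Y] (m : ℕ) (P : Y → Prop) {p : ℝ} (hp : p ≤ frac P) (a : ℝ) :
    frac (fun v : Fin m → Y => ∑ k, ind (P (v k)) ≤ a) ≤ Real.exp (a - 3 / 5 * p * m) := by
  have h := frac_sum_ge_le m (fun y => -ind (P y)) (-a) (-(3 / 5 * p)) ?_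
  · simp only [Finset.sum_neg_distrib, neg_le_neg_iff] at h
    convert h using 2
    ring
  have he : Real.exp (-1) ≤ 2 / 5 := by
    rw [Real.exp_neg]
    rw [inv_le_comm₀ (Real.exp_pos _) (by norm_num)]
    linarith [Real.exp_one_gt_d9]
  have h1 : ∀ y, Real.exp (-ind (P y)) ≤ 1 - 3 / 5 * ind (P y) := fun y => by
    by_cases h : P y
    · rw [ind_of h]; linarith
    · rw [ind_of_not h]; simp
  calc ∑ y, Real.exp (-ind (P y)) ≤ ∑ y, (1 - 3 / 5 * ind (P y)) := Finset.sum_le_sum fun y _ => h1 y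
    _ = (1 - 3 / 5 * frac P) * Fintype.card Y := by
        rw [Finset.sum_sub_distrib, ← Finset.mul_sum, ← frac_mul_card]; simp; ring
    _ ≤ _ := by
        gcongr
        linarith [Real.add_one_le_exp (-(3 / 5 * p))]

end Fractions


/-! ### The recursive evaluation -/

/-- The index set of the random rows sampled at level `s` of the recursion. -/
def Samp (m : ℕ) : ℕ → Type
  | 0 => Empty
  | s + 1 => Fin m × Option (Samp m s)

/-- The index set of the advice used at level `s` of the recursion. -/
def Leaf (m : ℕ) : ℕ → Type
  | 0 => Unit
  | s + 1 => Fin m × Leaf m s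

instance Samp.fintype (m : ℕ) : ∀ s, Fintype (Samp m s)
  | 0 => inferInstanceAs (Fintype Empty)
  | s + 1 => by
    haveI := Samp.fintype m s
    exact inferInstanceAs (Fintype (Fin m × Option (Samp m s)))

instance Leaf.fintype (m : ℕ) : ∀ s, Fintype (Leaf m s)
  | 0 => inferInstanceAs (Fintype Unit)
  | s + 1 => by
    haveI := Leaf.fintype m s
    exact inferInstanceAs (Fintype (Fin m × Leaf m s))

noncomputable instance (m s : ℕ) : DecidableEq (Samp m s) := Classical.decEq _

noncomputable instance (m s : ℕ) : DecidableEq (Leaf m s) := Classical.decEq _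

/-- The added `1` is the index `none` of the sampled row itself; with it the recursion for the
cardinality is a multiplication by `m`. -/
theorem card_samp_le {m : ℕ} (hm : 0 < m) (s : ℕ) : Fintype.card (Samp m s) + 1 ≤ (3 * m) ^ s := by
  induction s with
  | zero =>
    have h : Fintype.card (Samp m 0) = 0 := Fintype.card_empty
    simp [h]
  | succ s ih =>
    have h : Fintype.card (Samp m (s + 1)) = m * (Fintype.card (Samp m s) + 1) := by
      have := Fintype.card_prod (Fin m) (Option (Samp m s))
      rw [Fintype.card_fin, Fintype.card_option] at this
      rw [← this]; rfl
    rw [h, pow_succ]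
    have : 1 ≤ (3 * m) ^ s := Nat.one_le_pow _ _ (by omega)
    nlinarith

theorem card_leaf (m s : ℕ) : Fintype.card (Leaf m s) = m ^ s := by
  induction s with
  | zero => rfl
  | succ s ih =>
    have h : Fintype.card (Leaf m (s + 1)) = m * Fintype.card (Leaf m s) := by
      have := Fintype.card_prod (Fin m) (Leaf m s)
      rw [Fintype.card_fin] at this
      rw [← this]; rfl
    rw [h, ih, pow_succ']

/-- The tapes of level `s + 1` consist of `m` independent pairs of a row and a tape of level `s`. -/
def tapeEquiv (m n s : ℕ) : (Samp m (s + 1) → Fin n) ≃ (Fin m → Fin n × (Samp m s → Fin n)) where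
  toFun ω k := (ω (k, none), fun x => ω (k, some x))
  invFun v x := match x with
    | (k, none) => (v k).1
    | (k, some y) => (v k).2 y
  left_inv ω := by
    funext x
    obtain ⟨k, x⟩ := x
    cases x <;> rfl
  right_inv v := by funext k; rfl

/-- What a list recovery program leaves on its output tape: the closed rows and the last, open, row. -/
structure Recov (F : Type*) (n : ℕ) where
  out : ListString F n → List (List ℕ)
  row : ListString F n → List ℕ

/-- All symbols on the output tape. -/
def Recov.flat {F : Type*} {n : ℕ} (R : Recov F n) (S : ListString F n) (j : ℕ) : ℕ :=
  ((R.out S).flatten ++ R.row S).getD j 0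

/-- The column through coordinate `i` of the level `s` block that starts at `o`. -/
def col {F : Type*} (n : ℕ) (S : ℕ → Finset F) (i s o : ℕ) : ListString F n :=
  fun x => S (o + (x * n ^ s + i % n ^ s))

/-- The number of samples at which row `j` of `fl` disagrees with the values `v`. -/
def disagree {m : ℕ} (n : ℕ) (fl : ℕ → ℕ) (r v : Fin m → ℕ) (j : ℕ) : ℕ :=
  ∑ k, if fl (j * n + r k) = v k then 0 else 1

/-- Symbol `d` of the last of the rows `j, …, c - 1` that disagrees with at most `θ` of the sampled values. -/
def pick {m : ℕ} (n θ d c : ℕ) (fl : ℕ → ℕ) (r v : Fin m → ℕ) : ℕ → ℕ → ℕ → ℕ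
  | 0, _, res => res
  | f + 1, j, res =>
    if j < c then
      pick n θ d c fl r v f (j + 1) (if disagree n fl r v j ≤ θ then fl (j * n + d) else res)
    else res

/-- Several rows may pass the test, so it is only required that all of them carry the same symbol at
position `d`. The disjunction is the loop invariant: the right symbol is already stored, or a
passing row still lies ahead. -/
theorem pick_eq {m : ℕ} {n θ d c : ℕ} {fl : ℕ → ℕ} {r v : Fin m → ℕ} {val : ℕ}
    (h : ∀ j < c, disagree n fl r v j ≤ θ → fl (j * n + d) = val) :
    ∀ f j res, c ≤ j + f → (res = val ∨ ∃ j', j ≤ j' ∧ j' < c ∧ disagree n fl r v j' ≤ θ) →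
      pick n θ d c fl r v f j res = val := by
  intro f
  induction f with
  | zero =>
    rintro j res hc (h1 | ⟨j', h1, h2, -⟩)
    · exact h1
    · omega
  | succ f ih =>
    intro j res hc h1
    rw [pick]
    split_ifs with hj hd
    · exact ih _ _ (by omega) (Or.inl (h j hj hd))
    · refine ih _ _ (by omega) ?_
      rcases h1 with h1 | ⟨j', h1, h2, h3⟩
      · exact Or.inl h1
      · refine Or.inr ⟨j', ?_, h2, h3⟩
        rcases Nat.lt_or_ge j j' with h4 | h4
        · exact h4
        · exact absurd (by rwa [Nat.le_antisymm h1 h4]) hd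
    · rcases h1 with h1 | ⟨j', h1, h2, h3⟩
      · exact h1
      · omega

/-- The value that the local algorithm of level `s` computes at coordinate `i` of the block that starts at
`o`, given the sampled rows `ρ` and the advice `a`. -/
def ev {F : Type*} {n : ℕ} (R : Recov F n) (m θ L : ℕ) (S : ℕ → Finset F) (i : ℕ) :
    (s o : ℕ) → (Samp m s → ℕ) → (Leaf m s → ℕ) → ℕ
  | 0, o, _, a => R.flat (col n S i 0 o) (a () * n + i / n ^ 0 % n)
  | s + 1, o, ρ, a =>
    pick n θ (i / n ^ (s + 1) % n) (R.out (col n S i (s + 1) o)).length (R.flat (col n S i (s + 1) o))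
      (fun k => ρ (k, none))
      (fun k => ev R m θ L S i s (o + ρ (k, none) * n ^ (s + 1)) (fun x => ρ (k, some x))
        (fun x => a (k, x))) L 0 0

/-- A block of level `s` has `n ^ (s + 1)` coordinates, and only the lower digits of `i` enter.
Hence the evaluations inside the sampled rows are the same for all coordinates of one column. -/
theorem ev_mod {F : Type*} {n : ℕ} (R : Recov F n) (m θ L : ℕ) (S : ℕ → Finset F) :
    ∀ (s o : ℕ) (i j : ℕ) (ρ : Samp m s → ℕ) (a : Leaf m s → ℕ), i % n ^ (s + 1) = j % n ^ (s + 1) →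
      ev R m θ L S i s o ρ a = ev R m θ L S j s o ρ a := by
  have hmod : ∀ s i j : ℕ, i % n ^ (s + 1) = j % n ^ (s + 1) → i % n ^ s = j % n ^ s := fun s i j h => by
    have hd : n ^ s ∣ n ^ (s + 1) := pow_dvd_pow _ (by omega)
    rw [← Nat.mod_mod_of_dvd i hd, h, Nat.mod_mod_of_dvd j hd]
  have hdig : ∀ s i j : ℕ, i % n ^ (s + 1) = j % n ^ (s + 1) → i / n ^ s % n = j / n ^ s % n :=
    fun s i j h => by
      rw [← Nat.mod_mul_right_div_self, ← Nat.mod_mul_right_div_self, ← pow_succ, h]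
  have hcol : ∀ s o i j : ℕ, i % n ^ (s + 1) = j % n ^ (s + 1) → col n S i s o = col n S j s o :=
    fun s o i j h => by
      funext x
      rw [col, col, hmod s i j h]
  intro s
  induction s with
  | zero =>
    intro o i j ρ a h
    simp only [ev, hcol 0 o i j h, hdig 0 i j h]
  | succ s ih =>
    intro o i j ρ a h
    have h' := hmod _ _ _ h
    simp only [ev, hcol _ o i j h, hdig _ i j h, ih _ i j _ _ h']

/-- Rows of equal length can be addressed on a tape that does not record where rows end; `r` is the
unfinished last row. -/
theorem flatten_getD {n : ℕ} : ∀ (l : List (List ℕ)) (r : List ℕ), (∀ x ∈ l, x.length = n) →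
    ∀ (j : ℕ) (hj : j < l.length) (x : ℕ), x < n → (l.flatten ++ r).getD (j * n + x) 0 = l[j].getD x 0 := by
  intro l r hl
  induction l with
  | nil => intro j hj; simp at hj
  | cons y l ih =>
    intro j hj x hx
    have hy : y.length = n := hl y (by simp)
    rw [List.flatten_cons, List.append_assoc]
    cases j with
    | zero =>
      rw [List.getD_append _ _ _ _ (by omega)]
      simp
    | succ j =>
      rw [List.getD_append_right _ _ _ _ (by rw [hy]; nlinarith)]
      have : (j + 1) * n + x - y.length = j * n + x := by
        rw [hy]; have : (j + 1) * n = j * n + n := by ring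
        omega
      rw [this, ih (fun z hz => hl z (by simp [hz])) j (by simpa using hj) x hx]
      simp

/-- Splitting a coordinate of a level `s` block into a row and a coordinate in that row. -/
def splitEquiv (n s : ℕ) : Fin n × Fin (n ^ s) ≃ Fin (n ^ (s + 1)) :=
  finProdFinEquiv.trans (finCongr (pow_succ' n s).symm)

theorem splitEquiv_val (n s : ℕ) (p : Fin n × Fin (n ^ s)) :
    (splitEquiv n s p : ℕ) = p.1 * n ^ s + p.2 := by
  simp [splitEquiv, finProdFinEquiv, mul_comm, add_comm]

/-! ### Probabilistic correctness of the recursive evaluation -/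

section Correctness

variable {F : Type*} [Field F] {k n q : ℕ}

/-- The words of the tensor power `C^{⊗(s+1)}`, described by their rows and columns. -/
def InTensor (C : LinCode F k n) : ℕ → (ℕ → F) → Prop
  | 0, w => ∃ x, ∀ i : Fin n, w i = C x i
  | s + 1, w => (∀ y < n ^ (s + 1), ∃ x, ∀ i : Fin n, w (i * n ^ (s + 1) + y) = C x i) ∧
      ∀ r < n, InTensor C s (fun y => w (r * n ^ (s + 1) + y))

/-- `R` is the result of list recovery of `C`. -/
structure Recov.Correct (R : Recov F n) (φ : F ≃ Fin q) (C : LinCode F k n) (α : ℝ) (ℓ L : ℕ) : Prop where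
  length_le : ∀ S : ListString F n, (∀ i, (S i).card = ℓ) → (R.out S).length ≤ L
  codeword : ∀ S : ListString F n, (∀ i, (S i).card = ℓ) → ∀ r ∈ R.out S, ∃ x, r = encodeWord φ (C x)
  mem : ∀ S : ListString F n, (∀ i, (S i).card = ℓ) → ∀ x, listDist (C x) S ≤ α →
    encodeWord φ (C x) ∈ R.out S

variable {R : Recov F n} {φ : F ≃ Fin q} {C : LinCode F k n} {α : ℝ} {ℓ L : ℕ}

theorem Recov.Correct.flat_eq (hR : R.Correct φ C α ℓ L) {S : ListString F n} (hS : ∀ i, (S i).card = ℓ)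
    {j : ℕ} (hj : j < (R.out S).length) {x : Fin k → F} (hx : (R.out S)[j] = encodeWord φ (C x)) (i : Fin n) :
    R.flat S (j * n + i) = φ (C x i) := by
  have h1 : ∀ r ∈ R.out S, r.length = n := fun r hr => by
    obtain ⟨x, rfl⟩ := hR.codeword S hS r hr
    simp [encodeWord]
  rw [Recov.flat, flatten_getD _ _ h1 j hj _ i.2, hx, encodeWord]
  simp [List.getD_eq_getElem?_getD]

theorem Recov.Correct.exists_index (hR : R.Correct φ C α ℓ L) {S : ListString F n}
    (hS : ∀ i, (S i).card = ℓ) {x : Fin k → F} (hx : listDist (C x) S ≤ α) :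
    ∃ j, j < L ∧ j < (R.out S).length ∧ ∀ i : Fin n, R.flat S (j * n + i) = φ (C x i) := by
  obtain ⟨j, hj, h⟩ := List.getElem_of_mem (hR.mem S hS x hx)
  exact ⟨j, hj.trans_le (hR.length_le S hS), hj, hR.flat_eq hS hj h⟩

theorem Recov.Correct.exists_message (hR : R.Correct φ C α ℓ L) {S : ListString F n}
    (hS : ∀ i, (S i).card = ℓ) {j : ℕ} (hj : j < (R.out S).length) :
    ∃ x, ∀ i : Fin n, R.flat S (j * n + i) = φ (C x i) := by
  obtain ⟨x, hx⟩ := hR.codeword S hS _ (List.getElem_mem hj)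
  exact ⟨x, hR.flat_eq hS hj hx⟩

/-- Local list recovery succeeds at level `s`, on blocks that are `A`-close to `S`, up to error `ε`. -/
def LevelCorrect (R : Recov F n) (φ : F ≃ Fin q) (C : LinCode F k n) (m θ L : ℕ) (S : ℕ → Finset F)
    (s : ℕ) (A ε : ℝ) : Prop :=
  ∀ (o : ℕ) (w : ℕ → F), InTensor C s w → frac (fun y : Fin (n ^ (s + 1)) => w y ∉ S (o + y)) ≤ A →
    frac (fun ω : Samp m s → Fin n => ¬∃ a : Leaf m s → Fin L,
      frac (fun i : Fin (n ^ (s + 1)) =>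
        ev R m θ L S i s o (fun x => ω x) (fun x => a x) ≠ φ (w i)) ≤ ε) ≤ ε

/-- Nothing is sampled here: the advice is the position of the codeword in the recovered list, and
then no coordinate is wrong. -/
theorem levelCorrect_zero (hR : R.Correct φ C α ℓ L) {S : ℕ → Finset F} (hS : ∀ i, (S i).card = ℓ)
    {m θ : ℕ} {A ε : ℝ} (hA : A ≤ α) (hε : 0 ≤ ε) : LevelCorrect R φ C m θ L S 0 A ε := by
  intro o w hw hd
  obtain ⟨x, hx⟩ := hw
  have hcol : ∀ i, col n S i 0 o = fun x : Fin n => S (o + x) := fun i => by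
    funext x; simp [col, Nat.mod_one]
  have hdist : listDist (C x) (fun y : Fin n => S (o + y)) ≤ α := by
    refine le_trans (le_of_eq ?_) (hd.trans hA)
    rw [listDist, ← frac_equiv (finCongr (pow_one n).symm)]
    simp [hx]
  obtain ⟨j, hjL, hj, hfl⟩ := hR.exists_index (fun i => hS _) hdist
  refine le_trans (le_of_eq (frac_eq_zero fun ω => ?_)) hε
  rw [not_not]
  refine ⟨fun _ => ⟨j, hjL⟩, le_trans (le_of_eq (frac_eq_zero fun i => ?_)) hε⟩
  rw [not_not]
  have hi : (i : ℕ) < n := lt_of_lt_of_eq i.2 (pow_one n)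
  rw [ev, hcol]
  have := hfl ⟨i, hi⟩
  simp only [pow_zero, Nat.div_one, Nat.mod_eq_of_lt hi]
  rw [this, ← hx ⟨i, hi⟩]

theorem frac_ne_word_ge {δ : ℝ} (hδ : HasRelDist C δ) {x y : Fin k → F} {i : Fin n} (h : C x i ≠ C y i) :
    δ ≤ frac fun i => C x i ≠ C y i :=
  hδ.2 ⟨x, y, fun hxy => h (by rw [hxy]), rfl⟩

theorem disagree_cast {m : ℕ} (fl : ℕ → ℕ) (r v : Fin m → ℕ) (j : ℕ) :
    (disagree n fl r v j : ℝ) = ∑ k, ind (fl (j * n + r k) ≠ v k) := by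
  rw [disagree, Nat.cast_sum]
  refine Finset.sum_congr rfl fun k _ => ?_
  split_ifs with h
  · rw [ind_of_not (not_not.2 h), Nat.cast_zero]
  · rw [ind_of h, Nat.cast_one]

/-- Triangle inequality on the samples. A wrong candidate differs from `C x` at more than `θ + a`
samples, at most `a` of which carry a wrong value, so it disagrees with more than `θ` values and is
rejected. The true candidate disagrees with at most `a < θ + 1` values, hence with at most `θ`, the
count being an integer. -/
theorem Recov.Correct.pick_eq (hR : R.Correct φ C α ℓ L) {S : ListString F n} (hS : ∀ i, (S i).card = ℓ)
    {x : Fin k → F} (hx : listDist (C x) S ≤ α) {m θ : ℕ} {a : ℝ} (r : Fin m → Fin n) (v : Fin m → ℕ)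
    (hv : ∑ k, ind (v k ≠ φ (C x (r k))) ≤ a) (ha : a < θ + 1)
    (hamb : ∀ j z, j < (R.out S).length → (∀ i : Fin n, R.flat S (j * n + i) = φ (C z i)) → C z ≠ C x →
      θ + a < ∑ k, ind (C z (r k) ≠ C x (r k))) (i : Fin n) :
    pick n θ i (R.out S).length (R.flat S) (fun k => r k) v L 0 0 = φ (C x i) := by
  obtain ⟨j₀, hjL, hj₀, hfl⟩ := hR.exists_index hS hx
  refine LLR.pick_eq (fun j hj hd => ?_) L 0 0 (by simpa using hR.length_le S hS)
    (Or.inr ⟨j₀, Nat.zero_le _, hj₀, ?_⟩)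
  · obtain ⟨z, hz⟩ := hR.exists_message hS hj
    rw [hz]
    by_contra hne
    have hzx : C z ≠ C x := fun h => hne (by rw [h])
    have h1 := hamb j z hj hz hzx
    have h2 : (disagree n (R.flat S) (fun k => (r k : ℕ)) v j : ℝ) ≤ θ := by exact_mod_cast hd
    rw [disagree_cast] at h2
    have h3 : ∑ k, ind (C z (r k) ≠ C x (r k)) ≤
        ∑ k, (ind (R.flat S (j * n + r k) ≠ v k) + ind (v k ≠ φ (C x (r k)))) := by
      refine Finset.sum_le_sum fun k _ => le_trans (ind_mono fun h => ?_) (ind_or_le _ _)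
      by_contra hcon
      push Not at hcon
      apply h
      rw [hz] at hcon
      exact φ.injective (Fin.ext (hcon.1.trans hcon.2))
    rw [Finset.sum_add_distrib] at h3
    linarith
  · have h2 : (disagree n (R.flat S) (fun k => (r k : ℕ)) v j₀ : ℝ) < θ + 1 := by
      rw [disagree_cast]
      refine lt_of_le_of_lt (le_trans (Finset.sum_le_sum fun k _ => ind_mono fun h => ?_) hv) ha
      rw [hfl] at h
      exact h.symm
    have h3 : disagree n (R.flat S) (fun k => (r k : ℕ)) v j₀ < θ + 1 := by exact_mod_cast h2
    omega

/-- All coordinates of a column share the candidate list and the sampled values, so one condition on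
the column makes all its entries correct. -/
theorem Recov.Correct.ev_succ_eq (hR : R.Correct φ C α ℓ L) {S : ℕ → Finset F} (hS : ∀ i, (S i).card = ℓ)
    {s o i m θ : ℕ} (hi : i < n ^ (s + 1)) {x : Fin k → F} (hx : listDist (C x) (col n S i (s + 1) o) ≤ α)
    {b : ℝ} (r : Fin m → Fin n) (ρ : Samp m (s + 1) → ℕ) (a : Leaf m (s + 1) → ℕ)
    (hρ : ∀ k, ρ (k, none) = r k)
    (hv : ∑ k, ind (ev R m θ L S i s (o + r k * n ^ (s + 1)) (fun x => ρ (k, some x)) (fun x => a (k, x)) ≠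
      φ (C x (r k))) ≤ b) (hb : b < θ + 1)
    (hamb : ∀ j z, j < (R.out (col n S i (s + 1) o)).length →
      (∀ y : Fin n, R.flat (col n S i (s + 1) o) (j * n + y) = φ (C z y)) → C z ≠ C x →
      θ + b < ∑ k, ind (C z (r k) ≠ C x (r k))) (y : Fin n) :
    ev R m θ L S (y * n ^ (s + 1) + i) (s + 1) o ρ a = φ (C x y) := by
  have hdiv : (y * n ^ (s + 1) + i) / n ^ (s + 1) % n = y := by
    rw [add_comm, Nat.add_mul_div_right _ _ (by omega), Nat.div_eq_of_lt hi, zero_add, Nat.mod_eq_of_lt y.2]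
  have hmod : (y * n ^ (s + 1) + i) % n ^ (s + 1) = i := by
    rw [add_comm, Nat.add_mul_mod_self_right, Nat.mod_eq_of_lt hi]
  have hcol : col n S (y * n ^ (s + 1) + i) (s + 1) o = col n S i (s + 1) o := by
    funext x
    rw [col, col, hmod, Nat.mod_eq_of_lt hi]
  have hsub := fun k => ev_mod R m θ L S s (o + r k * n ^ (s + 1)) (y * n ^ (s + 1) + i) i
    (fun x => ρ (k, some x)) (fun x => a (k, x)) (by rw [hmod, Nat.mod_eq_of_lt hi])
  rw [ev, hcol, hdiv]
  simp only [hρ, hsub]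
  exact hR.pick_eq (fun x => hS _) hx r _ hv hb hamb y

-- Error budget: too many bad samples and too many ambiguous columns cost `ε/2` each in probability
-- over the tape. Given neither, columns far from their lists, columns with many wrong good samples,
-- and ambiguous columns cost `ε/4` each of the coordinates.
set_option maxHeartbeats 1000000 in
theorem levelCorrect_succ (hR : R.Correct φ C α ℓ L) {S : ℕ → Finset F} (hS : ∀ i, (S i).card = ℓ)
    {m θ s : ℕ} {A A' ε ε' δ : ℝ} (hδ : HasRelDist C δ) (hδ0 : 0 < δ) (hn : 0 < n) (hL : 0 < L) (hm : 0 < m)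
    (hα : 0 < α) (hA : 0 < A) (hA' : 0 ≤ A') (hε' : 0 < ε') (hε : 0 < ε)
    (h1 : A' / A + ε' ≤ δ / 32) (h2 : A' ≤ α * (ε / 4)) (h3 : ε' * 8 ≤ δ * (ε / 4))
    (h4 : Real.exp (-(δ * m / 16)) ≤ ε / 2) (h5 : L * Real.exp (-(δ * m / 10)) ≤ ε / 2 * (ε / 4))
    (hθ1 : δ * m / 4 < θ + 1) (hθ2 : θ ≤ δ * m / 4)
    (ih : LevelCorrect R φ C m θ L S s A ε') : LevelCorrect R φ C m θ L S (s + 1) A' ε := by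
  intro o w hw hd
  have : Nonempty (Fin n) := ⟨⟨0, hn⟩⟩
  have : Nonempty (Fin L) := ⟨⟨0, hL⟩⟩
  obtain ⟨hwcol, hwrow⟩ := hw
  set N := n ^ (s + 1) with hN
  have hNpos : 0 < N := pow_pos hn _
  have : Nonempty (Fin N) := ⟨⟨0, hNpos⟩⟩
  have hmR : (0 : ℝ) < m := by exact_mod_cast hm
  -- distances of rows and columns
  set D : Fin n → Fin N → Prop := fun r y => w (r * N + y) ∉ S (o + (r * N + y)) with hD
  have hdp : frac (fun p : Fin n × Fin N => D p.1 p.2) ≤ A' := by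
    refine le_trans (le_of_eq ?_) hd
    rw [← frac_equiv (splitEquiv n (s + 1))]
    simp only [splitEquiv_val, hD, hN]
    rfl
  have hrow : frac (fun r => A < frac (D r)) * A ≤ A' :=
    frac_lt_mul_le (fun r => frac_nonneg _) hA' (by rw [sum_frac_prod]; gcongr)
  have hcol : frac (fun y => α < frac fun r => D r y) * α ≤ A' := by
    refine frac_lt_mul_le (fun r => frac_nonneg _) hA' ?_
    rw [sum_frac_prod (fun y r => D r y), frac_swap (fun p : Fin n × Fin N => D p.1 p.2)]
    gcongr
  -- a single sample
  set good : Fin n × (Samp m s → Fin n) → Prop := fun y => ∃ a : Leaf m s → Fin L,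
    frac (fun i : Fin N => ev R m θ L S i s (o + y.1 * N) (fun x => y.2 x) (fun x => a x)
      ≠ φ (w (y.1 * N + i))) ≤ ε' with hgood
  have hbad : frac (fun y => ¬good y) ≤ δ / 32 := by
    refine le_trans ?_ h1
    have hb1 : frac (fun r => A < frac (D r)) ≤ A' / A := by rwa [le_div_iff₀ hA]
    refine le_trans (frac_mono (Q := fun y => A < frac (D y.1) ∨ (¬A < frac (D y.1) ∧ ¬good y)) ?_)
      (le_trans (frac_or_le _ _) (add_le_add ?_ ?_))
    · intro y hy; tauto
    · rwa [frac_prod_fst (fun r => A < frac (D r))]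
    · refine frac_prod_le (fun r => ?_) hε'.le
      by_cases hr : A < frac (D r)
      · exact (frac_eq_zero fun x hx => hx.1 hr).trans_le hε'.le
      · refine le_trans (frac_mono fun ω hω => hω.2) ?_
        have := ih (o + r * N) (fun y => w (r * N + y)) (hwrow r r.2)
          (by simpa [hD, add_assoc, hN] using not_lt.1 hr)
        exact this
  -- The advice for a sample depends on the sample alone, so one advice serves all columns
  -- simultaneously.
  have hadv : ∀ y, ∃ a : Leaf m s → Fin L, good y →
      frac (fun i : Fin N => ev R m θ L S i s (o + y.1 * N) (fun x => y.2 x) (fun x => a x)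
        ≠ φ (w (y.1 * N + i))) ≤ ε' := fun y => by
    by_cases hy : good y
    · obtain ⟨a, ha⟩ := hy; exact ⟨a, fun _ => ha⟩
    · exact ⟨fun _ => ⟨0, hL⟩, fun h => absurd h hy⟩
  choose adv hadv using hadv
  set wrong : Fin n × (Samp m s → Fin n) → Fin N → Prop := fun y i =>
    ev R m θ L S i s (o + y.1 * N) (fun x => y.2 x) (fun x => adv y x) ≠ φ (w (y.1 * N + i)) with hwrong
  -- the columns
  have hmsg : ∀ i : Fin N, ∃ x, ∀ r : Fin n, w (r * N + i) = C x r := fun i => hwcol i i.2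
  choose X hX using hmsg
  -- Candidates are indexed by `Fin L` for every column, so that the union bound runs over a fixed
  -- set; indices beyond the list get the message `0`, which does no harm.
  have hrows : ∀ (i : Fin N) (j : Fin L), ∃ x, j < (R.out (col n S i (s + 1) o)).length →
      ∀ r : Fin n, R.flat (col n S i (s + 1) o) (j * n + r) = φ (C x r) := fun i j => by
    by_cases hj : (j : ℕ) < (R.out (col n S i (s + 1) o)).length
    · obtain ⟨x, hx⟩ := hR.exists_message (fun x => hS _) hj
      exact ⟨x, fun _ => hx⟩
    · exact ⟨0, fun h => absurd h hj⟩
  choose Z hZ using hrows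
  set amb : Fin N → (Fin m → Fin n × (Samp m s → Fin n)) → Prop := fun i v =>
    ∃ j : Fin L, C (Z i j) ≠ C (X i) ∧
      ∑ k, ind (C (Z i j) (v k).1 ≠ C (X i) (v k).1) ≤ δ * m / 2 with hamb
  have hambp : ∀ i, frac (amb i) ≤ L * Real.exp (-(δ * m / 10)) := fun i => by
    refine le_trans (frac_exists_le _) ?_
    refine le_trans (Finset.sum_le_sum (g := fun _ => Real.exp (-(δ * m / 10))) fun j _ => ?_) (by simp)
    by_cases hj : C (Z i j) = C (X i)
    · exact (frac_eq_zero fun v hv => hv.1 hj).trans_le (Real.exp_pos _).le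
    · obtain ⟨r, hr⟩ := Function.ne_iff.1 hj
      have hfr : δ ≤ frac fun y : Fin n × (Samp m s → Fin n) => C (Z i j) y.1 ≠ C (X i) y.1 := by
        rw [frac_prod_fst fun r => C (Z i j) r ≠ C (X i) r]
        exact frac_ne_word_ge hδ hr
      refine le_trans (frac_mono fun v hv => hv.2) (le_trans (frac_few_le m _ hfr _) ?_)
      apply Real.exp_le_exp.2
      apply le_of_eq; ring
  -- the three bad events
  have hE1 : frac (fun v : Fin m → Fin n × (Samp m s → Fin n) => δ * m / 8 ≤ ∑ k, ind (¬good (v k))) ≤ ε / 2 := by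
    refine le_trans (frac_many_le m _ hbad _) (le_trans (Real.exp_le_exp.2 ?_) h4)
    apply le_of_eq; ring
  have hE2 : frac (fun v => ε / 4 < frac fun i => amb i v) ≤ ε / 2 := by
    have h := frac_lt_mul_le (f := fun v => frac fun i => amb i v) (a := ε / 4)
      (b := L * Real.exp (-(δ * m / 10))) (fun v => frac_nonneg _) (by positivity) ?_
    · have h6 := h.trans h5
      exact le_of_mul_le_mul_right h6 (by positivity)
    · rw [sum_frac_prod (fun v i => amb i v), frac_swap fun p : Fin N × _ => amb p.1 p.2]
      gcongr
      exact frac_prod_le (fun i => hambp i) (by positivity)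
  -- This holds for every tape: each good sample is wrong on at most an `ε'` fraction of the
  -- columns, and Markov's inequality is applied over the columns.
  have hB : ∀ v : Fin m → Fin n × (Samp m s → Fin n),
      frac (fun i => δ * m / 8 < ∑ k, ind (good (v k) ∧ wrong (v k) i)) ≤ ε / 4 := fun v => by
    have h := frac_lt_mul_le (f := fun i => ∑ k, ind (good (v k) ∧ wrong (v k) i)) (a := δ * m / 8)
      (b := m * ε') (fun i => Finset.sum_nonneg fun k _ => ind_nonneg _) (by positivity) ?_
    · have h6 : m * ε' ≤ ε / 4 * (δ * m / 8) := by nlinarith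
      exact le_of_mul_le_mul_right (h.trans h6) (by positivity)
    · rw [Finset.sum_comm]
      calc ∑ k, ∑ i, ind (good (v k) ∧ wrong (v k) i) ≤ ∑ _k : Fin m, ε' * Fintype.card (Fin N) := by
            refine Finset.sum_le_sum fun k _ => ?_
            rw [← frac_mul_card]
            gcongr
            by_cases hk : good (v k)
            · exact le_trans (frac_mono fun i hi => hi.2) (hadv _ hk)
            · exact (frac_eq_zero fun i hi => hk hi.1).trans_le hε'.le
        _ = _ := by simp; ring
  have hcolb : frac (fun y => α < frac fun r => D r y) ≤ ε / 4 := by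
    have := hcol.trans h2
    rw [mul_comm α] at this
    exact le_of_mul_le_mul_right this hα
  rw [← frac_equiv (tapeEquiv m n (s + 0)).symm]
  refine le_trans (frac_mono (Q := fun v => (δ * m / 8 ≤ ∑ k, ind (¬good (v k))) ∨
    (ε / 4 < frac fun i => amb i v)) ?_) (le_trans (frac_or_le _ _) (by linarith))
  intro v hv
  by_contra hcon
  apply hv
  push Not at hcon
  obtain ⟨hc1, hc2⟩ := hcon
  -- The advice of the block is the concatenation of the advices of its samples.
  refine ⟨fun x => adv (v x.1) x.2, ?_⟩
  rw [← frac_equiv (splitEquiv n (s + 1))]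
  rw [← frac_swap]
  refine le_trans (frac_mono (Q := fun p : Fin N × Fin n => ((α < frac fun r => D r p.1) ∨
    (δ * m / 8 < ∑ k, ind (good (v k) ∧ wrong (v k) p.1))) ∨ amb p.1 v) ?_) ?_
  · rintro ⟨i, r⟩ hne
    by_contra hcon
    apply hne
    push Not at hcon
    obtain ⟨⟨g1, g2⟩, g3⟩ := hcon
    have hval := splitEquiv_val n (s + 1) (r, i)
    change ev R m θ L S (splitEquiv n (s + 1) (r, i) : ℕ) (s + 1) o _ _ =
      φ (w (splitEquiv n (s + 1) (r, i) : ℕ))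
    rw [hval]
    -- The bound `δm/4` on the number of wrong values is `δm/8` for the bad samples plus `δm/8` for
    -- the good samples that err on this column.
    refine Eq.trans (hR.ev_succ_eq hS i.2 (x := X i) ?_ (b := δ * m / 4) (fun k => (v k).1) _ _
      (fun k => rfl) ?_ hθ1 ?_ r) (by rw [← hX])
    · refine le_trans (le_of_eq ?_) g1
      rw [listDist]
      congr 1
      funext x
      rw [col, Nat.mod_eq_of_lt i.2, ← hX]
    · calc _ ≤ ∑ k, (ind (¬good (v k)) + ind (good (v k) ∧ wrong (v k) i)) := by
            refine Finset.sum_le_sum fun k _ => le_trans (ind_mono fun h => ?_) (ind_or_le _ _)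
            have hw : wrong (v k) i := by
              intro h'
              apply h
              rw [← hX i]
              exact h'
            by_cases hg : good (v k)
            · exact Or.inr ⟨hg, hw⟩
            · exact Or.inl hg
        _ ≤ _ := by
            rw [Finset.sum_add_distrib]
            linarith
    · intro j z hj hz hne
      have hjL : j < L := hj.trans_le (hR.length_le _ fun x => hS _)
      have hzZ : C z = C (Z i ⟨j, hjL⟩) := by
        funext x
        apply φ.injective
        apply Fin.ext
        rw [← hz, ← hZ i ⟨j, hjL⟩ hj]
      by_contra hle
      apply g3
      refine ⟨⟨j, hjL⟩, hzZ ▸ hne, ?_⟩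
      rw [← hzZ]
      linarith
  · rw [frac_prod_fst (fun i : Fin N => ((α < frac fun r => D r i) ∨
      (δ * m / 8 < ∑ k, ind (good (v k) ∧ wrong (v k) i))) ∨ amb i v)]
    refine le_trans (frac_or_le _ _) ?_
    have h6 := frac_or_le (fun i : Fin N => α < frac fun r => D r i)
      (fun i => δ * m / 8 < ∑ k, ind (good (v k) ∧ wrong (v k) i))
    linarith [hB v]

end Correctness


/-! ### Rows and columns of tensor powers -/

section Tensor

variable {F : Type*} [Field F] {k n k₁ n₁ k₂ n₂ : ℕ}

/-- Bracket the product as `G₁ * (M * G₂ᵀ)`: each column is `G₁` applied to a vector. The rows are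
treated by the other bracketing. -/
theorem tensorCode_col (C₁ : LinCode F k₁ n₁) (C₂ : LinCode F k₂ n₂) (M : Fin (k₁ * k₂) → F) (b : Fin n₂) :
    ∃ x, ∀ a, tensorCode C₁ C₂ M (finProdFinEquiv (a, b)) = C₁ x a := by
  refine ⟨fun c => ((Matrix.of fun a b => M (finProdFinEquiv (a, b))) *
    (LinearMap.toMatrix' C₂).transpose) c b, fun a => ?_⟩
  rw [← LinearMap.toMatrix'_mulVec C₁]
  change (LinearMap.toMatrix' C₁ * (Matrix.of fun a b => M (finProdFinEquiv (a, b))) *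
      (LinearMap.toMatrix' C₂).transpose) (finProdFinEquiv.symm (finProdFinEquiv (a, b))).1
      (finProdFinEquiv.symm (finProdFinEquiv (a, b))).2 = _
  rw [Equiv.symm_apply_apply, Matrix.mul_assoc, Matrix.mul_apply]
  rfl

theorem tensorCode_row (C₁ : LinCode F k₁ n₁) (C₂ : LinCode F k₂ n₂) (M : Fin (k₁ * k₂) → F) (a : Fin n₁) :
    ∃ x, ∀ b, tensorCode C₁ C₂ M (finProdFinEquiv (a, b)) = C₂ x b := by
  refine ⟨(LinearMap.toMatrix' C₁ * (Matrix.of fun a b => M (finProdFinEquiv (a, b)))) a, fun b => ?_⟩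
  rw [← LinearMap.toMatrix'_mulVec C₂]
  change (LinearMap.toMatrix' C₁ * (Matrix.of fun a b => M (finProdFinEquiv (a, b))) *
      (LinearMap.toMatrix' C₂).transpose) (finProdFinEquiv.symm (finProdFinEquiv (a, b))).1
      (finProdFinEquiv.symm (finProdFinEquiv (a, b))).2 = _
  rw [Equiv.symm_apply_apply, Matrix.mul_apply]
  simp only [Matrix.mulVec, dotProduct, Matrix.transpose_apply]
  exact Finset.sum_congr rfl fun j _ => mul_comm _ _

theorem inTensor_tensorPow (C : LinCode F k n) : ∀ (s : ℕ) (x : Fin (k ^ (s + 1)) → F) (w : ℕ → F),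
    (∀ i : Fin (n ^ (s + 1)), w i = tensorPow C (s + 1) x i) → InTensor C s w := by
  intro s
  induction s with
  | zero =>
    intro x w hw
    refine ⟨fun j => x (finCongr (pow_one k).symm j), fun i => ?_⟩
    exact hw (finCongr (pow_one n).symm i)
  | succ s ih =>
    intro x w hw
    have h : ∀ (i : Fin n) (y : Fin (n ^ (s + 1))), w (i * n ^ (s + 1) + y) =
        tensorCode C (tensorPow C (s + 1)) (fun j => x (finCongr (pow_succ' k (s + 1)).symm j))
          (finProdFinEquiv (i, y)) := fun i y => by
      rw [← splitEquiv_val n (s + 1) (i, y), hw]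
      rfl
    refine ⟨fun y hy => ?_, fun r hr => ?_⟩
    · obtain ⟨z, hz⟩ := tensorCode_col C (tensorPow C (s + 1))
        (fun j => x (finCongr (pow_succ' k (s + 1)).symm j)) ⟨y, hy⟩
      exact ⟨z, fun i => (h i ⟨y, hy⟩).trans (hz i)⟩
    · obtain ⟨z, hz⟩ := tensorCode_row C (tensorPow C (s + 1))
        (fun j => x (finCongr (pow_succ' k (s + 1)).symm j)) ⟨r, hr⟩
      exact ih z _ fun i => (h ⟨r, hr⟩ i).trans (hz i)

/-- An average over the columns. A word close to the lists thus forces `C` itself to have a codeword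
close to some string of these lists, which is impossible when list recovery is too fast to write a
codeword. -/
theorem InTensor.exists_close_column {C : LinCode F k n} (hn : 0 < n) {S : ℕ → Finset F} {α : ℝ} {s : ℕ}
    {w : ℕ → F} (hw : InTensor C s w) (hd : frac (fun y : Fin (n ^ (s + 1)) => w y ∉ S y) ≤ α) :
    ∃ (g : Fin n → ℕ) (x : Fin k → F), listDist (C x) (fun i => S (g i)) ≤ α := by
  have : Nonempty (Fin n) := ⟨⟨0, hn⟩⟩
  cases s with
  | zero =>
    obtain ⟨x, hx⟩ := hw
    refine ⟨fun i => i, x, le_trans (le_of_eq ?_) hd⟩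
    rw [listDist, ← frac_equiv (finCongr (pow_one n).symm)]
    simp [hx]
  | succ s =>
    have : Nonempty (Fin (n ^ (s + 1))) := ⟨⟨0, pow_pos hn _⟩⟩
    rw [← frac_equiv (splitEquiv n (s + 1)), ← frac_swap] at hd
    have h := sum_frac_prod fun (y : Fin (n ^ (s + 1))) (r : Fin n) =>
      w (splitEquiv n (s + 1) (r, y)) ∉ S (splitEquiv n (s + 1) (r, y))
    have h2 : ∑ y, (frac fun r : Fin n => w (splitEquiv n (s + 1) (r, y)) ∉ S (splitEquiv n (s + 1) (r, y))) ≤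
        ∑ _y : Fin (n ^ (s + 1)), α := by
      rw [h]
      simp only [Finset.sum_const, Finset.card_univ, nsmul_eq_mul]
      rw [mul_comm]
      gcongr
    obtain ⟨y, -, hy⟩ := Finset.exists_le_of_sum_le Finset.univ_nonempty h2
    obtain ⟨x, hx⟩ := hw.1 y y.2
    refine ⟨fun i => i * n ^ (s + 1) + y, x, le_trans (le_of_eq ?_) hy⟩
    rw [listDist]
    simp only [splitEquiv_val, hx]

/-! ### Iteration over the levels -/

variable {q : ℕ} {R : Recov F n} {φ : F ≃ Fin q} {C : LinCode F k n} {α : ℝ} {ℓ L : ℕ}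

/-- With `u = δ/64`, going up one level divides the error by `u` and multiplies the closeness by
`u`, so a sampled row is bad with probability at most `u + u = δ/32`. The error reaches `ε` at level
`t - 1`. Every level's error is at least `ε * u ^ t`, hence the hypotheses on `m` need to be made
only for that value. -/
theorem levelCorrect (hR : R.Correct φ C α ℓ L) {S : ℕ → Finset F} (hS : ∀ i, (S i).card = ℓ)
    {m θ t : ℕ} {ε δ : ℝ} (hδ : HasRelDist C δ) (hδ0 : 0 < δ) (hδ1 : δ ≤ 1) (hn : 0 < n) (hL : 0 < L)
    (hm : 0 < m) (hα : 0 < α) (hε : 0 < ε) (hε1 : ε ≤ 1)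
    (h4 : Real.exp (-(δ * m / 16)) ≤ ε * (δ / 64) ^ t / 2)
    (h5 : L * Real.exp (-(δ * m / 10)) ≤ (ε * (δ / 64) ^ t) ^ 2 / 8)
    (hθ1 : δ * m / 4 < θ + 1) (hθ2 : θ ≤ δ * m / 4) (s : ℕ) (hs : s < t) :
    LevelCorrect R φ C m θ L S s (α * ε * (δ / 64) ^ (t + s)) (ε * (δ / 64) ^ (t - 1 - s)) := by
  have hu0 : 0 < δ / 64 := by positivity
  have hu1 : δ / 64 ≤ 1 := by linarith
  induction s with
  | zero =>
    refine levelCorrect_zero hR hS ?_ (by positivity)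
    have h1 : (δ / 64) ^ (t + 0) ≤ 1 := pow_le_one₀ hu0.le hu1
    rw [mul_assoc]
    exact mul_le_of_le_one_right hα.le (mul_le_one₀ hε1 (by positivity) h1)
  | succ s ih =>
    obtain ⟨r, hr⟩ : ∃ r, t - 1 - s = r + 1 := ⟨t - 1 - s - 1, by omega⟩
    have hr' : t - 1 - (s + 1) = r := by omega
    have ih := ih (by omega)
    rw [hr] at ih
    rw [hr']
    set u := δ / 64 with hu
    have hδu : δ = 64 * u := by rw [hu]; ring
    have hur : 0 < u ^ r := by positivity
    have hur1 : u ^ r ≤ 1 := pow_le_one₀ hu0.le hu1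
    have htr : u ^ t ≤ u ^ r := pow_le_pow_of_le_one hu0.le hu1 (by omega)
    have hη : ε * u ^ t ≤ ε * u ^ r := by gcongr
    refine levelCorrect_succ hR hS hδ hδ0 hn hL hm hα (by positivity) (by positivity) (by positivity)
      (by positivity) ?_ ?_ ?_ ?_ ?_ hθ1 hθ2 ih
    · have h6 : α * ε * u ^ (t + (s + 1)) / (α * ε * u ^ (t + s)) = u := by
        have : u ^ (t + (s + 1)) = u ^ (t + s) * u := by rw [← pow_succ]; rfl
        rw [this]
        field_simp
      rw [h6, hδu, pow_succ]
      have : ε * (u ^ r * u) ≤ 1 * (1 * u) := by gcongr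
      linarith
    · have h6 : u ^ (t + (s + 1)) ≤ u ^ (r + 1) := pow_le_pow_of_le_one hu0.le hu1 (by omega)
      have h7 : u ^ (r + 1) ≤ u ^ r * (1 / 4) := by
        rw [pow_succ]
        gcongr
        linarith
      calc α * ε * u ^ (t + (s + 1)) ≤ α * ε * (u ^ r * (1 / 4)) := by
            gcongr
            exact h6.trans h7
        _ = α * (ε * u ^ r / 4) := by ring
    · rw [hδu, pow_succ]
      have : 0 ≤ ε * u ^ r * u := by positivity
      linarith
    · exact h4.trans (by linarith)
    · refine h5.trans ?_
      have : (ε * u ^ t) ^ 2 ≤ (ε * u ^ r) ^ 2 := by gcongr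
      linarith

end Tensor


/-! ### Straight-line programs -/

/-- The effect on the memory of an instruction that accesses neither the oracle nor the tapes. -/
def memStep (E : Env) (M : ℕ → ℕ) : Op → ℕ → ℕ
  | .const a v => Function.update M a v
  | .add a b c => Function.update M a (M b + M c)
  | .sub a b c => Function.update M a (M b - M c)
  | .load a b => Function.update M a (M (M b))
  | .store a b => Function.update M (M a) (M b)
  | .read a b => Function.update M a (E.input.getD (M b) 0)
  | _ => M

/-- The instructions that only change the memory and cost one step. -/
def Op.isPure : Op → Bool
  | .query _ _ _ => false
  | .rand _ _ => false
  | .emit _ => false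
  | .endRow => false
  | _ => true

def block (l : List Op) : Prog := l.foldr (fun o p => .seq (.op o) p) .nop

def memRun (E : Env) (M : ℕ → ℕ) (l : List Op) : ℕ → ℕ := l.foldl (memStep E) M

theorem memRun_nil (E : Env) (M : ℕ → ℕ) : memRun E M [] = M := rfl

theorem memRun_cons (E : Env) (M : ℕ → ℕ) (o : Op) (l : List Op) :
    memRun E M (o :: l) = memRun E (memStep E M o) l := rfl

theorem memRun_append (E : Env) (M : ℕ → ℕ) (l l' : List Op) :
    memRun E M (l ++ l') = memRun E (memRun E M l) l' := List.foldl_append ..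

theorem Exec.block {E : Env} : ∀ (l : List Op) (s : State), l.all Op.isPure = true →
    Exec E (block l) s { s with mem := memRun E s.mem l, time := s.time + l.length }
  | [], s, _ => Exec.nop s
  | o :: l, s, h => by
    rw [List.all_cons, Bool.and_eq_true] at h
    have h1 : o.exec E s = { s with mem := memStep E s.mem o, time := s.time + 1 } := by
      cases o <;> first | rfl | simp [Op.isPure] at h
    refine Exec.seq (Exec.op o s) ?_
    change Exec E (LLR.block l) _ _
    convert Exec.block l (o.exec E s) h.2 using 1
    rw [h1]
    simp [memRun_cons, add_comm, add_left_comm]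

/-- `M[r] := 2 ^ κ * M[r]`. -/
def dbl (κ r : ℕ) : List Op := List.replicate κ (.add r r r)

theorem memRun_dbl (E : Env) (κ r : ℕ) (M : ℕ → ℕ) :
    memRun E M (dbl κ r) = Function.update M r (2 ^ κ * M r) := by
  induction κ generalizing M with
  | zero => simp [dbl, memRun_nil]
  | succ κ ih =>
    rw [dbl, List.replicate_succ, memRun_cons]
    change memRun E _ (dbl κ r) = _
    rw [ih]
    simp only [memStep, Function.update_self, Function.update_idem]
    congr 1
    ring

theorem dbl_pure (κ r : ℕ) : (dbl κ r).all Op.isPure = true := by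
  simp [dbl, Op.isPure]

theorem dbl_length (κ r : ℕ) : (dbl κ r).length = κ := by simp [dbl]

/-! ### Relocation of a program

The memory is divided into `K = 2 ^ κ` lanes; cell `a` of lane `g` has the address `K * a + g`.  The cells
`0, …, 9` are scratch registers, and cell `0` is always zero. -/

/-- How a program is relocated: its memory becomes lane `g`, its output tape lane `u`, and its oracle query
at `x < n` becomes a query at the sum of entry `x` of the table in lane `tab` and of register `rq`. -/
structure Reloc where
  κ : ℕ
  n : ℕ
  g : ℕ
  u : ℕ
  tab : ℕ
  rq : ℕ

namespace Reloc

def K (ρ : Reloc) : ℕ := 2 ^ ρ.κ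

def addr (ρ : Reloc) (a : ℕ) : ℕ := ρ.K * a + ρ.g

/-- `M[1] :=` the address of cell `M[b]` of lane `lane`. -/
def addrOps (κ lane b : ℕ) : List Op := .add 1 b 0 :: dbl κ 1 ++ [.const 2 lane, .add 1 1 2]

/-- The simulated program has empty input and a zero random tape, so `read` and `rand` become
constants. Register `4` points to the next free tape cell and register `5` counts closed rows; the
ends of rows are not stored. Queries at or beyond `n` give `0`, in agreement with `listOracle`. -/
def trOp (ρ : Reloc) : Op → Prog
  | .const a v => block [.const (ρ.addr a) v]
  | .add a b c => block [.add (ρ.addr a) (ρ.addr b) (ρ.addr c)]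
  | .sub a b c => block [.sub (ρ.addr a) (ρ.addr b) (ρ.addr c)]
  | .load a b => block (addrOps ρ.κ ρ.g (ρ.addr b) ++ [.load (ρ.addr a) 1])
  | .store a b => block (addrOps ρ.κ ρ.g (ρ.addr a) ++ [.store 1 (ρ.addr b)])
  | .read a _ => block [.const (ρ.addr a) 0]
  | .query a b c => .seq (block [.const 1 ρ.n, .sub 1 1 (ρ.addr b)])
      (.ite 1 (.seq (block (addrOps ρ.κ ρ.tab (ρ.addr b) ++ [.load 1 1, .add 1 1 ρ.rq]))
        (.op (.query (ρ.addr a) 1 (ρ.addr c)))) (block [.const (ρ.addr a) 0]))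
  | .rand a _ => block [.const (ρ.addr a) 0]
  | .emit a => block [.store 4 (ρ.addr a), .const 1 ρ.K, .add 4 4 1]
  | .endRow => block [.const 1 1, .add 5 5 1]

def tr (ρ : Reloc) : Prog → Prog
  | .nop => .nop
  | .op o => ρ.trOp o
  | .seq p q => .seq (ρ.tr p) (ρ.tr q)
  | .ite a p q => .ite (ρ.addr a) (ρ.tr p) (ρ.tr q)
  | .loop a p => .loop (ρ.addr a) (ρ.tr p)

/-- The environment of the relocated program: empty input and the oracle `og`. -/
def guestEnv (og : ℕ → ℕ → ℕ) : Env := ⟨[], og, fun _ => 0, 1⟩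

structure Valid (ρ : Reloc) : Prop where
  hg : 10 ≤ ρ.g
  hu : 10 ≤ ρ.u
  htab : 10 ≤ ρ.tab
  hgK : ρ.g < ρ.K
  huK : ρ.u < ρ.K
  htabK : ρ.tab < ρ.K
  hrqK : ρ.rq < ρ.K
  hrq : 6 ≤ ρ.rq
  hgu : ρ.g ≠ ρ.u
  hgt : ρ.g ≠ ρ.tab
  hut : ρ.u ≠ ρ.tab
  hgr : ρ.g ≠ ρ.rq
  hur : ρ.u ≠ ρ.rq

/-- The memory `M` represents the memory `gm` and the output tape `row`, `out` of the relocated program; it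
agrees with `M₀` elsewhere. -/
structure Rel (ρ : Reloc) (M₀ : ℕ → ℕ) (gm : ℕ → ℕ) (row : List ℕ) (out : List (List ℕ)) (M : ℕ → ℕ) : Prop where
  mem : ∀ a, M (ρ.addr a) = gm a
  tape : ∀ j, M (ρ.K * j + ρ.u) = (out.flatten ++ row).getD j 0
  ptr : M 4 = ρ.K * (out.flatten ++ row).length + ρ.u
  cnt : M 5 = out.length
  frame : ∀ b, (b = 0 ∨ 6 ≤ b) → b % ρ.K ≠ ρ.g → b % ρ.K ≠ ρ.u → M b = M₀ b

section

variable {ρ : Reloc} {M₀ gm M M' : ℕ → ℕ} {row : List ℕ} {out : List (List ℕ)}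

theorem K_pos (ρ : Reloc) : 0 < ρ.K := by unfold K; positivity

theorem addr_mod (h : ρ.Valid) (a : ℕ) : ρ.addr a % ρ.K = ρ.g := by
  rw [addr, Nat.mul_add_mod, Nat.mod_eq_of_lt h.hgK]

theorem addr_ge (h : ρ.Valid) (a : ℕ) : 10 ≤ ρ.addr a := by
  have := h.hg
  unfold addr
  omega

theorem addr_inj {a b : ℕ} (h : ρ.addr a = ρ.addr b) : a = b := by
  have := ρ.K_pos
  unfold addr at h
  exact Nat.eq_of_mul_eq_mul_left this (by omega)

theorem tape_mod (h : ρ.Valid) (j : ℕ) : (ρ.K * j + ρ.u) % ρ.K = ρ.u := by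
  rw [Nat.mul_add_mod, Nat.mod_eq_of_lt h.huK]

theorem addr_ne_tape (h : ρ.Valid) (a j : ℕ) : ρ.addr a ≠ ρ.K * j + ρ.u := fun he =>
  h.hgu (by rw [← addr_mod h a, he, tape_mod h])

theorem Rel.zero (h : ρ.Valid) (hr : ρ.Rel M₀ gm row out M) : M 0 = M₀ 0 := by
  have := h.hg
  have := h.hu
  exact hr.frame 0 (by omega) (by rw [Nat.zero_mod]; omega) (by rw [Nat.zero_mod]; omega)

theorem Rel.set (h : ρ.Valid) (hr : ρ.Rel M₀ gm row out M) {a v : ℕ} (hv : M' (ρ.addr a) = v)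
    (hM : ∀ b, b ≠ 1 → b ≠ 2 → b ≠ ρ.addr a → M' b = M b) :
    ρ.Rel M₀ (Function.update gm a v) row out M' where
  mem b := by
    by_cases hb : b = a
    · subst hb; rw [hv, Function.update_self]
    · rw [Function.update_of_ne hb, hM, hr.mem]
      · have := addr_ge h b; omega
      · have := addr_ge h b; omega
      · exact fun he => hb (addr_inj he)
  tape j := by
    have := h.hu
    rw [hM _ (by omega) (by omega) (addr_ne_tape h a j).symm, hr.tape]
  ptr := by
    have := addr_ge h a
    rw [hM _ (by omega) (by omega) (by omega), hr.ptr]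
  cnt := by
    have := addr_ge h a
    rw [hM _ (by omega) (by omega) (by omega), hr.cnt]
  frame b hb hbg hbu := by
    rw [hM b (by omega) (by omega) (fun he => hbg (by rw [he, addr_mod h])), hr.frame b hb hbg hbu]

end

end Reloc

theorem memRun_addrOps (E : Env) (M : ℕ → ℕ) (κ lane b : ℕ) (h0 : M 0 = 0) (hb : b ≠ 1) :
    memRun E M (Reloc.addrOps κ lane b) =
      Function.update (Function.update M 2 lane) 1 (2 ^ κ * M b + lane) := by
  rw [Reloc.addrOps, List.cons_append, memRun_cons, memRun_append, memRun_dbl]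
  funext x
  simp only [memRun_cons, memRun_nil, memStep, h0]
  by_cases h1 : x = 1
  · subst h1; simp
  · by_cases h2 : x = 2
    · subst h2; simp
    · simp [h1, h2]

theorem addrOps_pure (κ lane b : ℕ) : (Reloc.addrOps κ lane b).all Op.isPure = true := by
  rw [Reloc.addrOps, List.all_append, List.all_cons, dbl_pure]
  rfl

theorem addrOps_length (κ lane b : ℕ) : (Reloc.addrOps κ lane b).length = κ + 3 := by
  simp [Reloc.addrOps, dbl_length]

namespace Reloc

/-- The outcome of the simulation of a part of a run of the relocated program that takes `τ` steps. -/
def Sim (ρ : Reloc) (E : Env) (Q : Finset ℕ) (M₀ : ℕ → ℕ) (p : Prog) (s : State) (τ : ℕ) (gm : ℕ → ℕ)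
    (row : List ℕ) (out : List (List ℕ)) : Prop :=
  ∃ s', Exec E p s s' ∧ ρ.Rel M₀ gm row out s'.mem ∧ s'.row = s.row ∧ s'.out = s.out ∧
    s'.time ≤ s.time + (ρ.κ + 9) * τ ∧ s'.asked ⊆ s.asked ∪ Q

variable {ρ : Reloc} {E : Env} {Q : Finset ℕ} {M₀ : ℕ → ℕ}

theorem Sim.block {l : List Op} (hl : l.all Op.isPure = true) {s : State} (hlen : l.length ≤ ρ.κ + 9)
    {gm : ℕ → ℕ} {row : List ℕ} {out : List (List ℕ)} (h : ρ.Rel M₀ gm row out (memRun E s.mem l)) :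
    ρ.Sim E Q M₀ (LLR.block l) s 1 gm row out :=
  ⟨_, Exec.block l s hl, h, rfl, rfl, by simpa using hlen, Finset.subset_union_left⟩

/-- The most expensive case is a query in range, with `2 + 1 + (κ + 5) + 1 = κ + 9` steps. The table
and the register `rq` lie outside the two lanes that change, so they keep their initial contents
from `M₀`. -/
theorem trOp_sim (hρ : ρ.Valid) (h0 : M₀ 0 = 0) {og : ℕ → ℕ → ℕ} {P : ℕ → ℕ}
    (hP : ∀ x < ρ.n, M₀ (ρ.K * x + ρ.tab) = P x)
    (hog : ∀ x < ρ.n, ∀ j, og x j = E.oracle (P x + M₀ ρ.rq) j) (hog' : ∀ x, ρ.n ≤ x → ∀ j, og x j = 0)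
    (hQ : ∀ x < ρ.n, P x + M₀ ρ.rq ∈ Q) (o : Op) (σ s : State) (hr : ρ.Rel M₀ σ.mem σ.row σ.out s.mem) :
    ρ.Sim E Q M₀ (ρ.trOp o) s 1 (o.exec (guestEnv og) σ).mem (o.exec (guestEnv og) σ).row
        (o.exec (guestEnv og) σ).out ∧ (o.exec (guestEnv og) σ).time = σ.time + 1 := by
  have hM0 : s.mem 0 = 0 := (hr.zero hρ).trans h0
  refine ⟨?_, by cases o <;> rfl⟩
  cases o with
  | const a v =>
    refine Sim.block rfl (by simp) (hr.set hρ (a := a) (v := v) ?_ fun b _ _ hb => ?_)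
    · simp [memRun_cons, memRun_nil, memStep]
    · simp [memRun_cons, memRun_nil, memStep, hb]
  | add a b c =>
    refine Sim.block rfl (by simp) (hr.set hρ (a := a) (v := σ.mem b + σ.mem c) ?_ fun b _ _ hb => ?_)
    · simp [memRun_cons, memRun_nil, memStep, hr.mem]
    · simp [memRun_cons, memRun_nil, memStep, hb]
  | sub a b c =>
    refine Sim.block rfl (by simp) (hr.set hρ (a := a) (v := σ.mem b - σ.mem c) ?_ fun b _ _ hb => ?_)
    · simp [memRun_cons, memRun_nil, memStep, hr.mem]
    · simp [memRun_cons, memRun_nil, memStep, hb]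
  | load a b =>
    have hb := addr_ge hρ b
    refine Sim.block ?_ ?_ (hr.set hρ (a := a) (v := σ.mem (σ.mem b)) ?_ fun c h1 h2 hc => ?_)
    · rw [List.all_append, addrOps_pure]; rfl
    · rw [List.length_append, addrOps_length]; simp
    · rw [memRun_append, memRun_addrOps _ _ _ _ _ hM0 (by omega)]
      have h3 := addr_ge hρ (σ.mem b)
      have h4 : 2 ^ ρ.κ * s.mem (ρ.addr b) + ρ.g = ρ.addr (σ.mem b) := by rw [hr.mem]; rfl
      simp only [memRun_cons, memRun_nil, memStep, Function.update_self, h4]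
      rw [Function.update_of_ne (by omega), Function.update_of_ne (by omega), hr.mem]
    · rw [memRun_append, memRun_addrOps _ _ _ _ _ hM0 (by omega)]
      simp [memRun_cons, memRun_nil, memStep, hc, h1, h2]
  | store a b =>
    have ha := addr_ge hρ a
    have hb := addr_ge hρ b
    have h3 := addr_ge hρ (σ.mem a)
    have hmem : memRun E s.mem (addrOps ρ.κ ρ.g (ρ.addr a) ++ [.store 1 (ρ.addr b)]) =
        Function.update (Function.update (Function.update s.mem 2 ρ.g) 1 (ρ.addr (σ.mem a)))
          (ρ.addr (σ.mem a)) (σ.mem b) := by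
      rw [memRun_append, memRun_addrOps _ _ _ _ _ hM0 (by omega), hr.mem]
      simp only [memRun_cons, memRun_nil, memStep, Function.update_self]
      rw [Function.update_of_ne (show ρ.addr b ≠ 1 by omega),
        Function.update_of_ne (show ρ.addr b ≠ 2 by omega), hr.mem]
      rfl
    refine Sim.block ?_ ?_ (hr.set hρ (a := σ.mem a) (v := σ.mem b) ?_ fun c h1 h2 hc => ?_)
    · rw [List.all_append, addrOps_pure]; rfl
    · rw [List.length_append, addrOps_length]; simp
    · rw [hmem, Function.update_self]
    · rw [hmem]
      simp [hc, h1, h2]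
  | read a b =>
    refine Sim.block rfl (by simp) (hr.set hρ (a := a) (v := (guestEnv og).input.getD (σ.mem b) 0) ?_
      fun b _ _ hb => ?_)
    · simp [memRun_cons, memRun_nil, memStep, guestEnv]
    · simp [memRun_cons, memRun_nil, memStep, hb]
  | rand a b =>
    refine Sim.block rfl (by simp) (hr.set hρ (a := a) (v := (guestEnv og).coin (σ.mem b)) ?_
      fun b _ _ hb => ?_)
    · simp [memRun_cons, memRun_nil, memStep, guestEnv]
    · simp [memRun_cons, memRun_nil, memStep, hb]
  | query a b c =>
    have ha := addr_ge hρ a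
    have hb := addr_ge hρ b
    have hc := addr_ge hρ c
    have hrq := hρ.hrq
    have htab := hρ.htab
    set s₁ : State := { s with mem := memRun E s.mem [.const 1 ρ.n, .sub 1 1 (ρ.addr b)], time := s.time + 2 }
      with hs₁
    have hx₁ : Exec E (LLR.block [.const 1 ρ.n, .sub 1 1 (ρ.addr b)]) s s₁ := Exec.block _ s rfl
    have hm₁ : s₁.mem = Function.update s.mem 1 (ρ.n - σ.mem b) := by
      have : ρ.addr b ≠ 1 := by omega
      simp [hs₁, memRun_cons, memRun_nil, memStep, Function.update_of_ne this, hr.mem]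
    have hset : ∀ M', M' (ρ.addr a) = og (σ.mem b) (σ.mem c) →
        (∀ d, d ≠ 1 → d ≠ 2 → d ≠ ρ.addr a → M' d = s.mem d) →
        ρ.Rel M₀ ((Op.query a b c).exec (guestEnv og) σ).mem σ.row σ.out M' := fun M' h1 h2 =>
      hr.set hρ h1 h2
    by_cases hx : σ.mem b < ρ.n
    · have hrel : ρ.Rel M₀ σ.mem σ.row σ.out s.mem := hr
      have hrq' : s.mem ρ.rq = M₀ ρ.rq := by
        refine hr.frame _ (by omega) ?_ ?_ <;> rw [Nat.mod_eq_of_lt hρ.hrqK]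
        · exact hρ.hgr.symm
        · exact hρ.hur.symm
      have htab' : s.mem (ρ.K * σ.mem b + ρ.tab) = P (σ.mem b) := by
        rw [← hP _ hx]
        refine hr.frame _ (by omega) ?_ ?_ <;> rw [Nat.mul_add_mod, Nat.mod_eq_of_lt hρ.htabK]
        · exact hρ.hgt.symm
        · exact hρ.hut.symm
      set l : List Op := addrOps ρ.κ ρ.tab (ρ.addr b) ++ [.load 1 1, .add 1 1 ρ.rq] with hl
      have hlp : l.all Op.isPure = true := by rw [hl, List.all_append, addrOps_pure]; rfl
      have hll : l.length = ρ.κ + 5 := by rw [hl, List.length_append, addrOps_length]; rfl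
      have hx₂ := Exec.block (E := E) l (s₁.tick 1) hlp
      set s₂ : State := { s₁.tick 1 with
        mem := memRun E (s₁.tick 1).mem l, time := (s₁.tick 1).time + l.length } with hs₂
      have hm₂ : s₂.mem = Function.update (Function.update s.mem 2 ρ.tab) 1 (P (σ.mem b) + M₀ ρ.rq) := by
        change memRun E s₁.mem l = _
        rw [hl, memRun_append, memRun_addrOps _ _ _ _ _ (by rw [hm₁]; simpa using hM0) (by omega), hm₁,
          Function.update_of_ne (show ρ.addr b ≠ 1 by omega), hr.mem]
        change memRun E (Function.update _ 1 (ρ.K * σ.mem b + ρ.tab)) _ = _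
        have h1 : ρ.K * σ.mem b + ρ.tab ≠ 1 := by omega
        have h2 : ρ.K * σ.mem b + ρ.tab ≠ 2 := by omega
        have h3 : ρ.rq ≠ 1 := by omega
        have h4 : ρ.rq ≠ 2 := by omega
        simp only [memRun_cons, memRun_nil, memStep, Function.update_self, Function.update_idem, ne_eq, h1, h2,
          h3, h4, not_false_eq_true, Function.update_of_ne, htab', hrq']
        rw [Function.update_comm (by norm_num), Function.update_idem, Function.update_comm (by norm_num)]
      have hx₃ : Exec E (.op (.query (ρ.addr a) 1 (ρ.addr c))) s₂ _ := Exec.op _ s₂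
      refine ⟨_, Exec.seq hx₁ (Exec.iteTrue ?_ (Exec.seq hx₂ hx₃)), hset _ ?_ ?_, rfl, rfl, ?_, ?_⟩
      · rw [hm₁, Function.update_self]; omega
      · change Function.update s₂.mem _ (E.oracle (s₂.mem 1) (s₂.mem (ρ.addr c))) _ = _
        rw [Function.update_self, hm₂, Function.update_self, Function.update_of_ne (by omega),
          Function.update_of_ne (by omega), hr.mem, hog _ hx]
      · intro d h1 h2 h3
        change Function.update s₂.mem _ _ d = _
        rw [Function.update_of_ne h3, hm₂, Function.update_of_ne h1, Function.update_of_ne h2]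
      · change s.time + 2 + 1 + l.length + 1 ≤ _
        rw [hll]; omega
      · change insert (s₂.mem 1) s.asked ⊆ _
        rw [hm₂, Function.update_self]
        intro y hy
        rcases Finset.mem_insert.1 hy with rfl | hy
        · exact Finset.mem_union_right _ (hQ _ hx)
        · exact Finset.mem_union_left _ hy
    · have hx₂ := Exec.block (E := E) [.const (ρ.addr a) 0] (s₁.tick 1) rfl
      refine ⟨_, Exec.seq hx₁ (Exec.iteFalse ?_ hx₂), hset _ ?_ ?_, rfl, rfl, ?_, Finset.subset_union_left⟩
      · rw [hm₁, Function.update_self]; omega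
      · change Function.update s₁.mem _ _ _ = _
        rw [Function.update_self, hog' _ (by omega)]
      · intro d h1 h2 h3
        change Function.update s₁.mem _ _ d = _
        rw [Function.update_of_ne h3, hm₁, Function.update_of_ne h1]
      · change s.time + 2 + 1 + 1 ≤ _
        omega
  | emit a =>
    have ha := addr_ge hρ a
    have hu := hρ.hu
    have hmem : memRun E s.mem [.store 4 (ρ.addr a), .const 1 ρ.K, .add 4 4 1] =
        Function.update (Function.update (Function.update s.mem (s.mem 4) (σ.mem a)) 1 ρ.K) 4
          (s.mem 4 + ρ.K) := by
      have h1 : (4 : ℕ) ≠ s.mem 4 := by rw [hr.ptr]; omega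
      simp [memRun_cons, memRun_nil, memStep, hr.mem, Function.update_of_ne h1]
    refine Sim.block rfl (by simp) ?_
    rw [hmem, hr.ptr]
    change ρ.Rel M₀ σ.mem (σ.row ++ [σ.mem a]) σ.out _
    set len := (σ.out.flatten ++ σ.row).length with hlen
    refine ⟨fun b => ?_, fun j => ?_, ?_, ?_, fun b hb hbg hbu => ?_⟩
    · have := addr_ge hρ b
      rw [Function.update_of_ne (by omega), Function.update_of_ne (by omega),
        Function.update_of_ne (addr_ne_tape hρ b _), hr.mem]
    · rw [Function.update_of_ne (by omega), Function.update_of_ne (by omega), ← List.append_assoc]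
      by_cases hj : j = len
      · subst hj
        rw [Function.update_self, List.getD_append_right _ _ _ _ le_rfl, Nat.sub_self]
        rfl
      · have hne : ρ.K * j + ρ.u ≠ ρ.K * len + ρ.u := fun he =>
          hj (Nat.eq_of_mul_eq_mul_left ρ.K_pos (by omega))
        rw [Function.update_of_ne hne, hr.tape]
        rcases Nat.lt_or_gt_of_ne hj with h | h
        · rw [List.getD_append _ _ _ _ h]
        · rw [List.getD_eq_default _ _ (by omega), List.getD_eq_default _ _ (by simp at hlen ⊢; omega)]
    · rw [Function.update_self, ← List.append_assoc, List.length_append]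
      simp only [List.length_singleton, ← hlen]
      ring
    · rw [Function.update_of_ne (by omega), Function.update_of_ne (by omega),
        Function.update_of_ne (by omega), hr.cnt]
    · rw [Function.update_of_ne (by omega), Function.update_of_ne (by omega),
        Function.update_of_ne (fun he => hbu (by rw [he, tape_mod hρ])), hr.frame b hb hbg hbu]
  | endRow =>
    have hmem : memRun E s.mem [.const 1 1, .add 5 5 1] =
        Function.update (Function.update s.mem 1 1) 5 (s.mem 5 + 1) := by
      simp [memRun_cons, memRun_nil, memStep]
    refine Sim.block rfl (by simp) ?_
    rw [hmem]
    change ρ.Rel M₀ σ.mem [] (σ.out ++ [σ.row]) _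
    have hu := hρ.hu
    have hfl : (σ.out ++ [σ.row]).flatten ++ [] = σ.out.flatten ++ σ.row := by simp
    refine ⟨fun b => ?_, fun j => ?_, ?_, ?_, fun b hb hbg hbu => ?_⟩
    · have := addr_ge hρ b
      rw [Function.update_of_ne (by omega), Function.update_of_ne (by omega), hr.mem]
    · rw [Function.update_of_ne (by omega), Function.update_of_ne (by omega), hfl, hr.tape]
    · rw [Function.update_of_ne (by omega), Function.update_of_ne (by omega), hfl, hr.ptr]
    · rw [Function.update_self, hr.cnt, List.length_append]
      rfl
    · rw [Function.update_of_ne (by omega), Function.update_of_ne (by omega), hr.frame b hb hbg hbu]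

/-- The number `τ` is the exact length of the simulated run, which turns a time bound for the
original program into one for its translation. All queries stay in the fixed set `Q`, so repeated
queries do not increase the count. -/
theorem tr_sim (hρ : ρ.Valid) (h0 : M₀ 0 = 0) {og : ℕ → ℕ → ℕ} {P : ℕ → ℕ}
    (hP : ∀ x < ρ.n, M₀ (ρ.K * x + ρ.tab) = P x)
    (hog : ∀ x < ρ.n, ∀ j, og x j = E.oracle (P x + M₀ ρ.rq) j) (hog' : ∀ x, ρ.n ≤ x → ∀ j, og x j = 0)
    (hQ : ∀ x < ρ.n, P x + M₀ ρ.rq ∈ Q) {p : Prog} {σ σ' : State} (hx : Exec (guestEnv og) p σ σ') :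
    ∃ τ, σ'.time = σ.time + τ ∧ ∀ s : State, ρ.Rel M₀ σ.mem σ.row σ.out s.mem →
      ρ.Sim E Q M₀ (ρ.tr p) s τ σ'.mem σ'.row σ'.out := by
  induction hx with
  | nop σ =>
    exact ⟨0, rfl, fun s hr => ⟨s, Exec.nop s, hr, rfl, rfl, le_rfl, Finset.subset_union_left⟩⟩
  | op o σ =>
    refine ⟨1, ?_, fun s hr => (trOp_sim hρ h0 hP hog hog' hQ o σ s hr).1⟩
    cases o <;> rfl
  | seq _ _ ih₁ ih₂ =>
    obtain ⟨τ₁, ht₁, h₁⟩ := ih₁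
    obtain ⟨τ₂, ht₂, h₂⟩ := ih₂
    refine ⟨τ₁ + τ₂, by omega, fun s hr => ?_⟩
    obtain ⟨s₁, hx₁, hr₁, hrow₁, hout₁, htime₁, hask₁⟩ := h₁ s hr
    obtain ⟨s₂, hx₂, hr₂, hrow₂, hout₂, htime₂, hask₂⟩ := h₂ s₁ hr₁
    refine ⟨s₂, Exec.seq hx₁ hx₂, hr₂, hrow₂.trans hrow₁, hout₂.trans hout₁, ?_, ?_⟩
    · rw [mul_add]; omega
    · exact hask₂.trans (Finset.union_subset hask₁ Finset.subset_union_right)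
  | iteTrue ha _ ih =>
    obtain ⟨τ, ht, h⟩ := ih
    refine ⟨1 + τ, by rw [ht]; simp [State.tick, add_assoc], fun s hr => ?_⟩
    obtain ⟨s₁, hx₁, hr₁, hrow₁, hout₁, htime₁, hask₁⟩ := h (s.tick 1) hr
    refine ⟨s₁, Exec.iteTrue (by rwa [hr.mem]) hx₁, hr₁, hrow₁, hout₁, ?_, hask₁⟩
    simp only [State.tick] at htime₁
    rw [mul_add]; omega
  | iteFalse ha _ ih =>
    obtain ⟨τ, ht, h⟩ := ih
    refine ⟨1 + τ, by rw [ht]; simp [State.tick, add_assoc], fun s hr => ?_⟩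
    obtain ⟨s₁, hx₁, hr₁, hrow₁, hout₁, htime₁, hask₁⟩ := h (s.tick 1) hr
    refine ⟨s₁, Exec.iteFalse (by rwa [hr.mem]) hx₁, hr₁, hrow₁, hout₁, ?_, hask₁⟩
    simp only [State.tick] at htime₁
    rw [mul_add]; omega
  | loopStop ha =>
    refine ⟨1, rfl, fun s hr => ⟨s.tick 1, Exec.loopStop (by rwa [hr.mem]), hr, rfl, rfl, ?_,
      Finset.subset_union_left⟩⟩
    simp only [State.tick]
    omega
  | loopStep ha _ _ ih₁ ih₂ =>
    obtain ⟨τ₁, ht₁, h₁⟩ := ih₁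
    obtain ⟨τ₂, ht₂, h₂⟩ := ih₂
    refine ⟨1 + τ₁ + τ₂, by rw [ht₂, ht₁]; simp [State.tick]; omega, fun s hr => ?_⟩
    obtain ⟨s₁, hx₁, hr₁, hrow₁, hout₁, htime₁, hask₁⟩ := h₁ (s.tick 1) hr
    obtain ⟨s₂, hx₂, hr₂, hrow₂, hout₂, htime₂, hask₂⟩ := h₂ s₁ hr₁
    refine ⟨s₂, Exec.loopStep (by rwa [hr.mem]) hx₁ hx₂, hr₂, hrow₂.trans hrow₁, hout₂.trans hout₁, ?_, ?_⟩
    · simp only [State.tick] at htime₁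
      rw [mul_add, mul_add]; omega
    · exact hask₂.trans (Finset.union_subset hask₁ Finset.subset_union_right)

end Reloc


/-! ### Program verification -/

/-- Started with memory `M`, the program `p` halts after at most `τ` steps and at most `a` new queried
coordinates, leaves the output tape alone, and its final memory satisfies `Q`. -/
def Tri (E : Env) (p : Prog) (M : ℕ → ℕ) (τ a : ℕ) (Q : (ℕ → ℕ) → Prop) : Prop :=
  ∀ s : State, s.mem = M → ∃ s', Exec E p s s' ∧ Q s'.mem ∧ s'.row = s.row ∧ s'.out = s.out ∧
    s'.time ≤ s.time + τ ∧ s'.asked.card ≤ s.asked.card + a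

section

variable {E : Env} {p q : Prog} {M : ℕ → ℕ} {τ τ' a a' : ℕ} {Q Q' : (ℕ → ℕ) → Prop}

theorem Tri.mono (h : Tri E p M τ a Q) (hτ : τ ≤ τ') (ha : a ≤ a') (hQ : ∀ M', Q M' → Q' M') :
    Tri E p M τ' a' Q' := fun s hs => by
  obtain ⟨s', h1, h2, h3, h4, h5, h6⟩ := h s hs
  exact ⟨s', h1, hQ _ h2, h3, h4, by omega, by omega⟩

theorem Tri.nop (h : Q M) : Tri E .nop M 0 0 Q := fun s hs =>
  ⟨s, Exec.nop s, hs ▸ h, rfl, rfl, le_rfl, le_rfl⟩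

theorem Tri.block {l : List Op} (hl : l.all Op.isPure = true) (h : Q (memRun E M l)) :
    Tri E (block l) M l.length 0 Q := fun s hs =>
  ⟨_, Exec.block l s hl, hs ▸ h, rfl, rfl, le_rfl, le_rfl⟩

theorem Tri.seq (h : Tri E p M τ a Q) (h' : ∀ M', Q M' → Tri E q M' τ' a' Q') :
    Tri E (.seq p q) M (τ + τ') (a + a') Q' := fun s hs => by
  obtain ⟨s₁, h1, h2, h3, h4, h5, h6⟩ := h s hs
  obtain ⟨s₂, g1, g2, g3, g4, g5, g6⟩ := h' _ h2 s₁ rfl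
  exact ⟨s₂, Exec.seq h1 g1, g2, g3.trans h3, g4.trans h4, by omega, by omega⟩

theorem Tri.seq_block {l : List Op} (hl : l.all Op.isPure = true) (h : Tri E q (memRun E M l) τ a Q) :
    Tri E (.seq (LLR.block l) q) M (l.length + τ) a Q :=
  ((Tri.block (Q := fun M' => M' = memRun E M l) hl rfl).seq fun M' hM' => by rw [hM']; exact h).mono le_rfl
    (Nat.zero_add _).le fun _ h => h

theorem Tri.ite {c : ℕ} (h : M c ≠ 0 → Tri E p M τ a Q) (h' : M c = 0 → Tri E q M τ a Q) :
    Tri E (.ite c p q) M (τ + 1) a Q := fun s hs => by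
  by_cases hc : M c = 0
  · obtain ⟨s', h1, h2, h3, h4, h5, h6⟩ := h' hc (s.tick 1) hs
    refine ⟨s', Exec.iteFalse (by rwa [hs]) h1, h2, h3, h4, ?_, h6⟩
    simp only [State.tick] at h5; omega
  · obtain ⟨s', h1, h2, h3, h4, h5, h6⟩ := h hc (s.tick 1) hs
    refine ⟨s', Exec.iteTrue (by rwa [hs]) h1, h2, h3, h4, ?_, h6⟩
    simp only [State.tick] at h5; omega

end

/-- The programs `f 0`, …, `f (m - 1)` one after the other. -/
def forFin : (m : ℕ) → (Fin m → Prog) → Prog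
  | 0, _ => .nop
  | m + 1, f => .seq (forFin m fun k => f k.castSucc) (f (Fin.last m))

theorem Tri.forFin {E : Env} {τ a : ℕ} (I : ℕ → (ℕ → ℕ) → Prop) : ∀ {m : ℕ} {f : Fin m → Prog} {M : ℕ → ℕ},
    I 0 M → (∀ (k : Fin m) (M' : ℕ → ℕ), I k M' → Tri E (f k) M' τ a (I (k + 1))) →
      Tri E (forFin m f) M (m * τ) (m * a) (I m)
  | 0, f, M, h0, _ => (Tri.nop h0).mono (by omega) (by omega) fun _ h => h
  | m + 1, f, M, h0, h => by
    refine ((Tri.forFin I h0 fun k M' hk => h k.castSucc M' hk).seq fun M' hM' =>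
      h (Fin.last m) M' hM').mono ?_ ?_ fun _ h => h
    · rw [Nat.add_mul, Nat.one_mul]
    · rw [Nat.add_mul, Nat.one_mul]

/-! ### The local algorithm -/

/-- The data from which the local algorithm is built. -/
structure Params where
  κ : ℕ
  n : ℕ
  m : ℕ
  θ : ℕ
  L : ℕ
  G : Prog

namespace Params

def K (P : Params) : ℕ := 2 ^ P.κ

/-- The lane of the table of the multiples of `n ^ s`. -/
def tab (s : ℕ) : ℕ := 10 + 3 * s

/-- The register of the residue of the coordinate modulo `n ^ s`. -/
def suf (s : ℕ) : ℕ := 11 + 3 * s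

/-- The register of `K` times the digit of weight `n ^ s` of the coordinate. -/
def dig (s : ℕ) : ℕ := 12 + 3 * s

/-- How `G` is relocated at level `s` in the frame at lane `b`. -/
def reloc (P : Params) (s b : ℕ) : Reloc := ⟨P.κ, P.n, b + 1, b + 2, tab s, b + 5⟩

/-- Run `G` on the column of the level `s` block whose offset is in register `ro`. -/
def runG (P : Params) (s b ro : ℕ) : Prog :=
  .seq (block [.const 4 (b + 2), .const 5 0, .add (b + 5) ro (suf s)])
    (.seq ((P.reloc s b).tr P.G) (block [.add (b + 4) 5 0]))

/-- `M[1] :=` the address of the cell of lane `lane` whose number is at position `pos` of the input. -/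
def readOps (κ pos lane : ℕ) : List Op :=
  [.const 1 pos, .read 1 1] ++ (dbl κ 1 ++ [.const 2 lane, .add 1 1 2])

/-- The number of lanes that level `s` uses. -/
def size (P : Params) : ℕ → ℕ
  | 0 => 6
  | s + 1 => 6 + P.m * size P s

/-- Add one to `M[6]` if row `j` disagrees with register `v` at the position given by the input. -/
def cmp (P : Params) (b j pos v : ℕ) : Prog :=
  .seq (block (readOps P.κ pos (P.K * (j * P.n) + (b + 2)) ++ [.load 1 1, .sub 2 1 v, .sub 3 v 1, .add 2 2 3]))
    (.ite 2 (block [.const 1 1, .add 6 6 1]) .nop)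

/-- Take the symbol of row `j` if the row disagrees with at most `θ` sampled values. -/
def proc (P : Params) (s b : ℕ) (pos v : Fin P.m → ℕ) (j : ℕ) : Prog :=
  .seq (block [.const 6 0]) (.seq (forFin P.m fun k => P.cmp b j (pos k) (v k))
    (.seq (block [.const 1 (P.θ + 1), .sub 1 1 6])
      (.ite 1 (block [.const 1 (P.K * (j * P.n) + (b + 2)), .add 1 1 (dig s), .load b 1]) .nop)))

def sel (P : Params) (s b : ℕ) (pos v : Fin P.m → ℕ) : ℕ → ℕ → Prog
  | 0, _ => .nop
  | f + 1, j => .seq (block [.const 1 j, .sub 1 (b + 4) 1])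
      (.ite 1 (.seq (P.proc s b pos v j) (sel P s b pos v f (j + 1))) .nop)

/-- The local algorithm of level `s` in the frame at lane `b`, on the block whose offset is in register `ro`;
`pos` and `lpos` are the positions of the sampled rows and of the advice in the input. -/
def evalProg (P : Params) : (s : ℕ) → (b ro : ℕ) → (Samp P.m s → ℕ) → (Leaf P.m s → ℕ) → Prog
  | 0, b, ro, _, lpos => .seq (P.runG 0 b ro)
      (block [.const 1 (lpos ()), .read 1 1, .add 1 1 (dig 0), .const 2 (b + 2), .add 1 1 2, .load b 1])
  | s + 1, b, ro, pos, lpos => .seq (P.runG (s + 1) b ro)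
      (.seq (forFin P.m fun k =>
        .seq (block (readOps P.κ (pos (k, none)) (tab (s + 1)) ++ [.load 1 1, .add (b + 3) ro 1]))
          (evalProg P s (b + 6 + k * P.size s) (b + 3) (fun x => pos (k, some x)) (fun x => lpos (k, x))))
        (P.sel (s + 1) b (fun k => pos (k, none)) (fun k => b + 6 + k * P.size s) P.L 0))

/-- The registers and tables that are set up at the start. -/
structure BaseMem (P : Params) (t i : ℕ) (M : ℕ → ℕ) : Prop where
  zero : M 0 = 0
  tab : ∀ s < t, ∀ x < P.n, M (P.K * x + tab s) = x * P.n ^ s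
  suf : ∀ s < t, M (suf s) = i % P.n ^ s
  dig : ∀ s < t, M (dig s) = P.K * (i / P.n ^ s % P.n)

/-- All lanes from `b` on are zero. -/
def Fresh (P : Params) (b : ℕ) (M : ℕ → ℕ) : Prop := ∀ a, b ≤ a % P.K → M a = 0

/-- `M` and `M'` agree below lane `b`, apart from the scratch registers. -/
def Same (P : Params) (b : ℕ) (M M' : ℕ → ℕ) : Prop := ∀ a, (a = 0 ∨ 10 ≤ a) → a % P.K < b → M' a = M a

/-- `G` halts within `T` steps on the columns through `i`, with result `R`, if it has access to them through
the oracle of `E`. -/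
def Simulates {F : Type*} (P : Params) (E : Env) (R : Recov F P.n) (S : ℕ → Finset F) (i t T : ℕ) : Prop :=
  ∀ s o, s < t → o + P.n ^ (s + 1) ≤ P.n ^ t → ∃ (og : ℕ → ℕ → ℕ) (σ : State),
    Halts (Reloc.guestEnv og) P.G σ ∧ σ.out = R.out (col P.n S i s o) ∧ σ.row = R.row (col P.n S i s o) ∧
    σ.time ≤ T ∧ σ.out.length ≤ T ∧
    (∀ x < P.n, ∀ j, og x j = E.oracle (x * P.n ^ s + (o + i % P.n ^ s)) j) ∧ ∀ x, P.n ≤ x → ∀ j, og x j = 0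

theorem K_pos (P : Params) : 0 < P.K := by unfold K; positivity

theorem size_pos (P : Params) (s : ℕ) : 6 ≤ P.size s := by cases s <;> simp [size]

theorem lane_mod {P : Params} {g : ℕ} (hg : g < P.K) (a : ℕ) : (P.K * a + g) % P.K = g := by
  rw [Nat.mul_add_mod, Nat.mod_eq_of_lt hg]

theorem BaseMem.of_same {P : Params} {t i b : ℕ} {M M' : ℕ → ℕ} (hB : P.BaseMem t i M) (h : P.Same b M M')
    (hb : 10 + 3 * t ≤ b) (hK : b < P.K) : P.BaseMem t i M' where
  zero := by rw [h 0 (Or.inl rfl) (by rw [Nat.zero_mod]; omega), hB.zero]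
  tab s hs x hx := by
    have : Params.tab s < b := by unfold Params.tab; omega
    rw [h _ (Or.inr (by unfold Params.tab; omega)) (by rw [lane_mod (by omega)]; exact this), hB.tab s hs x hx]
  suf s hs := by
    have : Params.suf s < b := by unfold Params.suf; omega
    rw [h _ (Or.inr (by unfold Params.suf; omega)) (by rw [Nat.mod_eq_of_lt (by omega)]; exact this), hB.suf s hs]
  dig s hs := by
    have : Params.dig s < b := by unfold Params.dig; omega
    rw [h _ (Or.inr (by unfold Params.dig; omega)) (by rw [Nat.mod_eq_of_lt (by omega)]; exact this), hB.dig s hs]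

section

variable {F : Type*} {P : Params} {E : Env} {R : Recov F P.n} {S : ℕ → Finset F} {i t T : ℕ}

theorem reloc_valid {s b : ℕ} (hs : s < t) (hb : 10 + 3 * t ≤ b) (hK : b + 6 ≤ P.K) :
    (P.reloc s b).Valid where
  hg := show 10 ≤ b + 1 by omega
  hu := show 10 ≤ b + 2 by omega
  htab := show 10 ≤ 10 + 3 * s by omega
  hgK := show b + 1 < P.K by omega
  huK := show b + 2 < P.K by omega
  htabK := show 10 + 3 * s < P.K by omega
  hrqK := show b + 5 < P.K by omega
  hrq := show 6 ≤ b + 5 by omega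
  hgu := show b + 1 ≠ b + 2 by omega
  hgt := show b + 1 ≠ 10 + 3 * s by omega
  hut := show b + 2 ≠ 10 + 3 * s by omega
  hgr := show b + 1 ≠ b + 5 by omega
  hur := show b + 2 ≠ b + 5 by omega

/-- The frame at lane `b` consists of: `b` the result, `b + 1` the memory of `G`, `b + 2` its output
tape, `b + 3` the offset of the current sampled row, `b + 4` the number of closed rows, `b + 5` the
base added to every query. `G` has to start from zero memory; `Fresh` records that the lanes of this
frame have not been used. -/
theorem runG_tri (hG : P.Simulates E R S i t T) {s b ro o : ℕ} (hs : s < t) (hb : 10 + 3 * t ≤ b)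
    (hK : b + 6 ≤ P.K) (hro : 10 ≤ ro) (hrob : ro < b) (ho : o + P.n ^ (s + 1) ≤ P.n ^ t) {M : ℕ → ℕ}
    (hB : P.BaseMem t i M) (hF : P.Fresh b M) (hMo : M ro = o) :
    Tri E (P.runG s b ro) M ((P.κ + 9) * T + 4) P.n fun M' => P.Same b M M' ∧ P.Fresh (b + 6) M' ∧ M' b = 0 ∧
      (∀ j, M' (P.K * j + (b + 2)) = R.flat (col P.n S i s o) j) ∧
      M' (b + 4) = (R.out (col P.n S i s o)).length := by
  obtain ⟨og, σ, hx, hout, hrow, htime, hlen, hog, hog'⟩ := hG s o hs ho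
  have hv : (P.reloc s b).Valid := reloc_valid hs hb hK
  have hKe : (P.reloc s b).K = P.K := rfl
  set M₁ := memRun E M [.const 4 (b + 2), .const 5 0, .add (b + 5) ro (suf s)] with hM₁
  have hsuf : suf s ≠ 4 ∧ suf s ≠ 5 := by unfold suf; omega
  have hM₁e : M₁ = Function.update (Function.update (Function.update M 4 (b + 2)) 5 0) (b + 5)
      (o + i % P.n ^ s) := by
    rw [hM₁]
    simp only [memRun_cons, memRun_nil, memStep]
    rw [Function.update_of_ne (show ro ≠ 5 by omega), Function.update_of_ne (show ro ≠ 4 by omega),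
      Function.update_of_ne hsuf.2, Function.update_of_ne hsuf.1, hMo, hB.suf s hs]
  have hlow : ∀ a, a ≠ 4 → a ≠ 5 → a ≠ b + 5 → M₁ a = M a := fun a h1 h2 h3 => by
    rw [hM₁e, Function.update_of_ne h3, Function.update_of_ne h2, Function.update_of_ne h1]
  have hrqv : M₁ (b + 5) = o + i % P.n ^ s := by rw [hM₁e, Function.update_self]
  have h5m : (b + 5) % P.K = b + 5 := Nat.mod_eq_of_lt (by omega)
  have h0 : M₁ 0 = 0 := by rw [hlow 0 (by omega) (by omega) (by omega), hB.zero]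
  have hrel : (P.reloc s b).Rel M₁ (fun _ => 0) [] [] M₁ := by
    refine ⟨fun a => ?_, fun j => ?_, ?_, ?_, fun _ _ _ _ => rfl⟩
    · have hm := Reloc.addr_mod hv a
      have hge := Reloc.addr_ge hv a
      rw [hKe] at hm
      change _ = b + 1 at hm
      rw [hlow _ (by omega) (by omega) (fun he => by rw [he, h5m] at hm; omega), hF _ (by omega)]
    · have hm := Reloc.tape_mod hv j
      rw [hKe] at hm
      change (P.K * j + (b + 2)) % _ = b + 2 at hm
      change M₁ (P.K * j + (b + 2)) = _
      rw [hlow _ (by omega) (by omega) (fun he => by rw [he, h5m] at hm; omega), hF _ (by omega)]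
      simp
    · rw [hM₁e, Function.update_of_ne (by omega), Function.update_of_ne (by omega), Function.update_self]
      simp [reloc]
    · rw [hM₁e, Function.update_of_ne (by omega), Function.update_self]
      rfl
  have htabx : ∀ x < P.n, M₁ (P.K * x + tab s) = x * P.n ^ s := fun x hx => by
    have htm : (P.K * x + tab s) % P.K = tab s := lane_mod (by unfold tab; omega) x
    rw [hlow _ (by unfold tab; omega) (by unfold tab; omega) (fun he => ?_), hB.tab s hs x hx]
    rw [he, h5m] at htm
    unfold tab at htm; omega
  -- The queries all lie in one column, so they touch at most `n` coordinates however often `G`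
  -- asks.
  set Qs : Finset ℕ := (Finset.range P.n).image fun x => x * P.n ^ s + (o + i % P.n ^ s) with hQs
  have hQc : Qs.card ≤ P.n := Finset.card_image_le.trans (by simp)
  have hrq' : M₁ (P.reloc s b).rq = o + i % P.n ^ s := hrqv
  obtain ⟨τ, hτ, hsim⟩ := Reloc.tr_sim (ρ := P.reloc s b) (E := E) (Q := Qs) (M₀ := M₁) hv h0
    (P := fun x => x * P.n ^ s) htabx (og := og)
    (fun x hx j => by rw [hrq']; exact hog x hx j) hog'
    (fun x hx => by
      rw [hrq', hQs]
      exact Finset.mem_image.2 ⟨x, Finset.mem_range.2 hx, rfl⟩) hx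
  have hτT : τ ≤ T := by
    have : σ.time = τ := by rw [hτ]; simp [State.init]
    omega
  have h₁ : Tri E (block [.const 4 (b + 2), .const 5 0, .add (b + 5) ro (suf s)]) M 3 0 (fun M' => M' = M₁) :=
    Tri.block rfl rfl
  have h₂ : Tri E ((P.reloc s b).tr P.G) M₁ ((P.κ + 9) * T) P.n
      (fun M' => (P.reloc s b).Rel M₁ σ.mem σ.row σ.out M') := fun s₀ hs₀ => by
    obtain ⟨s₁, g1, g2, g3, g4, g5, g6⟩ := hsim s₀ (by rw [hs₀]; exact hrel)
    refine ⟨s₁, g1, g2, g3, g4, g5.trans ?_, ?_⟩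
    · have : (P.reloc s b).κ = P.κ := rfl
      rw [this]
      gcongr
    · exact (Finset.card_le_card g6).trans ((Finset.card_union_le _ _).trans (by omega))
  refine ((h₁.seq fun M' hM' => hM' ▸ h₂.seq fun M' hr => Tri.block rfl
    (Q := fun M' => P.Same b M M' ∧ P.Fresh (b + 6) M' ∧ M' b = 0 ∧
      (∀ j, M' (P.K * j + (b + 2)) = R.flat (col P.n S i s o) j) ∧
      M' (b + 4) = (R.out (col P.n S i s o)).length) ?_)).mono (by simp; omega) (by simp) fun _ h => h
  have hfr : ∀ a, (a = 0 ∨ 6 ≤ a) → a % P.K ≠ b + 1 → a % P.K ≠ b + 2 → M' a = M₁ a := hr.frame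
  have hmem : memRun E M' [.add (b + 4) 5 0] = Function.update M' (b + 4) σ.out.length := by
    have hz : M' 0 = 0 := by rw [hr.zero hv, h0]
    simp [memRun_cons, memRun_nil, memStep, hz, hr.cnt]
  have h4m : (b + 4) % P.K = b + 4 := Nat.mod_eq_of_lt (by omega)
  have hbm : b % P.K = b := Nat.mod_eq_of_lt (by omega)
  rw [hmem]
  refine ⟨fun a ha hab => ?_, fun a ha => ?_, ?_, fun j => ?_, ?_⟩
  · rw [Function.update_of_ne (fun he => by rw [he, h4m] at hab; omega), hfr a (by omega) (by omega) (by omega),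
      hlow a (by omega) (by omega) (fun he => by rw [he, h5m] at hab; omega)]
  · have ha6 : b + 6 ≤ a := ha.trans (Nat.mod_le _ _)
    rw [Function.update_of_ne (by omega), hfr a (by omega) (by omega) (by omega),
      hlow a (by omega) (by omega) (by omega), hF a (by omega)]
  · rw [Function.update_of_ne (by omega), hfr b (by omega) (by omega) (by omega),
      hlow b (by omega) (by omega) (by omega), hF b (by omega)]
  · have hm : (P.K * j + (b + 2)) % P.K = b + 2 := lane_mod (by omega) j
    rw [Function.update_of_ne (fun he => by rw [he, h4m] at hm; omega), Recov.flat, ← hout, ← hrow]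
    exact hr.tape j
  · rw [Function.update_self, hout]

theorem memRun_readOps (E : Env) (M : ℕ → ℕ) (κ pos lane : ℕ) :
    memRun E M (readOps κ pos lane) =
      Function.update (Function.update M 2 lane) 1 (2 ^ κ * E.input.getD pos 0 + lane) := by
  rw [readOps, memRun_append, memRun_append, memRun_dbl]
  funext x
  simp only [memRun_cons, memRun_nil, memStep]
  by_cases h1 : x = 1
  · subst h1; simp
  · by_cases h2 : x = 2
    · subst h2; simp
    · simp [h1, h2]

theorem readOps_pure (κ pos lane : ℕ) : (readOps κ pos lane).all Op.isPure = true := by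
  rw [readOps, List.all_append, List.all_append, dbl_pure]
  rfl

theorem readOps_length (κ pos lane : ℕ) : (readOps κ pos lane).length = κ + 4 := by
  simp [readOps, dbl_length]

/-- Inequality of two words is the nonvanishing of the sum of the two truncated differences. The row
number `j` is hard-wired, so `K * (j * n)` is a constant and no multiplication of words is needed.
-/
theorem cmp_tri {b j pos v r c : ℕ} {fl : ℕ → ℕ} {M : ℕ → ℕ} (hb : 10 ≤ b) (hv : 10 ≤ v)
    (hpos : E.input.getD pos 0 = r) (hfl : ∀ j, M (P.K * j + (b + 2)) = fl j) (hc : M 6 = c) :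
    Tri E (P.cmp b j pos v) M (P.κ + 11) 0 fun M' => (∀ a, (a = 0 ∨ 10 ≤ a) → M' a = M a) ∧
      M' 6 = c + if fl (j * P.n + r) = M v then 0 else 1 := by
  set x := fl (j * P.n + r) with hx
  have hmem : ∃ M₁, memRun E M (readOps P.κ pos (P.K * (j * P.n) + (b + 2)) ++
      [.load 1 1, .sub 2 1 v, .sub 3 v 1, .add 2 2 3]) = M₁ ∧ (∀ a, (a = 0 ∨ 6 ≤ a) → M₁ a = M a) ∧
        M₁ 2 = (x - M v) + (M v - x) := by
    refine ⟨_, rfl, ?_⟩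
    have he : 2 ^ P.κ * r + (P.K * (j * P.n) + (b + 2)) = P.K * (j * P.n + r) + (b + 2) := by
      have : P.K = 2 ^ P.κ := rfl
      rw [← this]; ring
    rw [memRun_append, memRun_readOps, hpos, he]
    simp only [memRun_cons, memRun_nil, memStep, Function.update_self]
    rw [Function.update_of_ne (show P.K * (j * P.n + r) + (b + 2) ≠ 1 by omega),
      Function.update_of_ne (show P.K * (j * P.n + r) + (b + 2) ≠ 2 by omega), hfl, ← hx]
    have h1 : v ≠ 1 := by omega
    have h2 : v ≠ 2 := by omega
    have h3 : v ≠ 3 := by omega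
    constructor
    · intro a ha
      have g1 : a ≠ 1 := by omega
      have g2 : a ≠ 2 := by omega
      have g3 : a ≠ 3 := by omega
      simp [g1, g2, g3]
    · simp [h1, h2]
  obtain ⟨M₁, hM₁, hsame, h2⟩ := hmem
  refine ((Tri.block (Q := fun M' => M' = M₁) ?_ hM₁).seq fun M' hM' => Tri.ite (τ := 2) (a := 0)
    (fun h => ?_) (fun h => ?_)).mono ?_ (le_refl 0) fun _ h => h
  · rw [List.all_append, readOps_pure]; rfl
  · subst hM'
    refine Tri.block rfl ⟨fun a ha => ?_, ?_⟩
    · have g1 : a ≠ 1 := by omega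
      have g2 : a ≠ 6 := by omega
      simp [memRun_cons, memRun_nil, memStep, g1, g2, hsame a (by omega)]
    · rw [if_neg (by omega)]
      simp [memRun_cons, memRun_nil, memStep, hsame 6 (by omega), hc]
  · subst hM'
    refine (Tri.nop ⟨fun a ha => hsame a (by omega), ?_⟩).mono (by omega) (by omega) fun _ h => h
    rw [if_pos (by omega), hsame 6 (by omega), hc, Nat.add_zero]
  · rw [List.length_append, readOps_length]; simp

/-- In this form partial sums over the first samples make sense, as the loop invariant requires. -/
theorem disagree_eq_sum_range {n m : ℕ} (fl : ℕ → ℕ) (r v : Fin m → ℕ) (j : ℕ) :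
    disagree n fl r v j = ∑ k ∈ Finset.range m,
      if h : k < m then (if fl (j * n + r ⟨k, h⟩) = v ⟨k, h⟩ then 0 else 1) else 0 := by
  rw [disagree, Finset.sum_range]
  exact Finset.sum_congr rfl fun k _ => by rw [dif_pos k.2]

/-- The time for one candidate row. -/
def selTime (P : Params) : ℕ := P.m * (P.κ + 11) + 11

theorem proc_tri {s b j d : ℕ} {pos v r vv : Fin P.m → ℕ} {fl : ℕ → ℕ} {M : ℕ → ℕ} (hb : 10 ≤ b)
    (hv : ∀ k, 10 ≤ v k) (hpos : ∀ k, E.input.getD (pos k) 0 = r k) (hvv : ∀ k, M (v k) = vv k)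
    (hfl : ∀ j, M (P.K * j + (b + 2)) = fl j) (hd : M (dig s) = P.K * d) :
    Tri E (P.proc s b pos v j) M (P.m * (P.κ + 11) + 7) 0 fun M' =>
      (∀ a, (a = 0 ∨ 10 ≤ a) → a ≠ b → M' a = M a) ∧
        M' b = if disagree P.n fl r vv j ≤ P.θ then fl (j * P.n + d) else M b := by
  have h₁ : Tri E (block [.const 6 0]) M 1 0 (fun M' => (∀ a, (a = 0 ∨ 10 ≤ a) → M' a = M a) ∧ M' 6 = 0) := by
    refine Tri.block rfl ⟨fun a ha => ?_, ?_⟩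
    · have : a ≠ 6 := by omega
      simp [memRun_cons, memRun_nil, memStep, this]
    · simp [memRun_cons, memRun_nil, memStep]
  have h₂ : ∀ M', ((∀ a, (a = 0 ∨ 10 ≤ a) → M' a = M a) ∧ M' 6 = 0) →
      Tri E (forFin P.m fun k => P.cmp b j (pos k) (v k)) M' (P.m * (P.κ + 11)) (P.m * 0)
        (fun M' => (∀ a, (a = 0 ∨ 10 ≤ a) → M' a = M a) ∧ M' 6 = disagree P.n fl r vv j) := by
    intro M' hM'
    rw [disagree_eq_sum_range]
    refine Tri.forFin (fun c M' => (∀ a, (a = 0 ∨ 10 ≤ a) → M' a = M a) ∧ M' 6 = ∑ k ∈ Finset.range c,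
      if h : k < P.m then (if fl (j * P.n + r ⟨k, h⟩) = vv ⟨k, h⟩ then 0 else 1) else 0) ?_ ?_
    · simpa using hM'
    · rintro k M'' ⟨g1, g2⟩
      refine (cmp_tri hb (hv k) (hpos k) (fl := fl) (fun j => ?_) g2).mono le_rfl le_rfl ?_
      · rw [g1 _ (by omega), hfl]
      · rintro M₃ ⟨g3, g4⟩
        refine ⟨fun a ha => by rw [g3 a ha, g1 a ha], ?_⟩
        rw [g4, Finset.sum_range_succ, dif_pos k.2, g1 _ (Or.inr (hv k)), hvv]
  refine (h₁.seq fun M' hM' => (h₂ M' hM').seq fun M₁ hM₁ => (Tri.block (Q := fun M' =>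
    (∀ a, (a = 0 ∨ 10 ≤ a) → M' a = M a) ∧ M' 1 = P.θ + 1 - disagree P.n fl r vv j) rfl ?_).seq
      fun M₂ hM₂ => Tri.ite (τ := 3) (a := 0) (fun h => ?_) (fun h => ?_)).mono
        (by simp; omega) (by simp) fun _ h => h
  · refine ⟨fun a ha => ?_, ?_⟩
    · have : a ≠ 1 := by omega
      simp [memRun_cons, memRun_nil, memStep, this, hM₁.1 a ha]
    · simp [memRun_cons, memRun_nil, memStep, hM₁.2]
  · refine Tri.block rfl ⟨fun a ha hab => ?_, ?_⟩
    · have : a ≠ 1 := by omega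
      simp [memRun_cons, memRun_nil, memStep, this, hM₂.1 a ha, hab]
    -- The truncated difference of `θ + 1` and the number of disagreements is nonzero exactly when
    -- that number is at most `θ`.
    · rw [if_pos (by omega)]
      have g1 : dig s ≠ 1 := by unfold dig; omega
      have g2 : P.K * (j * P.n) + (b + 2) + P.K * d = P.K * (j * P.n + d) + (b + 2) := by ring
      have g3 : P.K * (j * P.n + d) + (b + 2) ≠ 1 := by omega
      simp only [memRun_cons, memRun_nil, memStep, Function.update_self, Function.update_of_ne g1]
      rw [hM₂.1 (dig s) (by unfold dig; omega), hd, g2]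
      rw [Function.update_of_ne g3, Function.update_of_ne g3, hM₂.1 _ (by omega), hfl]
  · refine (Tri.nop ⟨fun a ha hab => hM₂.1 a ha, ?_⟩).mono (by omega) (by omega) fun _ h => h
    rw [if_neg (by omega), hM₂.1 b (by omega)]

/-- The loop is unrolled `L` times but stops when the rows are used up, so the time depends on `c -
j` and not on the fuel `f`. The final `3` is the cost of the test that fails. -/
theorem sel_tri {s b d c : ℕ} {pos v r vv : Fin P.m → ℕ} {fl : ℕ → ℕ} (hb : 10 + 3 * s + 3 ≤ b)
    (hv : ∀ k, b + 6 ≤ v k) (hpos : ∀ k, E.input.getD (pos k) 0 = r k) : ∀ (f j : ℕ) (M : ℕ → ℕ),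
    (∀ k, M (v k) = vv k) → (∀ j, M (P.K * j + (b + 2)) = fl j) → M (dig s) = P.K * d → M (b + 4) = c →
    Tri E (P.sel s b pos v f j) M ((c - j) * P.selTime + 3) 0 fun M' =>
      (∀ a, (a = 0 ∨ 10 ≤ a) → a ≠ b → M' a = M a) ∧ M' b = pick P.n P.θ d c fl r vv f j (M b) := by
  intro f
  induction f with
  | zero =>
    intro j M _ _ _ _
    exact (Tri.nop (Q := fun M' => (∀ a, (a = 0 ∨ 10 ≤ a) → a ≠ b → M' a = M a) ∧
      M' b = pick P.n P.θ d c fl r vv 0 j (M b)) ⟨fun _ _ _ => rfl, rfl⟩).mono (by omega) (by omega) fun _ h => h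
  | succ f ih =>
    intro j M hvv hfl hd hc
    have hb2 : ∀ x, P.K * x + (b + 2) ≠ b := fun x => by omega
    have hdig : dig s ≠ b ∧ 10 ≤ dig s := by unfold dig; omega
    have h₁ : Tri E (block [.const 1 j, .sub 1 (b + 4) 1]) M 2 0
        (fun M' => (∀ a, (a = 0 ∨ 10 ≤ a) → M' a = M a) ∧ M' 1 = c - j) := by
      refine Tri.block rfl ⟨fun a ha => ?_, ?_⟩
      · have : a ≠ 1 := by omega
        simp [memRun_cons, memRun_nil, memStep, this]
      · have : b + 4 ≠ 1 := by omega
        simp [memRun_cons, memRun_nil, memStep, this, hc]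
    have hstep : ∀ M₁, ((∀ a, (a = 0 ∨ 10 ≤ a) → M₁ a = M a) ∧ M₁ 1 = c - j) →
        Tri E (.ite 1 (.seq (P.proc s b pos v j) (P.sel s b pos v f (j + 1))) .nop) M₁
          ((c - j) * P.selTime + 1) 0 fun M' => (∀ a, (a = 0 ∨ 10 ≤ a) → a ≠ b → M' a = M a) ∧
            M' b = pick P.n P.θ d c fl r vv (f + 1) j (M b) := by
      rintro M₁ ⟨g1, g2⟩
      refine Tri.ite (fun h => ?_) (fun h => ?_)
      · have hj : j < c := by omega
        have h3 := (proc_tri (P := P) (E := E) (s := s) (b := b) (j := j) (d := d) (v := v) (vv := vv) (fl := fl) (M := M₁) (by omega)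
          (fun k => by have := hv k; omega) hpos
          (fun k => by rw [g1 _ (by have := hv k; omega), hvv k]) (fun x => by rw [g1 _ (by omega), hfl x])
          (by rw [g1 _ (Or.inr hdig.2), hd])).seq (q := P.sel s b pos v f (j + 1)) (a' := 0)
          (Q' := fun M' => (∀ a, (a = 0 ∨ 10 ≤ a) → a ≠ b → M' a = M a) ∧
            M' b = pick P.n P.θ d c fl r vv (f + 1) j (M b)) (τ' := (c - (j + 1)) * P.selTime + 3) ?_
        · refine h3.mono ?_ le_rfl fun _ h => h
          obtain ⟨e, he⟩ : ∃ e, c - j = e + 1 := ⟨c - j - 1, by omega⟩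
          have he' : c - (j + 1) = e := by omega
          rw [he, he', Nat.add_mul, Nat.one_mul]
          unfold selTime
          omega
        · rintro M₂ ⟨g3, g4⟩
          have g5 : ∀ a, (a = 0 ∨ 10 ≤ a) → a ≠ b → M₂ a = M a := fun a ha hab => by
            rw [g3 a ha hab, g1 a ha]
          refine (ih (j + 1) M₂ (fun k => ?_) (fun x => ?_) ?_ ?_).mono le_rfl le_rfl ?_
          · have := hv k
            rw [g5 _ (by omega) (by omega), hvv]
          · rw [g5 _ (by omega) (hb2 x), hfl]
          · rw [g5 _ (Or.inr hdig.2) hdig.1, hd]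
          · rw [g5 _ (by omega) (by omega), hc]
          · rintro M₃ ⟨g6, g7⟩
            refine ⟨fun a ha hab => by rw [g6 a ha hab, g5 a ha hab], ?_⟩
            rw [g7, g4, pick, if_pos hj, g1 b (by omega)]
      · refine (Tri.nop ⟨fun a ha _ => g1 a ha, ?_⟩).mono (by omega) le_rfl fun _ h => h
        rw [g1 b (by omega), pick, if_neg (by omega)]
    exact (h₁.seq hstep).mono (by omega) le_rfl fun _ h => h

end

end Params


/-! ### Verification of the compiled recursion -/

namespace Params

/-- The running time of level `s`. -/
def evTime (P : Params) (T : ℕ) : ℕ → ℕ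
  | 0 => (P.κ + 9) * T + 10
  | s + 1 => (P.κ + 9) * T + 4 + (P.m * (P.κ + 6 + evTime P T s) + (T * P.selTime + 3))

/-- The number of coordinates queried at level `s`. -/
def evAsk (P : Params) : ℕ → ℕ
  | 0 => P.n
  | s + 1 => P.n + P.m * evAsk P s

theorem Simulates.length_out_le {F : Type*} {P : Params} {E : Env} {R : Recov F P.n} {S : ℕ → Finset F} {i t T : ℕ}
    (hG : P.Simulates E R S i t T) {s o : ℕ} (hs : s < t) (ho : o + P.n ^ (s + 1) ≤ P.n ^ t) :
    (R.out (col P.n S i s o)).length ≤ T := by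
  obtain ⟨_, σ, _, h, _, _, h', _⟩ := hG s o hs ho
  rw [← h]
  exact h'

/-- `Same` protects the tables and the results of earlier sibling calls, which lie in lower lanes;
`Fresh` above the used frame guarantees zero memory for the next sibling. Together they make the
statement strong enough for the induction. -/
theorem eval_tri {F : Type*} {P : Params} {E : Env} {R : Recov F P.n} {S : ℕ → Finset F} {i t T : ℕ}
    (hG : P.Simulates E R S i t T) : ∀ (s b ro o : ℕ) (pos ρ : Samp P.m s → ℕ) (lpos a : Leaf P.m s → ℕ)
    (M : ℕ → ℕ), s < t → 10 + 3 * t ≤ b → b + P.size s ≤ P.K → 10 ≤ ro → ro < b →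
    o + P.n ^ (s + 1) ≤ P.n ^ t → P.BaseMem t i M → P.Fresh b M → M ro = o →
    (∀ x, E.input.getD (pos x) 0 = ρ x) → (∀ x, ρ x < P.n) →
    (∀ y, E.input.getD (lpos y) 0 = P.K * (a y * P.n)) →
    Tri E (P.evalProg s b ro pos lpos) M (P.evTime T s) (P.evAsk s) fun M' =>
      P.Same b M M' ∧ P.Fresh (b + P.size s) M' ∧ M' b = ev R P.m P.θ P.L S i s o ρ a := by
  intro s
  induction s with
  | zero =>
    intro b ro o pos ρ lpos a M hs hb hK hro hrob ho hB hF hMo hpos hρ hlpos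
    have hK6 : b + 6 ≤ P.K := hK
    refine ((runG_tri hG hs hb hK6 hro hrob ho hB hF hMo).seq fun M₁ hM₁ => Tri.block rfl ?_).mono le_rfl le_rfl
      fun _ h => h
    obtain ⟨hsame, hfresh, hb0, htape, hcnt⟩ := hM₁
    have hB₁ := hB.of_same hsame hb (by omega)
    have g2 : P.K * (a () * P.n) + P.K * (i / P.n ^ 0 % P.n) + (b + 2) =
        P.K * (a () * P.n + i / P.n ^ 0 % P.n) + (b + 2) := by ring
    have g3 : P.K * (a () * P.n + i / P.n ^ 0 % P.n) + (b + 2) ≠ 1 := by omega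
    have g4 : P.K * (a () * P.n + i / P.n ^ 0 % P.n) + (b + 2) ≠ 2 := by omega
    have hmem : ∃ M₂, memRun E M₁ [.const 1 (lpos ()), .read 1 1, .add 1 1 (dig 0), .const 2 (b + 2),
        .add 1 1 2, .load b 1] = M₂ ∧ (∀ c, c ≠ 1 → c ≠ 2 → c ≠ b → M₂ c = M₁ c) ∧
        M₂ b = M₁ (P.K * (a () * P.n + i / P.n ^ 0 % P.n) + (b + 2)) := by
      refine ⟨_, rfl, fun c h1 h2 h3 => ?_, ?_⟩
      · simp [memRun_cons, memRun_nil, memStep, h1, h2, h3]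
      · have h1 : dig 0 ≠ 1 := by unfold dig; omega
        have h2 : E.input.getD (lpos ()) 0 = P.K * (a () * P.n) := hlpos ()
        simp only [memRun_cons, memRun_nil, memStep, Function.update_self, Function.update_of_ne h1, h2,
          Function.update_idem, hB₁.dig 0 hs]
        rw [Function.update_of_ne (show (1 : ℕ) ≠ 2 by omega), Function.update_self, g2,
          Function.update_of_ne g3, Function.update_of_ne g4, Function.update_of_ne g3]
    obtain ⟨M₂, hM₂, h1, h2⟩ := hmem
    rw [hM₂]
    have hbm : b % P.K = b := Nat.mod_eq_of_lt (by omega)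
    refine ⟨fun c hc hcb => ?_, fun c hc => ?_, ?_⟩
    · rw [h1 c (by omega) (by omega) (fun he => by rw [he, hbm] at hcb; omega), hsame c hc hcb]
    · have : b + 6 ≤ c := hc.trans (Nat.mod_le _ _)
      rw [h1 c (by omega) (by omega) (by omega), hfresh c hc]
    · rw [h2, htape, ev]
  | succ s ih =>
    intro b ro o pos ρ lpos a M hs hb hK hro hrob ho hB hF hMo hpos hρ hlpos
    set sz := P.size s with hsz
    have hszp : 6 ≤ sz := P.size_pos s
    have hKs : b + (6 + P.m * sz) ≤ P.K := hK
    have hK6 : b + 6 ≤ P.K := by omega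
    set v : Fin P.m → ℕ := fun k => ev R P.m P.θ P.L S i s (o + ρ (k, none) * P.n ^ (s + 1))
      (fun x => ρ (k, some x)) (fun x => a (k, x)) with hv
    have h3m : (b + 3) % P.K = b + 3 := Nat.mod_eq_of_lt (by omega)
    have hbm : b % P.K = b := Nat.mod_eq_of_lt (by omega)
    have hrom : ro % P.K = ro := Nat.mod_eq_of_lt (by omega)
    refine ((runG_tri hG hs hb hK6 hro hrob ho hB hF hMo).seq (τ' := P.m * (P.κ + 6 + P.evTime T s) +
      (T * P.selTime + 3)) (a' := P.m * P.evAsk s) fun M₁ hM₁ => ?_).mono le_rfl le_rfl fun _ h => h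
    obtain ⟨hsame, hfresh, hb0, htape, hcnt⟩ := hM₁
    -- After `k` calls their results stand at the start of their frames, later frames are untouched,
    -- and of the own frame only the offset register `b + 3` has changed.
    set I : ℕ → (ℕ → ℕ) → Prop := fun k M' =>
      (∀ a, (a = 0 ∨ 10 ≤ a) → a % P.K < b + 6 → a ≠ b + 3 → M' a = M₁ a) ∧ P.Fresh (b + 6 + k * sz) M' ∧
        ∀ j : Fin P.m, (j : ℕ) < k → M' (b + 6 + j * sz) = v j with hI
    refine ((Tri.forFin (τ := P.κ + 6 + P.evTime T s) (a := P.evAsk s) I ?_ ?_).seq (τ' := T * P.selTime + 3)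
      (a' := 0) ?_).mono le_rfl (by omega) fun _ h => h
    · exact ⟨fun _ _ _ _ => rfl, by simpa using hfresh, fun j hj => absurd hj (by omega)⟩
    · rintro k M' ⟨hlow, hfr, hres⟩
      have hk1 : (k + 1) * sz ≤ P.m * sz := Nat.mul_le_mul_right _ k.2
      have hk2 : (k + 1) * sz = k * sz + sz := by ring
      have hsame' : P.Same b M M' := fun c hc hcb => by
        rw [hlow c hc (by omega) (fun he => by rw [he, h3m] at hcb; omega), hsame c hc hcb]
      have hB' := hB.of_same hsame' hb (by omega)
      have hro' : M' ro = o := by rw [hsame' ro (Or.inr hro) (by omega), hMo]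
      have hmem : ∃ M₂, memRun E M' (readOps P.κ (pos (k, none)) (tab (s + 1)) ++
          [.load 1 1, .add (b + 3) ro 1]) = M₂ ∧ (∀ c, c ≠ 1 → c ≠ 2 → c ≠ b + 3 → M₂ c = M' c) ∧
          M₂ (b + 3) = o + ρ (k, none) * P.n ^ (s + 1) := by
        refine ⟨_, rfl, fun c h1 h2 h3 => ?_, ?_⟩
        · rw [memRun_append, memRun_readOps]
          simp [memRun_cons, memRun_nil, memStep, h1, h2, h3]
        · have h3 : E.input.getD (pos (k, none)) 0 = ρ (k, none) := hpos _
          rw [memRun_append, memRun_readOps, h3]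
          have h4 : 2 ^ P.κ * ρ (k, none) + tab (s + 1) = P.K * ρ (k, none) + tab (s + 1) := rfl
          have h5 : P.K * ρ (k, none) + tab (s + 1) ≠ 1 := by unfold tab; omega
          have h6 : P.K * ρ (k, none) + tab (s + 1) ≠ 2 := by unfold tab; omega
          simp only [memRun_cons, memRun_nil, memStep, Function.update_self, h4, Function.update_idem]
          have h7 : M' (P.K * ρ (k, none) + tab (s + 1)) = ρ (k, none) * P.n ^ (s + 1) := hB'.tab _ hs _ (hρ _)
          rw [Function.update_of_ne h5, Function.update_of_ne h6, h7,
            Function.update_of_ne (show ro ≠ 1 by omega), Function.update_of_ne (show ro ≠ 2 by omega), hro']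
      obtain ⟨M₂, hM₂, h1, h2⟩ := hmem
      have hch := ih (b + 6 + k * sz) (b + 3) (o + ρ (k, none) * P.n ^ (s + 1)) (fun x => pos (k, some x))
        (fun x => ρ (k, some x)) (fun x => lpos (k, x)) (fun x => a (k, x)) M₂ (by omega) (by omega) (by omega)
        (by omega) (by omega) ?_ ?_ ?_ h2 (fun x => hpos _) (fun x => hρ _) (fun y => hlpos _)
      rotate_left
      · have h7 : (ρ (k, none) + 1) * P.n ^ (s + 1) ≤ P.n ^ (s + 1 + 1) := by
          rw [pow_succ' P.n (s + 1)]
          exact Nat.mul_le_mul_right _ (hρ _)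
        have h8 : (ρ (k, none) + 1) * P.n ^ (s + 1) = ρ (k, none) * P.n ^ (s + 1) + P.n ^ (s + 1) := by ring
        omega
      · refine hB'.of_same (b := b) (fun c hc hcb => ?_) hb (by omega)
        exact h1 c (by omega) (by omega) (fun he => by rw [he, h3m] at hcb; omega)
      · intro c hc
        have hc' := hc.trans (Nat.mod_le _ _)
        rw [h1 c (by omega) (by omega) (by omega), hfr c hc]
      rw [← hM₂] at hch
      refine (Tri.seq_block ?_ hch).mono ?_ le_rfl ?_
      · rw [List.all_append, readOps_pure]; rfl
      · rw [List.length_append, readOps_length]; simp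
      · rintro M₃ ⟨g1, g2, g3⟩
        rw [hM₂] at g1
        refine ⟨fun c hc hcb hc3 => ?_, ?_, fun j hj => ?_⟩
        · rw [g1 c hc (by omega), h1 c (by omega) (by omega) hc3, hlow c hc hcb hc3]
        · have h9 : b + 6 + (k + 1) * sz = b + 6 + k * sz + sz := by omega
          rw [h9]
          exact g2
        · rcases Nat.lt_succ_iff_lt_or_eq.1 hj with hj | hj
          · have hj1 : (j + 1) * sz ≤ k * sz := Nat.mul_le_mul_right _ hj
            have hj2 : ((j : ℕ) + 1) * sz = j * sz + sz := by ring
            rw [g1 _ (by omega) (by rw [Nat.mod_eq_of_lt (by omega)]; omega),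
              h1 _ (by omega) (by omega) (by omega), hres j hj]
          · have hjk : j = k := Fin.ext hj
            rw [hjk, g3]
    · rintro M₂ ⟨hlow, hfr, hres⟩
      have hsame' : P.Same b M M₂ := fun c hc hcb => by
        rw [hlow c hc (by omega) (fun he => by rw [he, h3m] at hcb; omega), hsame c hc hcb]
      have hB' := hB.of_same hsame' hb (by omega)
      refine (sel_tri (P := P) (E := E) (s := s + 1) (b := b) (d := i / P.n ^ (s + 1) % P.n)
        (c := (R.out (col P.n S i (s + 1) o)).length) (pos := fun k => pos (k, none))
        (v := fun k => b + 6 + k * sz) (r := fun k => ρ (k, none)) (vv := v)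
        (fl := R.flat (col P.n S i (s + 1) o)) (by omega) (fun k => by omega) (fun k => hpos _) P.L 0 M₂
        (fun k => hres k k.2) (fun j => ?_) (hB'.dig _ hs) ?_).mono ?_ le_rfl ?_
      · have hm : (P.K * j + (b + 2)) % P.K = b + 2 := lane_mod (by omega) j
        rw [hlow _ (by omega) (by omega) (fun he => by rw [he, h3m] at hm; omega), htape]
      · rw [hlow _ (by omega) (by rw [Nat.mod_eq_of_lt (by omega)]; omega) (by omega), hcnt]
      -- Closing a row costs a step, so there are at most `T` candidates; this bound does not
      -- involve `L`.
      · have := hG.length_out_le hs ho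
        rw [Nat.sub_zero]
        gcongr
      · rintro M₃ ⟨g1, g2⟩
        refine ⟨fun c hc hcb => ?_, fun c hc => ?_, ?_⟩
        · rw [g1 c hc (fun he => by rw [he, hbm] at hcb; omega), hsame' c hc hcb]
        · have hc' : b + (6 + P.m * sz) ≤ c % P.K := hc
          have hc2 := hc'.trans (Nat.mod_le _ _)
          rw [g1 c (by omega) (by omega), hfr c (by omega)]
        · rw [g2, hlow b (by omega) (by omega) (by omega), hb0, ev]

end Params


/-! ### Tables, digits of the coordinate, and the complete local program -/

theorem memRun_const (E : Env) (f : ℕ → ℕ) (l : List ℕ) (M : ℕ → ℕ) (b : ℕ) :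
    memRun E M (l.map fun a => .const a (f a)) b = if b ∈ l then f b else M b := by
  induction l generalizing M with
  | nil => simp [memRun_nil]
  | cons a l ih =>
    rw [List.map_cons, memRun_cons, ih]
    by_cases hb : b ∈ l
    · simp [hb]
    · by_cases hba : b = a
      · subst hba; simp [hb, memStep]
      · simp [hb, hba, memStep]

namespace Params

/-- The addresses of the tables. -/
def tabAddrs (P : Params) (t : ℕ) : List ℕ :=
  (List.range t).flatMap fun s => (List.range P.n).map fun x => P.K * x + tab s

/-- Split the word in register `7` into its digit of weight `n ^ s` and the rest. -/
def splitProg (P : Params) (s : ℕ) : Prog :=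
  .seq (forFin P.n fun x =>
    .seq (block [.const 1 (x * P.n ^ s), .const 2 1, .add 2 7 2, .sub 2 2 1])
      (.ite 2 (block [.const (dig s) (P.K * x), .sub (suf s) 7 1]) .nop))
    (block [.add 7 (suf s) 0])

/-- Set up the tables and the digits of the coordinate. -/
def setup (P : Params) (t : ℕ) : Prog :=
  .seq (block ((P.tabAddrs t).map fun a => .const a (a / P.K * P.n ^ ((a % P.K - 10) / 3))))
    (.seq (block [.const 1 0, .read 7 1]) (forFin t fun j => P.splitProg (t - 1 - j)))

section

variable {P : Params} {E : Env} {i t : ℕ}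

theorem mem_tabAddrs {a : ℕ} : a ∈ P.tabAddrs t ↔ ∃ s < t, ∃ x < P.n, P.K * x + tab s = a := by
  simp [tabAddrs]

theorem tabAddrs_length : (P.tabAddrs t).length = t * P.n := by
  simp [tabAddrs, List.length_flatMap]

/-- Division by exhaustive search: each `x` with `x * n ^ s ≤ cur` overwrites digit and remainder,
so the last success is the quotient. This is the meaning of the minimum in the invariant. The test
word is `cur + 1 - x * n ^ s`, nonzero exactly for these `x`. -/
theorem split_tri {s cur : ℕ} {M : ℕ → ℕ} (h0 : M 0 = 0) (hM : M 7 = cur) (hcur : cur < P.n ^ (s + 1)) :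
    Tri E (P.splitProg s) M (P.n * 7 + 1) 0 fun M' =>
      (∀ a, (a = 0 ∨ 10 ≤ a) → a ≠ dig s → a ≠ suf s → M' a = M a) ∧ M' 7 = cur % P.n ^ s ∧
        M' (dig s) = P.K * (cur / P.n ^ s) ∧ M' (suf s) = cur % P.n ^ s := by
  have hn : 0 < P.n := by
    rcases Nat.eq_zero_or_pos P.n with h | h
    · rw [h, pow_succ, mul_zero] at hcur; omega
    · exact h
  set N := P.n ^ s with hN
  have hNp : 0 < N := pow_pos hn s
  have hds : dig s ≠ suf s ∧ 10 ≤ dig s ∧ 10 ≤ suf s := by unfold dig suf; omega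
  obtain ⟨hds, hd10, hs10⟩ := hds
  have hdiv : cur / N < P.n := by
    rw [Nat.div_lt_iff_lt_mul hNp, mul_comm, ← pow_succ]
    exact hcur
  set I : ℕ → (ℕ → ℕ) → Prop := fun X M' =>
    (∀ a, (a = 0 ∨ 10 ≤ a) → a ≠ dig s → a ≠ suf s → M' a = M a) ∧ M' 7 = cur ∧
      (X ≠ 0 → ∃ y, y = min (cur / N) (X - 1) ∧ M' (dig s) = P.K * y ∧ M' (suf s) = cur - y * N) with hI
  refine ((Tri.forFin (τ := 7) (a := 0) I ?_ ?_).seq (τ' := 1) (a' := 0) ?_).mono le_rfl (by omega) fun _ h => h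
  · exact ⟨fun _ _ _ _ => rfl, hM, fun h => absurd rfl h⟩
  · rintro x M' ⟨h1, h2, h3⟩
    have hmem : ∃ M₁, memRun E M' [.const 1 (x * N), .const 2 1, .add 2 7 2, .sub 2 2 1] = M₁ ∧
        (∀ a, a ≠ 1 → a ≠ 2 → M₁ a = M' a) ∧ M₁ 1 = x * N ∧ M₁ 2 = cur + 1 - x * N := by
      refine ⟨_, rfl, fun a g1 g2 => ?_, ?_, ?_⟩
      · simp [memRun_cons, memRun_nil, memStep, g1, g2]
      · simp [memRun_cons, memRun_nil, memStep]
      · simp [memRun_cons, memRun_nil, memStep, h2]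
    obtain ⟨M₁, hM₁, g1, g2, g3⟩ := hmem
    refine (Tri.seq_block (τ := 3) rfl ?_).mono le_rfl le_rfl fun _ h => h
    rw [hM₁]
    have hle : M₁ 2 ≠ 0 ↔ (x : ℕ) ≤ cur / N := by
      rw [g3, Nat.le_div_iff_mul_le hNp]; omega
    refine Tri.ite (fun h => ?_) (fun h => ?_)
    · have hx := hle.1 h
      refine Tri.block rfl ⟨fun a ha had has => ?_, ?_, fun _ =>
        ⟨x, by rw [Nat.add_sub_cancel]; exact (min_eq_right hx).symm, ?_, ?_⟩⟩
      · simp [memRun_cons, memRun_nil, memStep, had, has, g1 a (by omega) (by omega), h1 a ha had has]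
      · have k1 : 7 ≠ dig s := by omega
        have k2 : 7 ≠ suf s := by omega
        simp [memRun_cons, memRun_nil, memStep, k1, k2, g1 7, h2]
      · simp [memRun_cons, memRun_nil, memStep, hds]
      · have k1 : 7 ≠ dig s := by omega
        have k2 : 1 ≠ dig s := by omega
        simp [memRun_cons, memRun_nil, memStep, k1, k2, g1 7, h2, g2]
    · have hx : cur / N < x := not_le.1 fun hx => hle.2 hx h
      obtain ⟨y, hy1, hy2, hy3⟩ := h3 ((Nat.zero_le _).trans_lt hx).ne'
      refine (Tri.nop ⟨fun a ha had has => ?_, ?_, fun _ =>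
        ⟨y, by rw [hy1, Nat.add_sub_cancel, min_eq_left hx.le, min_eq_left (Nat.le_sub_one_of_lt hx)],
          ?_, ?_⟩⟩).mono (by omega) le_rfl
        fun _ h => h
      · rw [g1 a (by omega) (by omega), h1 a ha had has]
      · rw [g1 7 (by omega) (by omega), h2]
      · rw [g1 _ (by omega) (by omega), hy2]
      · rw [g1 _ (by omega) (by omega), hy3]
  · rintro M' ⟨h1, h2, h3⟩
    obtain ⟨y, hy1, hy2, hy3⟩ := h3 (by omega)
    have hy : y = cur / N := by
      rw [hy1]
      exact min_eq_left (Nat.le_sub_one_of_lt hdiv)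
    have hmod : cur - y * N = cur % N := by
      have := Nat.div_add_mod cur N
      rw [hy, mul_comm]; omega
    rw [hmod] at hy3
    rw [hy] at hy2
    have hz : M' 0 = 0 := by rw [h1 0 (Or.inl rfl) (by omega) (by omega), h0]
    refine Tri.block rfl ⟨fun a ha had has => ?_, ?_, ?_, ?_⟩
    · have : a ≠ 7 := by omega
      simp [memRun_cons, memRun_nil, memStep, this, h1 a ha had has]
    · simp [memRun_cons, memRun_nil, memStep, hy3, hz]
    · have : dig s ≠ 7 := by omega
      simp [memRun_cons, memRun_nil, memStep, this, hy2]
    · have : suf s ≠ 7 := by omega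
      simp [memRun_cons, memRun_nil, memStep, this, hy3]

/-- The address `K * x + tab s` determines `x` and `s`, so each table entry is a constant computed
from its address. The digits are split off from the top: after `j` rounds register `7` holds `i % n
^ (t - j)`. -/
theorem setup_tri (hi : i < P.n ^ t) (hE : E.input.getD 0 0 = i) (hK : 10 + 3 * t ≤ P.K) :
    Tri E (P.setup t) (fun _ => 0) (t * P.n + (2 + t * (P.n * 7 + 1))) 0 fun M =>
      P.BaseMem t i M ∧ P.Fresh (10 + 3 * t) M := by
  have hlane : ∀ s < t, ∀ x, (P.K * x + tab s) % P.K = tab s := fun s hs x =>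
    lane_mod (by unfold tab; omega) x
  set M₁ := memRun E (fun _ => 0)
    ((P.tabAddrs t).map fun a => .const a (a / P.K * P.n ^ ((a % P.K - 10) / 3))) with hM₁
  have hM₁a : ∀ b, M₁ b = if b ∈ P.tabAddrs t then b / P.K * P.n ^ ((b % P.K - 10) / 3) else 0 := fun b => by
    rw [hM₁]
    exact memRun_const E _ _ _ b
  have htab : ∀ s < t, ∀ x < P.n, M₁ (P.K * x + tab s) = x * P.n ^ s := fun s hs x hx => by
    rw [hM₁a, if_pos (mem_tabAddrs.2 ⟨s, hs, x, hx, rfl⟩), hlane s hs]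
    have h1 : (P.K * x + tab s) / P.K = x := by
      rw [Nat.mul_add_div P.K_pos, Nat.div_eq_of_lt (by unfold tab; omega), add_zero]
    have h2 : (tab s - 10) / 3 = s := by unfold tab; omega
    rw [h1, h2]
  have hother : ∀ b, (∀ s < t, b % P.K ≠ tab s) → M₁ b = 0 := fun b hb => by
    rw [hM₁a, if_neg]
    rintro hmem
    obtain ⟨s, hs, x, hx, rfl⟩ := mem_tabAddrs.1 hmem
    exact hb s hs (hlane s hs x)
  have h0 : M₁ 0 = 0 := hother 0 fun s hs => by rw [Nat.zero_mod]; unfold tab; omega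
  have hsegs : ∀ s < t, ∀ c, c = dig s ∨ c = suf s → c % P.K = c := fun s hs c hc =>
    Nat.mod_eq_of_lt (by unfold dig suf at hc; omega)
  set J : ℕ → (ℕ → ℕ) → Prop := fun j M =>
    (∀ a, (a = 0 ∨ 10 ≤ a) → (∀ s < t, a ≠ dig s ∧ a ≠ suf s) → M a = M₁ a) ∧ M 7 = i % P.n ^ (t - j) ∧
      ∀ s < t, t - j ≤ s → M (dig s) = P.K * (i / P.n ^ s % P.n) ∧ M (suf s) = i % P.n ^ s with hJ
  refine (Tri.seq_block ?_ (Tri.seq_block (τ := t * (P.n * 7 + 1)) (a := 0) rfl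
    ((Tri.forFin (τ := P.n * 7 + 1) (a := 0) J ?_ ?_).mono le_rfl (by omega)
      (fun M hM => ?_)))).mono ?_ le_rfl fun _ h => h
  · simp [Op.isPure]
  · refine ⟨fun a ha _ => ?_, ?_, fun s hs hs' => by omega⟩
    · have k1 : a ≠ 1 := by omega
      have k2 : a ≠ 7 := by omega
      simp [memRun_cons, memRun_nil, memStep, k1, k2, hM₁]
    · simp only [memRun_cons, memRun_nil, memStep, Function.update_self, hE]
      rw [Nat.sub_zero, Nat.mod_eq_of_lt hi]
  · rintro j M ⟨h1, h2, h3⟩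
    obtain ⟨s, hs⟩ : ∃ s, s = t - 1 - j := ⟨_, rfl⟩
    have hj := j.2
    have hts : t - (j : ℕ) = s + 1 := by omega
    have hts' : t - ((j : ℕ) + 1) = s := by omega
    rw [← hs]
    rw [hts] at h2
    have hn : 0 < P.n := by
      rcases Nat.eq_zero_or_pos P.n with h | h
      · rw [h, zero_pow (by omega)] at hi; omega
      · exact h
    refine (split_tri (P := P) (E := E) (s := s) ?_ h2 (Nat.mod_lt _ (pow_pos hn _))).mono le_rfl le_rfl ?_
    · rw [h1 0 (Or.inl rfl) (fun s _ => by unfold dig suf; omega), h0]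
    · rintro M' ⟨g1, g2, g3, g4⟩
      have hmod : i % P.n ^ (s + 1) % P.n ^ s = i % P.n ^ s :=
        Nat.mod_mod_of_dvd _ (pow_dvd_pow _ (by omega))
      have hdig : i % P.n ^ (s + 1) / P.n ^ s = i / P.n ^ s % P.n := by
        rw [pow_succ, Nat.mod_mul_right_div_self]
      rw [hmod] at g2 g4
      rw [hdig] at g3
      refine ⟨fun a ha has => ?_, ?_, fun s' hs' hle => ?_⟩
      · rw [g1 a ha (has s (by omega)).1 (has s (by omega)).2, h1 a ha has]
      · rw [hts', g2]
      · rw [hts'] at hle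
        rcases Nat.eq_or_lt_of_le hle with rfl | hlt
        · exact ⟨g3, g4⟩
        · obtain ⟨k1, k2⟩ := h3 s' hs' (by omega)
          rw [g1 _ (by unfold dig; omega) (by unfold dig; omega) (by unfold dig suf; omega),
            g1 _ (by unfold suf; omega) (by unfold dig suf; omega) (by unfold suf; omega)]
          exact ⟨k1, k2⟩
  · obtain ⟨h1, h2, h3⟩ := hM
    refine ⟨⟨?_, fun s hs x hx => ?_, fun s hs => (h3 s hs (by omega)).2, fun s hs => (h3 s hs (by omega)).1⟩,
      fun a ha => ?_⟩
    · rw [h1 0 (Or.inl rfl) (fun s _ => by unfold dig suf; omega), h0]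
    · rw [h1 _ (by unfold tab; omega) ?_, htab s hs x hx]
      intro s' hs'
      have k1 := hlane s hs x
      constructor
      · intro he
        rw [he, hsegs s' hs' _ (Or.inl rfl)] at k1
        unfold tab dig at k1; omega
      · intro he
        rw [he, hsegs s' hs' _ (Or.inr rfl)] at k1
        unfold tab suf at k1; omega
    · have ha' := ha.trans (Nat.mod_le _ _)
      rw [h1 a (by omega) (fun s hs => by unfold dig suf; omega)]
      exact hother a fun s hs => by unfold tab; omega
  · simp [tabAddrs_length]

/-- The local algorithm for blocks of level `t - 1`. -/
def localProg (P : Params) (s : ℕ) (pos : Samp P.m s → ℕ) (lpos : Leaf P.m s → ℕ) : Prog :=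
  .seq (P.setup (s + 1)) (.seq (P.evalProg s (11 + 3 * (s + 1)) (10 + 3 * (s + 1)) pos lpos)
    (.seq (.op (.emit (11 + 3 * (s + 1)))) (.op .endRow)))

theorem localProg_halts {F : Type*} {R : Recov F P.n} {S : ℕ → Finset F} {T s : ℕ}
    (hG : P.Simulates E R S i (s + 1) T) (hi : i < P.n ^ (s + 1)) (hE : E.input.getD 0 0 = i)
    (hK : 11 + 3 * (s + 1) + P.size s ≤ P.K) (pos ρ : Samp P.m s → ℕ) (lpos a : Leaf P.m s → ℕ)
    (hpos : ∀ x, E.input.getD (pos x) 0 = ρ x) (hρ : ∀ x, ρ x < P.n)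
    (hlpos : ∀ y, E.input.getD (lpos y) 0 = P.K * (a y * P.n)) :
    ∃ σ, Halts E (P.localProg s pos lpos) σ ∧ σ.out = [[ev R P.m P.θ P.L S i s 0 ρ a]] ∧
      σ.time ≤ (s + 1) * P.n + (2 + (s + 1) * (P.n * 7 + 1)) + P.evTime T s + 2 ∧
      σ.asked.card ≤ P.evAsk s := by
  have hsz := P.size_pos s
  have h := (setup_tri (P := P) (E := E) hi hE (by omega)).seq
    (q := P.evalProg s (11 + 3 * (s + 1)) (10 + 3 * (s + 1)) pos lpos) fun M hM =>
      -- Register `10 + 3 * (s + 1)` is still zero after the setup and serves as the offset of the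
      -- whole word; the first frame begins right after it.
      (eval_tri hG s (11 + 3 * (s + 1)) (10 + 3 * (s + 1)) 0 pos ρ lpos a M (by omega) (by omega) hK (by omega)
        (by omega) (by omega) hM.1 (fun c hc => hM.2 c (by omega))
        (hM.2 _ (by rw [Nat.mod_eq_of_lt (by omega)])) hpos hρ hlpos).mono le_rfl le_rfl
          (Q' := fun M' => M' (11 + 3 * (s + 1)) = ev R P.m P.θ P.L S i s 0 ρ a) fun _ h => h.2.2
  obtain ⟨σ, hx, hres, hrow, hout, htime, hask⟩ := h State.init rfl
  cases hx with
  | seq hx₁ hx₂ =>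
    refine ⟨_, Exec.seq hx₁ (Exec.seq hx₂ (Exec.seq (Exec.op _ _) (Exec.op _ _))), ?_, ?_, ?_⟩
    · change σ.out ++ [σ.row ++ [σ.mem _]] = _
      rw [hres, hout, hrow]
      rfl
    · change σ.time + 1 + 1 ≤ _
      have : State.init.time = 0 := rfl
      omega
    · change σ.asked.card ≤ _
      have : State.init.asked.card = 0 := rfl
      omega

end

end Params


/-! ### The preprocessing -/

/-- The final state of a straight-line program. -/
def runOps (E : Env) (s : State) (l : List Op) : State := l.foldl (fun s o => o.exec E s) s

theorem Exec.ops (E : Env) : ∀ (l : List Op) (s : State), Exec E (LLR.block l) s (runOps E s l)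
  | [], s => Exec.nop s
  | o :: l, s => Exec.seq (Exec.op o s) (Exec.ops E l (o.exec E s))

theorem runOps_append (E : Env) (s : State) (l l' : List Op) :
    runOps E s (l ++ l') = runOps E (runOps E s l) l' := List.foldl_append ..

theorem runOps_cons (E : Env) (s : State) (o : Op) (l : List Op) :
    runOps E s (o :: l) = runOps E (o.exec E s) l := rfl

theorem runOps_nil (E : Env) (s : State) : runOps E s [] = s := rfl

/-- Store the first `R` symbols of the random tape at the addresses from `10` on. -/
def tapeOps (R : ℕ) : List Op := (List.range R).flatMap fun r => [.const 1 r, .rand (10 + r) 1]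

/-- Write the row that consists of the stored symbols and `w`. -/
def rowOps (R : ℕ) (w : List ℕ) : List Op :=
  ((List.range R).map fun r => .emit (10 + r)) ++ (w.flatMap fun c => [.const 1 c, .emit 1]) ++ [.endRow]

theorem runOps_tapeOps (E : Env) (s : State) (R : ℕ) :
    (∀ r < R, (runOps E s (tapeOps R)).mem (10 + r) = E.coin r) ∧
    (runOps E s (tapeOps R)).row = s.row ∧ (runOps E s (tapeOps R)).out = s.out ∧
    (runOps E s (tapeOps R)).time = s.time + R * (1 + E.coinCost) := by
  induction R with
  | zero => exact ⟨fun r hr => absurd hr (by omega), rfl, rfl, by simp [tapeOps, runOps_nil]⟩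
  | succ R ih =>
    obtain ⟨h1, h2, h3, h4⟩ := ih
    have he : tapeOps (R + 1) = tapeOps R ++ [.const 1 R, .rand (10 + R) 1] := by
      simp [tapeOps, List.range_succ, List.flatMap_append]
    rw [he, runOps_append]
    set s' := runOps E s (tapeOps R)
    refine ⟨fun r hr => ?_, h2, h3, ?_⟩
    · change Function.update (Function.update s'.mem 1 R) (10 + R)
        (E.coin (Function.update s'.mem 1 R 1)) (10 + r) = _
      rw [Function.update_self]
      rcases Nat.lt_succ_iff_lt_or_eq.1 hr with hr | rfl
      · rw [Function.update_of_ne (by omega), Function.update_of_ne (by omega), h1 r hr]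
      · rw [Function.update_self]
    · change s'.time + 1 + E.coinCost = _
      rw [h4]; ring

theorem runOps_emits (E : Env) (l : List ℕ) (s : State) :
    runOps E s (l.map .emit) = { s with row := s.row ++ l.map s.mem, time := s.time + l.length } := by
  induction l generalizing s with
  | nil => simp [runOps_nil]
  | cons a l ih =>
    rw [List.map_cons, runOps_cons, ih]
    simp [Op.exec, State.tick]
    omega

theorem runOps_words (E : Env) (w : List ℕ) (s : State) :
    (∀ a, a ≠ 1 → (runOps E s (w.flatMap fun c => [.const 1 c, .emit 1])).mem a = s.mem a) ∧
    (runOps E s (w.flatMap fun c => [.const 1 c, .emit 1])).row = s.row ++ w ∧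
    (runOps E s (w.flatMap fun c => [.const 1 c, .emit 1])).out = s.out ∧
    (runOps E s (w.flatMap fun c => [.const 1 c, .emit 1])).time = s.time + 2 * w.length := by
  induction w generalizing s with
  | nil => simp [runOps_nil]
  | cons c w ih =>
    rw [List.flatMap_cons, runOps_append]
    obtain ⟨h1, h2, h3, h4⟩ := ih (runOps E s [.const 1 c, .emit 1])
    refine ⟨fun a ha => ?_, ?_, ?_, ?_⟩
    · rw [h1 a ha]
      simp [runOps_cons, runOps_nil, Op.exec, State.set, State.tick, ha]
    · rw [h2]
      simp [runOps_cons, runOps_nil, Op.exec, State.set, State.tick]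
    · rw [h3]
      simp [runOps_cons, runOps_nil, Op.exec, State.set, State.tick]
    · rw [h4]
      simp [runOps_cons, runOps_nil, Op.exec, State.set, State.tick]
      ring

theorem runOps_rowOps (E : Env) (R : ℕ) (w : List ℕ) (s : State) (hs : s.row = []) :
    (∀ a, a ≠ 1 → (runOps E s (rowOps R w)).mem a = s.mem a) ∧ (runOps E s (rowOps R w)).row = [] ∧
    (runOps E s (rowOps R w)).out = s.out ++ [((List.range R).map fun r => s.mem (10 + r)) ++ w] ∧
    (runOps E s (rowOps R w)).time = s.time + (R + 2 * w.length + 1) := by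
  have he : ((List.range R).map fun r => Op.emit (10 + r)) = ((List.range R).map (10 + ·)).map Op.emit := by
    simp
  rw [rowOps, runOps_append, runOps_append, he, runOps_emits]
  obtain ⟨h1, h2, h3, h4⟩ := runOps_words E w
    { s with row := s.row ++ ((List.range R).map (10 + ·)).map s.mem,
             time := s.time + ((List.range R).map (10 + ·)).length }
  set s' := runOps E _ (w.flatMap fun c => [.const 1 c, .emit 1])
  refine ⟨fun a ha => h1 a ha, rfl, ?_, ?_⟩
  · change s'.out ++ [s'.row] = _
    rw [h2, h3, hs]
    simp [Function.comp_def]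
  · change s'.time + 1 = _
    rw [h4]
    simp
    ring

theorem runOps_rows (E : Env) (R lc : ℕ) (ws : List (List ℕ)) (hw : ∀ w ∈ ws, w.length = lc) (s : State)
    (hs : s.row = []) :
    (runOps E s (ws.flatMap (rowOps R))).out =
      s.out ++ ws.map (fun w => ((List.range R).map fun r => s.mem (10 + r)) ++ w) ∧
    (runOps E s (ws.flatMap (rowOps R))).time = s.time + ws.length * (R + 2 * lc + 1) := by
  induction ws generalizing s with
  | nil => simp [runOps_nil]
  | cons w ws ih =>
    rw [List.flatMap_cons, runOps_append]
    obtain ⟨h1, h2, h3, h4⟩ := runOps_rowOps E R w s hs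
    obtain ⟨g1, g2⟩ := ih (fun w' hw' => hw w' (by simp [hw'])) _ h2
    have hm : ∀ r, (runOps E s (rowOps R w)).mem (10 + r) = s.mem (10 + r) := fun r => h1 _ (by omega)
    rw [g1, g2, h3, h4, hw w (by simp)]
    simp only [hm]
    refine ⟨by simp, ?_⟩
    rw [List.length_cons]
    ring

theorem pre_halts (E : Env) (R lc : ℕ) (ws : List (List ℕ)) (hw : ∀ w ∈ ws, w.length = lc) :
    ∃ σ, Halts E (block (tapeOps R ++ ws.flatMap (rowOps R))) σ ∧
      σ.out = ws.map (fun w => (List.range R).map E.coin ++ w) ∧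
      σ.time = R * (1 + E.coinCost) + ws.length * (R + 2 * lc + 1) := by
  refine ⟨_, Exec.ops E _ _, ?_⟩
  rw [runOps_append]
  obtain ⟨h1, h2, h3, h4⟩ := runOps_tapeOps E State.init R
  obtain ⟨g1, g2⟩ := runOps_rows E R lc ws hw _ h2
  rw [g1, g2, h3, h4]
  constructor
  · have : ((List.range R).map fun r => (runOps E State.init (tapeOps R)).mem (10 + r)) =
        (List.range R).map E.coin :=
      List.map_congr_left fun r hr => h1 r (List.mem_range.1 hr)
    rw [this]
    rfl
  · have : State.init.time = 0 := rfl
    omega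

/-- Every symbol and every closed row costs a step, and closing a row only moves symbols. So time
bounds both the number of candidates and the length of what is written. -/
theorem Exec.output_le {E : Env} {p : Prog} {s s' : State} (h : Exec E p s s') :
    (s'.out.flatten ++ s'.row).length + s'.out.length + s.time ≤
      (s.out.flatten ++ s.row).length + s.out.length + s'.time := by
  induction h with
  | nop s => exact le_rfl
  | op o s =>
    cases o <;> simp [Op.exec, State.set, State.tick] <;> omega
  | seq _ _ ih₁ ih₂ => omega
  | iteTrue _ _ ih => simp only [State.tick] at ih; omega
  | iteFalse _ _ ih => simp only [State.tick] at ih; omega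
  | loopStop _ => simp only [State.tick]; omega
  | loopStep _ _ _ ih₁ ih₂ => simp only [State.tick] at ih₁; omega

theorem Halts.output_le {E : Env} {p : Prog} {s : State} (h : Halts E p s) :
    (s.out.flatten ++ s.row).length + s.out.length ≤ s.time := by
  simpa [State.init] using Exec.output_le h

/-! ### The algorithm -/

section

variable {F : Type*} [Field F] {q k : ℕ}

/-- `G` list recovers `C` within `T` steps. -/
def GlobalProg {n : ℕ} (φ : F ≃ Fin q) (C : LinCode F k n) (α : ℝ) (ℓ L T : ℕ) (G : Prog) : Prop :=
  ∀ S : ListString F n, (∀ i, (S i).card = ℓ) →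
    ∃ s : State, Halts (listEnv φ S []) G s ∧ s.time ≤ T ∧ s.out.length ≤ L ∧
      (∀ r ∈ s.out, ∃ x, r = encodeWord φ (C x)) ∧
      ∀ x, listDist (C x) S ≤ α → encodeWord φ (C x) ∈ s.out

/-- The outputs of the runs become a function of `S`, the form in which the probabilistic analysis
uses list recovery. -/
theorem GlobalProg.exists_recov {n : ℕ} {φ : F ≃ Fin q} {C : LinCode F k n} {α : ℝ} {ℓ L T : ℕ} {G : Prog}
    (h : GlobalProg φ C α ℓ L T G) : ∃ R : Recov F n, R.Correct φ C α ℓ L ∧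
      ∀ S : ListString F n, (∀ i, (S i).card = ℓ) → ∃ s : State, Halts (listEnv φ S []) G s ∧ s.time ≤ T ∧
        s.out = R.out S ∧ s.row = R.row S := by
  have h' : ∀ S : ListString F n, ∃ s : State, (∀ i, (S i).card = ℓ) → Halts (listEnv φ S []) G s ∧
      s.time ≤ T ∧ s.out.length ≤ L ∧ (∀ r ∈ s.out, ∃ x, r = encodeWord φ (C x)) ∧
      ∀ x, listDist (C x) S ≤ α → encodeWord φ (C x) ∈ s.out := fun S => by
    by_cases hS : ∀ i, (S i).card = ℓ
    · obtain ⟨s, hs⟩ := h S hS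
      exact ⟨s, fun _ => hs⟩
    · exact ⟨State.init, fun h => absurd h hS⟩
  choose σ hσ using h'
  exact ⟨⟨fun S => (σ S).out, fun S => (σ S).row⟩,
    ⟨fun S hS => (hσ S hS).2.2.1, fun S hS => (hσ S hS).2.2.2.1, fun S hS => (hσ S hS).2.2.2.2⟩,
    fun S hS => ⟨σ S, (hσ S hS).1, (hσ S hS).2.1, rfl, rfl⟩⟩

namespace Params

/-- The words by which the advice `a` is described. -/
def advWords (P : Params) {lc : ℕ} (a : Fin lc → Fin P.L) : List ℕ := List.ofFn fun y => P.K * (a y * P.n)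

noncomputable def advices (P : Params) (lc : ℕ) : List (List ℕ) :=
  (Finset.univ : Finset (Fin lc → Fin P.L)).toList.map P.advWords

theorem advices_length (P : Params) (lc : ℕ) : (P.advices lc).length = P.L ^ lc := by
  simp [advices]

/-- The algorithm for the tensor power `s + 1`. -/
noncomputable def alg (P : Params) (hn : 0 < P.n) (s : ℕ) : LocalListAlg where
  pre := block (tapeOps (Fintype.card (Samp P.m s)) ++
    (P.advices (Fintype.card (Leaf P.m s))).flatMap (rowOps (Fintype.card (Samp P.m s))))
  loc := P.localProg s (fun x => 1 + Fintype.equivFin (Samp P.m s) x)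
    (fun y => 1 + Fintype.card (Samp P.m s) + Fintype.equivFin (Leaf P.m s) y)
  radix := P.n
  radix_pos := hn
  seedLen := Fintype.card (Samp P.m s)

/-- The description of the local algorithm with tape `ω` and advice `a`. -/
def descr (P : Params) {R lc : ℕ} (ω : Fin R → Fin P.n) (a : Fin lc → Fin P.L) : List ℕ :=
  (List.ofFn fun r => (ω r : ℕ)) ++ P.advWords a

variable {P : Params} {hn : 0 < P.n} {s : ℕ}

theorem alg_pre (ω : (P.alg hn s).Seed) : ∃ σ, Halts ((P.alg hn s).preEnv ω) (P.alg hn s).pre σ ∧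
    σ.out = (Finset.univ : Finset (Fin (Fintype.card (Leaf P.m s)) → Fin P.L)).toList.map (P.descr ω) ∧
    σ.time = Fintype.card (Samp P.m s) * (1 + Nat.size P.n) + P.L ^ Fintype.card (Leaf P.m s) *
      (Fintype.card (Samp P.m s) + 2 * Fintype.card (Leaf P.m s) + 1) := by
  obtain ⟨σ, h1, h2, h3⟩ := pre_halts ((P.alg hn s).preEnv ω) (Fintype.card (Samp P.m s))
    (Fintype.card (Leaf P.m s)) (P.advices (Fintype.card (Leaf P.m s))) (fun w hw => by
      obtain ⟨a, -, rfl⟩ := List.mem_map.1 hw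
      simp [advWords])
  refine ⟨σ, h1, ?_, ?_⟩
  · rw [h2, advices, List.map_map]
    refine List.map_congr_left fun a _ => ?_
    have : (List.range (Fintype.card (Samp P.m s))).map ((P.alg hn s).preEnv ω).coin =
        List.ofFn fun r => (ω r : ℕ) := by
      apply List.ext_getElem
      · simp [alg]
      · intro j h1 h2
        have hj : j < Fintype.card (Samp P.m s) := by simpa using h1
        simp [LocalListAlg.preEnv, alg, hj]
    rw [Function.comp, this]
    rfl
  · rw [h3, advices_length]
    rfl

theorem alg_outputs {ω : (P.alg hn s).Seed} {D : List (List ℕ)} (h : (P.alg hn s).Outputs ω D) :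
    D = (Finset.univ : Finset (Fin (Fintype.card (Leaf P.m s)) → Fin P.L)).toList.map (P.descr ω) := by
  obtain ⟨σ, h1, rfl⟩ := h
  obtain ⟨σ', h1', h2, -⟩ := alg_pre (hn := hn) ω
  rw [Exec.unique h1 h1', h2]

theorem descr_tape {R lc : ℕ} (ω : Fin R → Fin P.n) (a : Fin lc → Fin P.L) (i : ℕ) (r : Fin R) :
    (i :: P.descr ω a).getD (1 + r) 0 = ω r := by
  rw [add_comm, List.getD_cons_succ, descr, List.getD_append _ _ _ _ (by simp)]
  simp [List.getD_eq_getElem?_getD]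

theorem descr_advice {R lc : ℕ} (ω : Fin R → Fin P.n) (a : Fin lc → Fin P.L) (i : ℕ) (y : Fin lc) :
    (i :: P.descr ω a).getD (1 + R + y) 0 = P.K * (a y * P.n) := by
  have h : 1 + R + (y : ℕ) = (R + y) + 1 := by ring
  rw [h, List.getD_cons_succ, descr, List.getD_append_right _ _ _ _ (by simp), advWords]
  simp [List.getD_eq_getElem?_getD]

/-- A column of the lists is itself a string of lists, and its oracle is the oracle of `S` at
shifted coordinates. The bound on `o` keeps these coordinates in range. -/
theorem simulates {φ : F ≃ Fin q} {ℓ T : ℕ} {R : Recov F P.n} {t : ℕ}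
    (hG : ∀ S : ListString F P.n, (∀ i, (S i).card = ℓ) → ∃ s : State, Halts (listEnv φ S []) P.G s ∧
      s.time ≤ T ∧ s.out = R.out S ∧ s.row = R.row S) (S : ListString F (P.n ^ t)) (S' : ℕ → Finset F)
    (hS' : ∀ i, (S' i).card = ℓ) (hSS' : ∀ i : Fin (P.n ^ t), S' i = S i) (i : ℕ) (inp : List ℕ) :
    P.Simulates (listEnv φ S inp) R S' i t T := by
  intro s o hs ho
  obtain ⟨σ, h1, h2, h3, h4⟩ := hG (col P.n S' i s o) fun _ => hS' _
  refine ⟨listOracle φ (col P.n S' i s o), σ, h1, h3, h4, h2, ?_, fun x hx j => ?_, fun x hx j => ?_⟩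
  · have := Halts.output_le h1
    omega
  · have hlt : x * P.n ^ s + (o + i % P.n ^ s) < P.n ^ t := by
      have h5 : (x + 1) * P.n ^ s ≤ P.n ^ (s + 1) := by
        rw [pow_succ']
        exact Nat.mul_le_mul_right _ hx
      have h6 : (x + 1) * P.n ^ s = x * P.n ^ s + P.n ^ s := by ring
      have h7 : i % P.n ^ s < P.n ^ s := Nat.mod_lt _ (pow_pos (by omega) _)
      omega
    have he : col P.n S' i s o ⟨x, hx⟩ = S ⟨x * P.n ^ s + (o + i % P.n ^ s), hlt⟩ := by
      rw [← hSS', col]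
      congr 1
      simp only
      ring
    rw [listOracle, dif_pos hx, he]
    change _ = listOracle φ S _ j
    rw [listOracle, dif_pos hlt]
  · rw [listOracle, dif_neg (by omega)]

theorem alg_local {φ : F ≃ Fin q} {ℓ T : ℕ} {R : Recov F P.n}
    (hG : ∀ S : ListString F P.n, (∀ i, (S i).card = ℓ) → ∃ s : State, Halts (listEnv φ S []) P.G s ∧
      s.time ≤ T ∧ s.out = R.out S ∧ s.row = R.row S) (S : ListString F (P.n ^ (s + 1))) (S' : ℕ → Finset F)
    (hS' : ∀ i, (S' i).card = ℓ) (hSS' : ∀ i : Fin (P.n ^ (s + 1)), S' i = S i)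
    (hK : 11 + 3 * (s + 1) + P.size s ≤ P.K) (ω : (P.alg hn s).Seed)
    (a : Fin (Fintype.card (Leaf P.m s)) → Fin P.L) (i : Fin (P.n ^ (s + 1))) :
    ∃ σ, (P.alg hn s).LocalHalts φ S (P.descr ω a) i σ ∧
      σ.out = [[ev R P.m P.θ P.L S' i s 0 (fun x => ω (Fintype.equivFin (Samp P.m s) x))
        (fun y => a (Fintype.equivFin (Leaf P.m s) y))]] ∧
      σ.time ≤ (s + 1) * P.n + (2 + (s + 1) * (P.n * 7 + 1)) + P.evTime T s + 2 ∧
      σ.asked.card ≤ P.evAsk s :=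
  localProg_halts (simulates hG S S' hS' hSS' i _) i.2 rfl hK _ _ _ _
    (fun _ => descr_tape ω a i _) (fun _ => (ω _).2) (fun _ => descr_advice ω a i _)

theorem alg_recovers {φ : F ≃ Fin q} {ℓ T : ℕ} {C : LinCode F k P.n} {α ε δ : ℝ}
    (hG : GlobalProg φ C α ℓ P.L T P.G) (hK : 11 + 3 * (s + 1) + P.size s ≤ P.K)
    (hδ : HasRelDist C δ) (hδ0 : 0 < δ) (hδ1 : δ ≤ 1) (hL : 0 < P.L)
    (hm : 0 < P.m) (hα : 0 < α) (hε : 0 < ε) (hε1 : ε ≤ 1)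
    (h4 : Real.exp (-(δ * P.m / 16)) ≤ ε * (δ / 64) ^ (s + 1) / 2)
    (h5 : P.L * Real.exp (-(δ * P.m / 10)) ≤ (ε * (δ / 64) ^ (s + 1)) ^ 2 / 8)
    (hθ1 : δ * P.m / 4 < P.θ + 1) (hθ2 : P.θ ≤ δ * P.m / 4) :
    (P.alg hn s).ApproxLocallyListRecovers φ (tensorPow C (s + 1)) (P.evAsk s)
      (α * ε * (δ / 64) ^ (s + 1 + s)) ε ℓ ((P.L : ℝ) ^ P.m ^ s) ∧
    (P.alg hn s).RunningTime φ (P.n ^ (s + 1)) ℓ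
      (((s + 1) * P.n + (2 + (s + 1) * (P.n * 7 + 1)) + P.evTime T s + 2 : ℕ) : ℝ) := by
  obtain ⟨R, hR, hRG⟩ := hG.exists_recov
  have hN : 0 < P.n ^ (s + 1) := pow_pos hn _
  -- The analysis uses lists indexed by all natural numbers; the periodic extension keeps every list
  -- of size `ℓ`.
  have hext : ∀ S : ListString F (P.n ^ (s + 1)), (∀ i, (S i).card = ℓ) → ∃ S' : ℕ → Finset F,
      (∀ i, (S' i).card = ℓ) ∧ ∀ i : Fin (P.n ^ (s + 1)), S' i = S i := fun S hS =>
    ⟨fun i => S ⟨i % P.n ^ (s + 1), Nat.mod_lt _ hN⟩, fun i => hS _, fun i => by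
      exact congrArg S (Fin.ext (Nat.mod_eq_of_lt i.2))⟩
  refine ⟨⟨fun ω => ?_, fun ω D hD d hd S hS i => ?_, fun S hS x hx => ?_⟩, fun ω D hD d hd S hS i => ?_⟩
  · obtain ⟨σ, h1, h2, -⟩ := alg_pre (hn := hn) ω
    refine ⟨σ.out, ⟨σ, h1, rfl⟩, ?_⟩
    rw [h2]
    simp [card_leaf]
  · rw [alg_outputs hD] at hd
    obtain ⟨a, -, rfl⟩ := List.mem_map.1 hd
    obtain ⟨S', hS', hSS'⟩ := hext S hS
    obtain ⟨σ, h1, -, -, h2⟩ := alg_local (hn := hn) hRG S S' hS' hSS' hK ω a i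
    exact ⟨σ, h1, by exact_mod_cast h2⟩
  · obtain ⟨S', hS', hSS'⟩ := hext S hS
    set w : ℕ → F := fun y => tensorPow C (s + 1) x ⟨y % P.n ^ (s + 1), Nat.mod_lt _ hN⟩ with hw
    have hwi : ∀ i : Fin (P.n ^ (s + 1)), w i = tensorPow C (s + 1) x i := fun i => by
      rw [hw]
      simp only [Nat.mod_eq_of_lt i.2]
    have hlev := levelCorrect hR hS' (m := P.m) (θ := P.θ) (t := s + 1) hδ hδ0 hδ1 hn hL hm hα hε hε1 h4 h5
      hθ1 hθ2 s (by omega) 0 w (inTensor_tensorPow C s x w hwi) (by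
        refine le_trans (le_of_eq ?_) hx
        rw [listDist]
        simp only [Nat.zero_add, hwi, hSS'])
    have he : s + 1 - 1 - s = 0 := by omega
    rw [he, pow_zero, mul_one] at hlev
    have : Nonempty (Fin P.n) := ⟨⟨0, hn⟩⟩
    have : Nonempty (Fin (P.n ^ (s + 1))) := ⟨⟨0, hN⟩⟩
    rw [frac_not] at hlev
    -- The analysis indexes tapes by the recursion tree, the machine by positions; an enumeration of
    -- `Samp` preserves the uniform distribution.
    have hseed := frac_equiv (Equiv.arrowCongr (Fintype.equivFin (Samp P.m s)).symm (Equiv.refl (Fin P.n)))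
      (fun ω : Samp P.m s → Fin P.n => ∃ a : Leaf P.m s → Fin P.L,
        frac (fun i : Fin (P.n ^ (s + 1)) =>
          ev R P.m P.θ P.L S' i s 0 (fun x => ω x) (fun x => a x) ≠ φ (w i)) ≤ ε)
    rw [← hseed] at hlev
    refine le_trans (by linarith) (frac_mono (X := Fin (Fintype.card (Samp P.m s)) → Fin P.n) ?_)
    rintro ω ⟨a, ha⟩
    obtain ⟨σ, h1, h2, -⟩ := alg_pre (hn := hn) (s := s) ω
    refine ⟨σ.out, ⟨σ, h1, rfl⟩, P.descr ω (fun y => a ((Fintype.equivFin (Leaf P.m s)).symm y)), ?_, ?_⟩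
    · rw [h2]
      exact List.mem_map_of_mem (Finset.mem_toList.2 (Finset.mem_univ _))
    · have hnot := frac_not (X := Fin (P.n ^ (s + 1))) fun i =>
        ev R P.m P.θ P.L S' i s 0 (fun x => ω (Fintype.equivFin (Samp P.m s) x)) (fun x => a x) ≠ φ (w i)
      refine le_trans (b := 1 - frac (fun i : Fin (P.n ^ (s + 1)) => ev R P.m P.θ P.L S' i s 0
        (fun x => ω (Fintype.equivFin (Samp P.m s) x)) (fun x => a x) ≠ φ (w i))) ?_ ?_
      · have ha' : frac (fun i : Fin (P.n ^ (s + 1)) => ev R P.m P.θ P.L S' i s 0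
          (fun x => ω (Fintype.equivFin (Samp P.m s) x)) (fun x => a x) ≠ φ (w i)) ≤ ε := ha
        linarith
      · rw [← hnot]
        refine frac_mono fun i hi => ?_
        rw [not_not] at hi
        obtain ⟨σ', g1, g2, -⟩ := alg_local (hn := hn) hRG S S' hS' hSS' hK ω
          (fun y => a ((Fintype.equivFin (Leaf P.m s)).symm y)) i
        refine ⟨σ', g1, ?_⟩
        simp only [Equiv.symm_apply_apply] at g2
        rw [g2, hi, hwi]
  · rw [alg_outputs hD] at hd
    obtain ⟨a, -, rfl⟩ := List.mem_map.1 hd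
    obtain ⟨S', hS', hSS'⟩ := hext S hS
    obtain ⟨σ, h1, -, h2, -⟩ := alg_local (hn := hn) hRG S S' hS' hSS' hK ω a i
    exact ⟨σ, h1, by exact_mod_cast h2⟩

theorem alg_preprocessingTime (hn : 0 < P.n) : (P.alg hn s).PreprocessingTime
    ((Fintype.card (Samp P.m s) * (1 + Nat.size P.n) + P.L ^ Fintype.card (Leaf P.m s) *
      (Fintype.card (Samp P.m s) + 2 * Fintype.card (Leaf P.m s) + 1) : ℕ) : ℝ) := fun ω => by
  obtain ⟨σ, h1, -, h2⟩ := alg_pre (hn := hn) ω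
  exact ⟨σ, h1, by rw [h2]⟩

end Params

end


/-! ### Every list recoverable code has a list recovery algorithm -/

/-- A branch on a word that is at most `q` is a chain of tests that counts the word down, with a
copy of a program in each arm. The arm starts in some state `s'` whose memory is left unspecified;
only its output tape matters. -/
theorem exists_switch (q : ℕ) (p : ℕ → Prog) : ∃ P : Prog, ∀ (E : Env) (s : State), s.mem 2 ≤ q →
    ∃ s' : State, s'.row = s.row ∧ s'.out = s.out ∧ ∀ s'', Exec E (p (s.mem 2)) s' s'' → Exec E P s s'' := by
  induction q generalizing p with
  | zero =>
    refine ⟨p 0, fun E s hs => ⟨s, rfl, rfl, fun s'' h => ?_⟩⟩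
    rwa [Nat.le_zero.1 hs] at h
  | succ q ih =>
    obtain ⟨P, hP⟩ := ih fun v => p (v + 1)
    refine ⟨.ite 2 (.seq (block [.const 3 1, .sub 2 2 3]) P) (p 0), fun E s hs => ?_⟩
    by_cases h0 : s.mem 2 = 0
    · refine ⟨s.tick 1, rfl, rfl, fun s'' h => Exec.iteFalse h0 ?_⟩
      rwa [h0] at h
    · have hm : (runOps E (s.tick 1) [.const 3 1, .sub 2 2 3]).mem 2 = s.mem 2 - 1 := by
        simp [runOps_cons, runOps_nil, Op.exec, State.set, State.tick]
      obtain ⟨s', h1, h2, h3⟩ := hP E (runOps E (s.tick 1) [.const 3 1, .sub 2 2 3]) (by omega)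
      refine ⟨s', h1, h2, fun s'' h => Exec.iteTrue h0 (Exec.seq (Exec.ops E _ _) (h3 s'' ?_))⟩
      rw [hm]
      rwa [Nat.sub_add_cancel (by omega)]

/-- A program can branch according to the answers to a fixed list of queries. -/
theorem exists_tree (q : ℕ) (l : List (ℕ × ℕ)) (f : List ℕ → Prog) : ∃ P : Prog, ∀ (E : Env) (s : State),
    (∀ p ∈ l, E.oracle p.1 p.2 ≤ q) → ∃ s' : State, s'.row = s.row ∧ s'.out = s.out ∧
      ∀ s'', Exec E (f (l.map fun p => E.oracle p.1 p.2)) s' s'' → Exec E P s s'' := by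
  induction l generalizing f with
  | nil => exact ⟨f [], fun E s _ => ⟨s, rfl, rfl, fun s'' h => h⟩⟩
  | cons p l ih =>
    choose P hP using fun v => ih fun a => f (v :: a)
    obtain ⟨P', hP'⟩ := exists_switch q P
    refine ⟨.seq (block [.const 0 p.1, .const 1 p.2, .query 2 0 1]) P', fun E s hl => ?_⟩
    have hm : (runOps E s [.const 0 p.1, .const 1 p.2, .query 2 0 1]).mem 2 = E.oracle p.1 p.2 := by
      simp [runOps_cons, runOps_nil, Op.exec, State.set, State.tick]
    obtain ⟨s₁, h1, h2, h3⟩ := hP' E (runOps E s [.const 0 p.1, .const 1 p.2, .query 2 0 1])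
      (by rw [hm]; exact hl p (by simp))
    obtain ⟨s₂, g1, g2, g3⟩ := hP (E.oracle p.1 p.2) E s₁ fun p' hp' => hl p' (by simp [hp'])
    rw [hm] at h3
    exact ⟨s₂, g1.trans h1, g2.trans h2, fun s'' h => Exec.seq (Exec.ops E _ _) (h3 s'' (g3 s'' h))⟩

section

variable {F : Type*} {q n k : ℕ}

theorem listOracle_le (φ : F ≃ Fin q) (S : ListString F n) (x j : ℕ) : listOracle φ S x j ≤ q := by
  rw [listOracle]
  split_ifs with h
  · rw [List.getD_eq_getElem?_getD]
    by_cases hj : j < (((S ⟨x, h⟩).map (φ.toEmbedding.trans Fin.valEmbedding)).sort (· ≤ ·)).length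
    · rw [List.getElem?_eq_getElem hj, Option.getD_some]
      have := List.getElem_mem hj
      rw [Finset.mem_sort, Finset.mem_map] at this
      obtain ⟨a, -, ha⟩ := this
      rw [← ha]
      exact (φ a).2.le
    · rw [List.getElem?_eq_none (by omega)]
      exact Nat.zero_le _
  · exact Nat.zero_le _

theorem eq_of_listOracle_eq {ℓ : ℕ} (φ : F ≃ Fin q) {S S' : ListString F n} (hS : ∀ i, (S i).card = ℓ)
    (hS' : ∀ i, (S' i).card = ℓ) (h : ∀ x < n, ∀ j < ℓ, listOracle φ S x j = listOracle φ S' x j) :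
    S = S' := by
  funext i
  apply Finset.map_injective (φ.toEmbedding.trans Fin.valEmbedding)
  have hl : ((S i).map (φ.toEmbedding.trans Fin.valEmbedding)).sort (· ≤ ·) =
      ((S' i).map (φ.toEmbedding.trans Fin.valEmbedding)).sort (· ≤ ·) := by
    apply List.ext_getElem
    · simp [hS, hS']
    · intro j h1 h2
      have := h i i.2 j (by simpa [hS] using h1)
      simpa only [listOracle, i.2, dif_pos, Fin.eta, List.getD_eq_getElem?_getD, List.getElem?_eq_getElem h1,
        List.getElem?_eq_getElem h2, Option.getD_some] using this
  rw [← Finset.sort_toFinset ((S i).map _) (· ≤ ·), hl, Finset.sort_toFinset]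

/-- The `nℓ` answers of the oracle determine `S`, so a decision tree can ask for all of them and
print a hard-wired list of codewords. There are finitely many `S`, so the running times have a
maximum, which is all that is needed of `T`. -/
theorem exists_globalProg [Field F] [Finite F] (φ : F ≃ Fin q) {C : LinCode F k n} {α : ℝ} {ℓ L : ℕ}
    (hC : ListRecoverable C α ℓ L) : ∃ (T : ℕ) (G : Prog), GlobalProg φ C α ℓ L T G := by
  classical
  have := Fintype.ofFinite F
  set pts : List (ℕ × ℕ) := List.range n ×ˢ List.range ℓ with hpts
  set ans : ListString F n → List ℕ := fun S => pts.map fun p => listOracle φ S p.1 p.2 with hans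
  have hinj : ∀ S S' : ListString F n, (∀ i, (S i).card = ℓ) → (∀ i, (S' i).card = ℓ) → ans S = ans S' →
      S = S' := fun S S' hS hS' h => eq_of_listOracle_eq φ hS hS' fun x hx j hj =>
    List.map_inj_left.1 h (x, j) (by simp [hpts, hx, hj])
  set ws : List ℕ → List (List ℕ) := fun a =>
    if h : ∃ S : ListString F n, (∀ i, (S i).card = ℓ) ∧ ans S = a then
      (hC h.choose h.choose_spec.1).1.toFinset.toList.map fun x => encodeWord φ (C x)
    else [] with hws
  have hws' : ∀ (S : ListString F n) (hS : ∀ i, (S i).card = ℓ), ws (ans S) =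
      (hC S hS).1.toFinset.toList.map fun x => encodeWord φ (C x) := fun S hS => by
    have h : ∃ S' : ListString F n, (∀ i, (S' i).card = ℓ) ∧ ans S' = ans S := ⟨S, hS, rfl⟩
    have he := hinj _ _ h.choose_spec.1 hS h.choose_spec.2
    simp only [hws, dif_pos h, he]
  obtain ⟨G, hG⟩ := exists_tree q pts fun a => block ((ws a).flatMap (rowOps 0))
  have hrun : ∀ S : ListString F n, ∃ s : State, ∀ hS : ∀ i, (S i).card = ℓ, Halts (listEnv φ S []) G s ∧
      s.out = (hC S hS).1.toFinset.toList.map fun x => encodeWord φ (C x) := fun S => by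
    by_cases hS : ∀ i, (S i).card = ℓ
    · obtain ⟨s', h1, h2, h3⟩ := hG (listEnv φ S []) State.init fun p _ => listOracle_le φ S _ _
      refine ⟨_, fun _ => ⟨h3 _ (Exec.ops _ _ _), ?_⟩⟩
      change (runOps _ s' ((ws (ans S)).flatMap (rowOps 0))).out = _
      rw [(runOps_rows _ 0 n _ (fun w hw => ?_) s' h1).1, h2, hws' S hS]
      · simp [State.init]
      · rw [hws' S hS] at hw
        obtain ⟨x, -, rfl⟩ := List.mem_map.1 hw
        simp [encodeWord]
    · exact ⟨State.init, fun h => absurd h hS⟩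
  choose σ hσ using hrun
  refine ⟨Finset.univ.sup fun S => (σ S).time, G, fun S hS => ⟨σ S, (hσ S hS).1,
    Finset.le_sup (f := fun S => (σ S).time) (Finset.mem_univ S), ?_, fun r hr => ?_, fun x hx => ?_⟩⟩
  · rw [(hσ S hS).2, List.length_map, Finset.length_toList, ← Set.ncard_eq_toFinset_card]
    exact (hC S hS).2
  · rw [(hσ S hS).2] at hr
    obtain ⟨x, -, rfl⟩ := List.mem_map.1 hr
    exact ⟨x, rfl⟩
  · rw [(hσ S hS).2]
    refine List.mem_map.2 ⟨x, ?_, rfl⟩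
    rw [Finset.mem_toList, Set.Finite.mem_toFinset]
    exact hx

end


/-! ### Estimates -/

section

variable {c s L m : ℕ} {α ε δ : ℝ}

theorem one_le_logb_two (hL : 2 ≤ L) : 1 ≤ Real.logb 2 L := by
  rw [Real.le_logb_iff_rpow_le (by norm_num) (by positivity), Real.rpow_one]
  exact_mod_cast hL

/-- With `t = s + 1` and `t² = t * t`, the cost factor is a perfect `t`-th power, and it suffices to
compare the bases. The exponent `c * t` exceeds `t`, which frees one factor `δ/c ≤ δ/2^20`; this
pays for `32 * 512 = 2^14` and for the `δ` in the denominator of the bound on `m`. -/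
theorem le_costFactor (hc : 2 ^ 20 ≤ c) (hL : 2 ≤ L) (hα : 0 < α) (hα1 : α ≤ 1) (hε : 0 < ε) (hε1 : ε ≤ 1)
    (hδ : 0 < δ) (hδ1 : δ ≤ 1)
    (hm : (m : ℝ) ≤ 512 * Real.logb 2 L / (δ * (ε * (δ / 64) ^ (s + 1)))) :
    (32 * (m : ℝ)) ^ (s + 1) ≤ costFactor c (s + 1) L α ε δ := by
  have hΛ := one_le_logb_two hL
  have hc' : (2 : ℝ) ^ 20 ≤ c := by exact_mod_cast hc
  have hc0 : (0 : ℝ) < c := lt_of_lt_of_le (by positivity) hc'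
  have hd0 : 0 < δ / c := by positivity
  have hd64 : δ / c ≤ δ / 64 := div_le_div_of_nonneg_left hδ.le (by norm_num) (by norm_num at hc' ⊢; linarith)
  have hd20 : δ / c ≤ δ / 2 ^ 20 := div_le_div_of_nonneg_left hδ.le (by positivity) hc'
  have hd1 : δ / c ≤ 1 := hd64.trans (by linarith)
  have he : costFactor c (s + 1) L α ε δ =
      (Real.logb 2 L / ((α * ε) ^ c * (δ / c) ^ (c * (s + 1)))) ^ (s + 1) := by
    rw [costFactor, div_pow (Real.logb 2 L), mul_pow ((α * ε) ^ c), ← pow_mul, ← pow_mul, sq, mul_assoc]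
  rw [he]
  refine pow_le_pow_left₀ (by positivity) ?_ _
  have hD : (α * ε) ^ c * (δ / c) ^ (c * (s + 1)) ≤ ε * ((δ / 64) ^ (s + 1) * (δ / 2 ^ 20)) := by
    refine mul_le_mul ?_ ?_ (by positivity) hε.le
    · calc (α * ε) ^ c ≤ (α * ε) ^ 1 :=
            pow_le_pow_of_le_one (by positivity) (mul_le_one₀ hα1 hε.le hε1) (by omega)
        _ ≤ ε := by rw [pow_one]; exact mul_le_of_le_one_left hε.le hα1
    · calc (δ / c) ^ (c * (s + 1)) ≤ (δ / c) ^ (s + 1 + 1) :=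
            pow_le_pow_of_le_one hd0.le hd1 (by nlinarith)
        _ = (δ / c) ^ (s + 1) * (δ / c) := pow_succ _ _
        _ ≤ _ := mul_le_mul (pow_le_pow_left₀ hd0.le hd64 _) hd20 hd0.le (by positivity)
  calc 32 * (m : ℝ) ≤ 32 * (512 * Real.logb 2 L / (δ * (ε * (δ / 64) ^ (s + 1)))) := by linarith
    _ = 2 ^ 14 * Real.logb 2 L / (δ * (ε * (δ / 64) ^ (s + 1))) := by ring
    _ ≤ 2 ^ 20 * Real.logb 2 L / (δ * (ε * (δ / 64) ^ (s + 1))) := by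
        refine div_le_div_of_nonneg_right ?_ (by positivity)
        norm_num
        linarith
    _ = Real.logb 2 L / (ε * ((δ / 64) ^ (s + 1) * (δ / 2 ^ 20))) := by
        field_simp
    _ ≤ _ := div_le_div_of_nonneg_left (by linarith) (by positivity) hD

/-- The number of samples at each node that makes the failure probabilities small. -/
theorem exists_samples (hL : 2 ≤ L) (hε : 0 < ε) (hε1 : ε ≤ 1) (hδ : 0 < δ) (hδ1 : δ ≤ 1) : ∃ m : ℕ,
    256 ≤ m ∧ Real.logb 2 L ≤ m ∧ (m : ℝ) ≤ 512 * Real.logb 2 L / (δ * (ε * (δ / 64) ^ (s + 1))) ∧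
    Real.exp (-(δ * m / 16)) ≤ ε * (δ / 64) ^ (s + 1) / 2 ∧
    L * Real.exp (-(δ * m / 10)) ≤ (ε * (δ / 64) ^ (s + 1)) ^ 2 / 8 := by
  have hΛ := one_le_logb_two hL
  set Λ := Real.logb 2 L with hΛ_def
  have hη0 : 0 < ε * (δ / 64) ^ (s + 1) := by positivity
  have hη1 : ε * (δ / 64) ^ (s + 1) ≤ 1 :=
    mul_le_one₀ hε1 (by positivity) (pow_le_one₀ (by positivity) (by linarith))
  set η := ε * (δ / 64) ^ (s + 1)
  have hx : Λ ≤ Λ / (δ * η) := by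
    rw [le_div_iff₀ (by positivity)]
    exact mul_le_of_le_one_right (by linarith) (mul_le_one₀ hδ1 hη0.le hη1)
  have h256 : 256 * Λ / (δ * η) = 256 * (Λ / (δ * η)) := by ring
  have h512 : 512 * Λ / (δ * η) = 512 * (Λ / (δ * η)) := by ring
  have hm := Nat.le_ceil (256 * Λ / (δ * η))
  have hm' := Nat.ceil_lt_add_one (a := 256 * Λ / (δ * η)) (by positivity)
  set m := ⌈256 * Λ / (δ * η)⌉₊
  have hinv : 1 / η ≤ Λ / η := div_le_div_of_nonneg_right hΛ hη0.le
  have hδm : 256 * (Λ / η) ≤ δ * m := by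
    calc 256 * (Λ / η) = δ * (256 * Λ / (δ * η)) := by field_simp
      _ ≤ _ := mul_le_mul_of_nonneg_left hm hδ.le
  -- This crude bound is enough: it is used at `y = 2/η`, and twice at `y = 3/η` to produce `η²/9`.
  have hexp : ∀ y : ℝ, 0 < y → Real.exp (-y) ≤ 1 / y := fun y hy => by
    rw [Real.exp_neg, ← one_div]
    exact one_div_le_one_div_of_le hy (by linarith [Real.add_one_le_exp y])
  have h256m : (256 : ℝ) ≤ m := by linarith
  refine ⟨m, by exact_mod_cast h256m, by linarith, by linarith, ?_, ?_⟩
  · calc Real.exp (-(δ * m / 16)) ≤ Real.exp (-(2 * (1 / η))) := Real.exp_le_exp.2 (by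
          have : 0 < 1 / η := by positivity
          linarith)
      _ ≤ 1 / (2 * (1 / η)) := hexp _ (by positivity)
      _ = η / 2 := by field_simp
  · have hLe : (L : ℝ) ≤ Real.exp (Λ / η) := by
      have h1 : (L : ℝ) = (2 : ℝ) ^ Λ :=
        (Real.rpow_logb (by norm_num) (by norm_num) (by positivity)).symm
      rw [h1, Real.rpow_def_of_pos (by norm_num)]
      refine Real.exp_le_exp.2 ?_
      have h2 : Λ ≤ Λ / η := by
        rw [le_div_iff₀ hη0]
        exact mul_le_of_le_one_right (by linarith) hη1
      have h3 : Real.log 2 ≤ 1 := by linarith [Real.log_two_lt_d9]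
      nlinarith
    calc L * Real.exp (-(δ * m / 10)) ≤ Real.exp (Λ / η) * Real.exp (-(δ * m / 10)) :=
          mul_le_mul_of_nonneg_right hLe (Real.exp_pos _).le
      _ = Real.exp (Λ / η + -(δ * m / 10)) := (Real.exp_add _ _).symm
      -- Here `δm/10` is at least `25.6 * Λ/η`; one `Λ/η` is spent on `L`, and `Λ ≥ 1` covers `6/η`
      -- by the rest.
      _ ≤ Real.exp (-(3 * (1 / η)) + -(3 * (1 / η))) := Real.exp_le_exp.2 (by
          have : 0 < 1 / η := by positivity
          linarith)
      _ = Real.exp (-(3 * (1 / η))) * Real.exp (-(3 * (1 / η))) := Real.exp_add _ _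
      _ ≤ (1 / (3 * (1 / η))) * (1 / (3 * (1 / η))) :=
          mul_le_mul (hexp _ (by positivity)) (hexp _ (by positivity)) (Real.exp_pos _).le (by positivity)
      _ = η ^ 2 / 9 := by field_simp; norm_num
      _ ≤ η ^ 2 / 8 := div_le_div_of_nonneg_left (by positivity) (by norm_num) (by norm_num)

end

/-! ### Bounds for the cost recurrences -/

namespace Params

variable (P : Params)

/-- Base `2m` instead of `m` doubles the bound at each level, which absorbs the cost of the node
itself. The next two recurrences are solved in the same way. -/
theorem size_le (hm : 0 < P.m) (s : ℕ) : P.size s ≤ 6 * (2 * P.m) ^ s := by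
  induction s with
  | zero => simp [size]
  | succ s ih =>
    have h1 : 1 ≤ P.m * (2 * P.m) ^ s := Nat.mul_pos hm (pow_pos (by omega) _)
    have h2 := Nat.mul_le_mul_left P.m ih
    have h3 : 6 * (2 * P.m) ^ (s + 1) = 6 * (P.m * (2 * P.m) ^ s) + P.m * (6 * (2 * P.m) ^ s) := by ring
    rw [size]
    omega

theorem evAsk_le (hm : 0 < P.m) (s : ℕ) : P.evAsk s ≤ P.n * (2 * P.m) ^ s := by
  induction s with
  | zero => simp [evAsk]
  | succ s ih =>
    have h1 : P.n * 1 ≤ P.n * (P.m * (2 * P.m) ^ s) :=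
      Nat.mul_le_mul_left _ (Nat.mul_pos hm (pow_pos (by omega) _))
    have h2 := Nat.mul_le_mul_left P.m ih
    have h3 : P.n * (2 * P.m) ^ (s + 1) = P.n * (P.m * (2 * P.m) ^ s) + P.m * (P.n * (2 * P.m) ^ s) := by ring
    rw [evAsk]
    omega

theorem evTime_le {T : ℕ} (hm : 0 < P.m) (hT : 2 ≤ T) (s : ℕ) :
    P.evTime T s ≤ T * (3 * P.κ + 41) * (2 * P.m) ^ s := by
  induction s with
  | zero =>
    rw [evTime, pow_zero]
    nlinarith
  | succ s ih =>
    have h1 : T * (3 * P.κ + 41) * P.m * 1 ≤ T * (3 * P.κ + 41) * P.m * (2 * P.m) ^ s :=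
      Nat.mul_le_mul_left _ (Nat.one_le_pow _ _ (by omega))
    have h2 := Nat.mul_le_mul_left P.m ih
    have h3 : T * (3 * P.κ + 41) * (2 * P.m) ^ (s + 1) =
      T * (3 * P.κ + 41) * P.m * (2 * P.m) ^ s + P.m * (T * (3 * P.κ + 41) * (2 * P.m) ^ s) := by ring
    rw [evTime, selTime]
    have h4 : (P.κ + 9) * T + 4 + (P.m * (P.κ + 6) + (T * (P.m * (P.κ + 11) + 11) + 3)) ≤
        T * (3 * P.κ + 41) * P.m := by
      obtain ⟨a, ha⟩ : ∃ a, P.m = a + 1 := ⟨P.m - 1, by omega⟩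
      obtain ⟨b, rfl⟩ : ∃ b, T = b + 2 := ⟨T - 2, by omega⟩
      rw [ha]
      ring_nf
      nlinarith [Nat.zero_le (a * b), Nat.zero_le (a * b * P.κ), Nat.zero_le (b * P.κ), Nat.zero_le (a * P.κ)]
    have h5 : P.m * (P.κ + 6 + P.evTime T s) = P.m * (P.κ + 6) + P.m * P.evTime T s := by ring
    omega

end Params


namespace Params

variable (P : Params)

/-- The choice of `κ` rests on `2m ≤ 2^(m+1)`. A `κ` linear in `m` is wasteful, but simulation slows
down only by `κ + 9`, and the cost bound has a factor `m` to spare. -/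
theorem size_le_K (hm : 0 < P.m) {s : ℕ} (hκ : P.κ = (P.m + 3) * (s + 1) + 6) :
    11 + 3 * (s + 1) + P.size s ≤ P.K := by
  have h1 : s + 1 < 2 ^ (s + 1) := Nat.lt_two_pow_self
  have h2 : (2 * P.m) ^ s ≤ 2 ^ ((P.m + 1) * (s + 1)) := by
    calc (2 * P.m) ^ s ≤ (2 ^ (P.m + 1)) ^ s :=
          Nat.pow_le_pow_left (by have := (Nat.lt_two_pow_self (n := P.m)); rw [pow_succ]; omega) _
      _ = 2 ^ ((P.m + 1) * s) := (pow_mul _ _ _).symm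
      _ ≤ _ := Nat.pow_le_pow_right (by norm_num) (Nat.mul_le_mul_left _ (by omega))
  have h3 := P.size_le hm s
  have h4 : P.K = 2 ^ ((P.m + 1) * (s + 1)) * 2 ^ (s + 1) * 2 ^ (s + 1) * 64 := by
    rw [K, hκ, ← pow_add, ← pow_add, show (64 : ℕ) = 2 ^ 6 by norm_num, ← pow_add]
    congr 1
    ring
  have h5 : 1 ≤ 2 ^ ((P.m + 1) * (s + 1)) := Nat.one_le_two_pow
  generalize 2 ^ ((P.m + 1) * (s + 1)) = a at *
  generalize 2 ^ (s + 1) = b at *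
  rw [h4]
  have h6 : a ≤ a * b := Nat.le_mul_of_pos_right _ (by omega)
  have h7 : b ≤ a * b := Nat.le_mul_of_pos_left _ (by omega)
  have h8 : a * b ≤ a * b * b := Nat.le_mul_of_pos_right _ (by omega)
  omega

/-- The assumption `n ≤ T` charges the setup, which takes time of order `(s + 1) * n`, to list
recovery. The overhead of order `m * (s + 1)` from `κ` uses the extra power of `m`, and `s + 1 ≤ 2 ^
(s + 1)`. -/
theorem runningTime_le {T s : ℕ} (hm : 256 ≤ P.m) (hκ : P.κ = (P.m + 3) * (s + 1) + 6) (hT : 2 ≤ T)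
    (hn : P.n ≤ T) : (s + 1) * P.n + (2 + (s + 1) * (P.n * 7 + 1)) + P.evTime T s + 2 ≤
      T * (32 * P.m) ^ (s + 1) := by
  have h1 := P.evTime_le (T := T) (by omega) hT s
  have h2 : 3 * P.κ + 41 ≤ 7 * (P.m * (s + 1)) := by
    rw [hκ]
    have := Nat.mul_le_mul_right (s + 1) hm
    have : (P.m + 3) * (s + 1) = P.m * (s + 1) + 3 * (s + 1) := by ring
    omega
  have h3 : T * (3 * P.κ + 41) * (2 * P.m) ^ s ≤ T * (7 * (P.m * (s + 1))) * (2 * P.m) ^ s :=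
    Nat.mul_le_mul_right _ (Nat.mul_le_mul_left _ h2)
  have h4 : (s + 1) * P.n + (2 + (s + 1) * (P.n * 7 + 1)) + 2 ≤ 11 * (T * (s + 1)) := by
    have h5 : (s + 1) * P.n ≤ (s + 1) * T := Nat.mul_le_mul_left _ hn
    have h6 : (s + 1) * 2 ≤ (s + 1) * T := Nat.mul_le_mul_left _ hT
    have h7 : (s + 1) * (P.n * 7 + 1) = 7 * ((s + 1) * P.n) + (s + 1) := by ring
    have h8 : T * (s + 1) = (s + 1) * T := mul_comm _ _
    omega
  have h5 : 11 * (T * (s + 1)) ≤ T * (P.m * (s + 1)) * (2 * P.m) ^ s := by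
    calc 11 * (T * (s + 1)) ≤ P.m * (T * (s + 1)) := Nat.mul_le_mul_right _ (by omega)
      _ = T * (P.m * (s + 1)) * 1 := by ring
      _ ≤ _ := Nat.mul_le_mul_left _ (Nat.one_le_pow _ _ (by omega))
  have h6 : T * (8 * (P.m * (s + 1))) * (2 * P.m) ^ s ≤ T * (32 * P.m) ^ (s + 1) := by
    calc T * (8 * (P.m * (s + 1))) * (2 * P.m) ^ s = T * (4 * (s + 1) * (2 * P.m) ^ (s + 1)) := by ring
      _ ≤ T * (8 ^ (s + 1) * 2 ^ (s + 1) * (2 * P.m) ^ (s + 1)) := by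
        refine Nat.mul_le_mul_left _ (Nat.mul_le_mul_right _ (Nat.mul_le_mul ?_ (Nat.lt_two_pow_self).le))
        calc 4 ≤ 8 ^ 1 := by norm_num
          _ ≤ _ := Nat.pow_le_pow_right (by norm_num) (by omega)
      _ = _ := by rw [← mul_pow, ← mul_pow]; ring
  have h7 : T * (8 * (P.m * (s + 1))) * (2 * P.m) ^ s =
      T * (7 * (P.m * (s + 1))) * (2 * P.m) ^ s + T * (P.m * (s + 1)) * (2 * P.m) ^ s := by ring
  omega

/-- The length of `n` matters only for the price of random symbols. The number of descriptions is at
most `2 ^ (m ^ (s + 1))` because `log L ≤ m`, and the remaining factors enter the exponent through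
`x ≤ 2 ^ x`. -/
theorem preprocessingTime_le {s : ℕ} (hn : 2 ≤ P.n) (hm : 256 ≤ P.m) (hL : 2 ≤ P.L)
    (hLm : Real.logb 2 P.L ≤ P.m) :
    ((Fintype.card (Samp P.m s) * (1 + Nat.size P.n) + P.L ^ Fintype.card (Leaf P.m s) *
      (Fintype.card (Samp P.m s) + 2 * Fintype.card (Leaf P.m s) + 1) : ℕ) : ℝ) ≤
    Real.logb 2 P.n * (2 : ℝ) ^ ((32 * (P.m : ℝ)) ^ (s + 1)) := by
  have hlog := one_le_logb_two hn
  have hsize : (Nat.size P.n : ℝ) ≤ Real.logb 2 P.n + 1 := by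
    have h1 : 2 ^ (Nat.size P.n - 1) ≤ P.n := by
      have : 0 < Nat.size P.n := Nat.size_pos.2 (by omega)
      exact Nat.lt_size.1 (by omega)
    have h2 : ((Nat.size P.n - 1 : ℕ) : ℝ) ≤ Real.logb 2 P.n := by
      rw [Real.le_logb_iff_rpow_le (by norm_num) (by positivity), Real.rpow_natCast]
      exact_mod_cast h1
    have h3 : (Nat.size P.n : ℝ) ≤ ((Nat.size P.n - 1 : ℕ) : ℝ) + 1 := by
      norm_cast
      omega
    linarith
  have hR : (Fintype.card (Samp P.m s) : ℝ) + 1 ≤ (3 * P.m : ℝ) ^ s := by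
    exact_mod_cast card_samp_le (by omega) s
  have hm' : (256 : ℝ) ≤ P.m := by exact_mod_cast hm
  have hlc : ((P.m ^ s : ℕ) : ℝ) ≤ (3 * P.m : ℝ) ^ s := by
    push_cast
    exact pow_le_pow_left₀ (by positivity) (by linarith) _
  have hLpow : (P.L : ℝ) ^ P.m ^ s ≤ (2 : ℝ) ^ ((P.m : ℝ) ^ (s + 1)) := by
    have h1 : (P.L : ℝ) = (2 : ℝ) ^ Real.logb 2 P.L :=
      (Real.rpow_logb (by norm_num) (by norm_num) (by positivity)).symm
    rw [← Real.rpow_natCast]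
    nth_rewrite 1 [h1]
    rw [← Real.rpow_mul (by norm_num)]
    refine Real.rpow_le_rpow_of_exponent_le (by norm_num) ?_
    push_cast
    rw [pow_succ']
    exact mul_le_mul_of_nonneg_right hLm (by positivity)
  rw [card_leaf]
  have hRn : (0 : ℝ) ≤ Fintype.card (Samp P.m s) := Nat.cast_nonneg _
  generalize (Fintype.card (Samp P.m s) : ℕ) = R at *
  push_cast at *
  have hX1 : (1 : ℝ) ≤ (2 : ℝ) ^ ((P.m : ℝ) ^ (s + 1)) := Real.one_le_rpow (by norm_num) (by positivity)
  have hfin : (2 : ℝ) ^ ((P.m : ℝ) ^ (s + 1)) * (6 * (3 * P.m : ℝ) ^ s) ≤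
      (2 : ℝ) ^ ((32 * (P.m : ℝ)) ^ (s + 1)) := by
    have h1 : 6 * (3 * P.m : ℝ) ^ s ≤ (2 : ℝ) ^ (6 * (3 * P.m : ℝ) ^ s) := by
      have h2 : ((6 * (3 * P.m) ^ s : ℕ) : ℝ) < 2 ^ (6 * (3 * P.m) ^ s : ℕ) := by
        exact_mod_cast Nat.lt_two_pow_self
      have h3 := h2.le
      rw [← Real.rpow_natCast] at h3
      push_cast at h3
      exact h3
    refine (mul_le_mul_of_nonneg_left h1 (by positivity)).trans ?_
    rw [← Real.rpow_add (by norm_num)]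
    refine Real.rpow_le_rpow_of_exponent_le (by norm_num) ?_
    have h2 : (P.m : ℝ) ^ (s + 1) ≤ (3 * P.m : ℝ) ^ (s + 1) := pow_le_pow_left₀ (by positivity) (by linarith) _
    have h3 : 6 * (3 * P.m : ℝ) ^ s ≤ (3 * P.m : ℝ) ^ (s + 1) := by
      rw [pow_succ']
      exact mul_le_mul_of_nonneg_right (by linarith) (by positivity)
    calc _ ≤ 2 * (3 * P.m : ℝ) ^ (s + 1) := by linarith
      _ ≤ 2 ^ (s + 1) * (3 * P.m : ℝ) ^ (s + 1) := by
        refine mul_le_mul_of_nonneg_right ?_ (by positivity)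
        exact le_self_pow₀ (by norm_num) (by omega)
      _ = (6 * (P.m : ℝ)) ^ (s + 1) := by rw [← mul_pow]; ring
      _ ≤ _ := pow_le_pow_left₀ (by positivity) (by linarith) _
  refine le_trans ?_ (mul_le_mul_of_nonneg_left hfin (by linarith))
  set X := (2 : ℝ) ^ ((P.m : ℝ) ^ (s + 1))
  set Y := (3 * P.m : ℝ) ^ s
  set l := Real.logb 2 P.n
  have hY : 1 ≤ Y := by linarith
  have hXl : X ≤ l * X := le_mul_of_one_le_left (by linarith) hlog
  calc (R : ℝ) * (1 + Nat.size P.n) + (P.L : ℝ) ^ P.m ^ s * (R + 2 * (P.m : ℝ) ^ s + 1)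
      ≤ Y * (3 * l) + l * X * (3 * Y) := by
        refine add_le_add ?_ ?_
        · exact mul_le_mul (by linarith) (by linarith) (by positivity) (by linarith)
        · exact mul_le_mul (hLpow.trans hXl) (by linarith) (by positivity) (by positivity)
    _ ≤ X * (Y * (3 * l)) + l * X * (3 * Y) := by
        have := le_mul_of_one_le_left (a := X) (b := Y * (3 * l)) (by positivity) hX1
        linarith
    _ = _ := by ring

end Params

/-! ### Degenerate cases and assembly -/

namespace LocalListAlg

variable {F : Type*} {q n k ℓ : ℕ} {φ : F ≃ Fin q} {A : LocalListAlg}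

theorem ApproxLocallyListRecovers.mono [Field F] {C : LinCode F k n} {Q Q' α α' ε L L' : ℝ}
    (h : A.ApproxLocallyListRecovers φ C Q α ε ℓ L) (hQ : Q ≤ Q') (hα : α' ≤ α) (hL : L ≤ L') :
    A.ApproxLocallyListRecovers φ C Q' α' ε ℓ L' where
  preprocessing ω := let ⟨D, h1, h2⟩ := h.preprocessing ω; ⟨D, h1, h2.trans hL⟩
  queries ω D hD d hd S hS i := let ⟨s, h1, h2⟩ := h.queries ω D hD d hd S hS i; ⟨s, h1, h2.trans hQ⟩
  correct S hS x hx := h.correct S hS x (hx.trans hα)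

theorem PreprocessingTime.mono {T T' : ℝ} (h : A.PreprocessingTime T) (hT : T ≤ T') :
    A.PreprocessingTime T' :=
  fun ω => let ⟨s, h1, h2⟩ := h ω; ⟨s, h1, h2.trans hT⟩

theorem RunningTime.mono {T T' : ℝ} (h : A.RunningTime φ n ℓ T) (hT : T ≤ T') : A.RunningTime φ n ℓ T' :=
  fun ω D hD d hd S hS i => let ⟨s, h1, h2⟩ := h ω D hD d hd S hS i; ⟨s, h1, h2.trans hT⟩

/-- The algorithm that outputs no descriptions. -/
def empty : LocalListAlg := ⟨.nop, .nop, 1, one_pos, 0⟩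

theorem Outputs.eq_nil {ω : empty.Seed} {D : List (List ℕ)} (h : empty.Outputs ω D) : D = [] := by
  obtain ⟨s, h1, rfl⟩ := h
  have := Exec.unique h1 (Exec.nop State.init)
  rw [this]
  rfl

/-- Either no codeword is close to any admissible `S`, or `1 - ε ≤ 0` and success probability zero
is enough. -/
theorem empty_recovers [Field F] {C : LinCode F k n} {Q α ε L : ℝ} (hL : 0 ≤ L)
    (h : ∀ S : ListString F n, (∀ i, (S i).card = ℓ) → ∀ x, listDist (C x) S ≤ α → 1 ≤ ε) :
    empty.ApproxLocallyListRecovers φ C Q α ε ℓ L where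
  preprocessing ω := ⟨[], ⟨_, Exec.nop _, rfl⟩, by simpa using hL⟩
  queries ω D hD d hd := by simp [hD.eq_nil] at hd
  correct S hS x hx := by
    have := h S hS x hx
    exact le_trans (by linarith) (div_nonneg (Nat.cast_nonneg _) (Nat.cast_nonneg _))

theorem empty_preprocessingTime {T : ℝ} (hT : 0 ≤ T) : empty.PreprocessingTime T :=
  fun ω => ⟨_, Exec.nop _, by simpa [State.init] using hT⟩

theorem empty_runningTime {T : ℝ} : empty.RunningTime φ n ℓ T := fun ω D hD d hd => by
  simp [hD.eq_nil] at hd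

end LocalListAlg

section

variable {F : Type*} [Field F] {q n k ℓ : ℕ} {φ : F ≃ Fin q}

theorem HasRelDist.le_one {C : LinCode F k n} {δ : ℝ} (h : HasRelDist C δ) : δ ≤ 1 := by
  obtain ⟨x, y, -, rfl⟩ := h.1
  exact frac_le_one _

/-- There are no codewords that are close to a string of lists when list recovery is too fast to write one. -/
theorem GlobalProg.not_close {C : LinCode F k n} {α : ℝ} {L T : ℕ} {G : Prog} (h : GlobalProg φ C α ℓ L T G)
    (hT : T < n) {S : ListString F n} (hS : ∀ i, (S i).card = ℓ) (x : Fin k → F) : ¬ listDist (C x) S ≤ α := by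
  intro hx
  obtain ⟨s, h1, h2, -, -, h3⟩ := h S hS
  have h4 := Halts.output_le h1
  have h5 := (List.sublist_flatten_of_mem (h3 x hx)).length_le
  simp only [encodeWord, List.length_ofFn, List.length_append] at h4 h5
  omega

/-- The trivial algorithm handles `ε ≥ 1` and `T < n`. In the remaining case the sampling algorithm
is instantiated with `m` from `exists_samples`, and each of its costs is compared with
`(32m)^(s+1)`. -/
theorem exists_alg {C : LinCode F k n} {c s L T : ℕ} {α ε δ : ℝ} {G : Prog} (hc : 2 ^ 20 ≤ c) (hn : 2 ≤ n)
    (hL : 2 ≤ L) (hα : 0 < α) (hα1 : α ≤ 1) (hε : 0 < ε) (hδ : 0 < δ) (hC : HasRelDist C δ)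
    (hG : GlobalProg φ C α ℓ L T G) : ∃ A : LocalListAlg,
      A.ApproxLocallyListRecovers φ (tensorPow C (s + 1)) (n * costFactor c (s + 1) L α ε δ)
        (α * ε * (δ / c) ^ (c * (s + 1))) ε ℓ (2 ^ costFactor c (s + 1) L α ε δ) ∧
      A.PreprocessingTime (Real.logb 2 n * 2 ^ costFactor c (s + 1) L α ε δ) ∧
      A.RunningTime φ (n ^ (s + 1)) ℓ (T * costFactor c (s + 1) L α ε δ) := by
  have hδ1 := hC.le_one
  have hlogn := one_le_logb_two hn
  have hpre : 0 ≤ Real.logb 2 n * 2 ^ costFactor c (s + 1) L α ε δ := by positivity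
  have hc' : (2 : ℝ) ^ 20 ≤ c := by exact_mod_cast hc
  have hc0 : (0 : ℝ) < c := lt_of_lt_of_le (by positivity) hc'
  have hd64 : δ / c ≤ δ / 64 := div_le_div_of_nonneg_left hδ.le (by norm_num) (by norm_num at hc' ⊢; linarith)
  by_cases hε1 : 1 ≤ ε
  · exact ⟨.empty, LocalListAlg.empty_recovers (by positivity) fun _ _ _ _ => hε1,
      LocalListAlg.empty_preprocessingTime hpre, LocalListAlg.empty_runningTime⟩
  push Not at hε1
  have hαε : α * ε * (δ / c) ^ (c * (s + 1)) ≤ α := by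
    rw [mul_assoc]
    refine mul_le_of_le_one_right hα.le (mul_le_one₀ hε1.le (by positivity) ?_)
    exact pow_le_one₀ (by positivity) (hd64.trans (by linarith))
  rcases lt_or_ge T n with hT | hT
  · refine ⟨.empty, LocalListAlg.empty_recovers (by positivity) fun S hS x hx => ?_,
      LocalListAlg.empty_preprocessingTime hpre, LocalListAlg.empty_runningTime⟩
    have hN : 0 < n ^ (s + 1) := pow_pos (by omega) _
    set w : ℕ → F := fun y => tensorPow C (s + 1) x ⟨y % n ^ (s + 1), Nat.mod_lt _ hN⟩ with hw
    have hwi : ∀ i : Fin (n ^ (s + 1)), w i = tensorPow C (s + 1) x i := fun i => by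
      rw [hw]
      simp only [Nat.mod_eq_of_lt i.2]
    set S' : ℕ → Finset F := fun y => S ⟨y % n ^ (s + 1), Nat.mod_lt _ hN⟩ with hS'
    have hSi : ∀ i : Fin (n ^ (s + 1)), S' i = S i := fun i => by
      rw [hS']
      simp only [Nat.mod_eq_of_lt i.2]
    obtain ⟨g, z, hz⟩ := InTensor.exists_close_column (α := α) (S := S') (by omega)
      (inTensor_tensorPow C s x w hwi) (by
        simp only [hwi, hSi]
        exact hx.trans hαε)
    exact absurd hz (hG.not_close hT (fun i => hS _) z)
  · obtain ⟨m, hm, hLm, hmB, h4, h5⟩ := exists_samples (s := s) hL hε hε1.le hδ hδ1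
    have hB := le_costFactor hc hL hα hα1 hε hε1.le hδ hδ1 hmB
    set B := costFactor c (s + 1) L α ε δ
    have hm1 : (1 : ℝ) ≤ m := by
      have : 1 ≤ m := by omega
      exact_mod_cast this
    -- The acceptance threshold is `δm/4` rounded down, halfway between zero and the `δm/2`
    -- differences expected at least of a wrong candidate.
    set P : Params := ⟨(m + 3) * (s + 1) + 6, n, m, ⌊δ * m / 4⌋₊, L, G⟩ with hP
    obtain ⟨hA, hrun⟩ := Params.alg_recovers (P := P) (hn := show 0 < n by omega) (s := s) hG
      (P.size_le_K (show 0 < m by omega) rfl) hC hδ hδ1 (show 0 < L by omega) (show 0 < m by omega) hα hε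
      hε1.le h4 h5 (Nat.lt_floor_add_one _) (Nat.floor_le (by positivity))
    refine ⟨_, hA.mono ?_ ?_ ?_, (Params.alg_preprocessingTime (P := P) (s := s)
      (show 0 < n by omega)).mono ?_, hrun.mono ?_⟩
    · have h1 : (P.evAsk s : ℝ) ≤ n * (2 * m) ^ s := by exact_mod_cast P.evAsk_le (show 0 < m by omega) s
      refine h1.trans (mul_le_mul_of_nonneg_left (le_trans ?_ hB) (by positivity))
      calc (2 * (m : ℝ)) ^ s ≤ (32 * (m : ℝ)) ^ s := pow_le_pow_left₀ (by positivity) (by linarith) _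
        _ ≤ _ := pow_le_pow_right₀ (by linarith) (by omega)
    -- The algorithm tolerates closeness `α * ε * (δ/64)^(2s+1)`; a constant `c ≥ 2` in the exponent
    -- covers `2s + 1`.
    · refine mul_le_mul_of_nonneg_left ?_ (by positivity)
      calc (δ / c) ^ (c * (s + 1)) ≤ (δ / c) ^ (s + 1 + s) :=
            pow_le_pow_of_le_one (by positivity) (hd64.trans (by linarith)) (by nlinarith)
        _ ≤ _ := pow_le_pow_left₀ (by positivity) hd64 _
    · change (L : ℝ) ^ m ^ s ≤ _
      have h1 : (L : ℝ) = (2 : ℝ) ^ Real.logb 2 L :=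
        (Real.rpow_logb (by norm_num) (by norm_num) (by positivity)).symm
      rw [← Real.rpow_natCast]
      nth_rewrite 1 [h1]
      rw [← Real.rpow_mul (by norm_num)]
      refine Real.rpow_le_rpow_of_exponent_le (by norm_num) (le_trans ?_ hB)
      push_cast
      calc Real.logb 2 L * (m : ℝ) ^ s ≤ m * (m : ℝ) ^ s := mul_le_mul_of_nonneg_right hLm (by positivity)
        _ = (m : ℝ) ^ (s + 1) := (pow_succ' _ _).symm
        _ ≤ _ := pow_le_pow_left₀ (by positivity) (by linarith) _
    · refine (P.preprocessingTime_le hn hm hL hLm).trans (mul_le_mul_of_nonneg_left ?_ (by linarith))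
      exact Real.rpow_le_rpow_of_exponent_le (by norm_num) hB
    · have h1 := P.runningTime_le (T := T) hm rfl (by omega) hT
      have h2 : ((T * (32 * m) ^ (s + 1) : ℕ) : ℝ) ≤ T * B := by
        push_cast
        exact mul_le_mul_of_nonneg_left hB (by positivity)
      exact (Nat.cast_le.2 h1).trans h2

end

end LLR

theorem lemma5p2 :
    ∃ c : ℕ, 0 < c ∧
      ∀ (F : Type*) [Field F] [Fintype F] (φ : F ≃ Fin (Fintype.card F))
        (k n t ℓ L : ℕ) (C : LLR.LinCode F k n) (δ α ε : ℝ),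
        2 ≤ n → 1 ≤ t → 1 ≤ ℓ → 2 ≤ L → 0 < α → α ≤ 1 → 0 < ε →
        0 < δ → LLR.HasRelDist C δ → LLR.ListRecoverable C α ℓ L →
        (∃ A : LLR.LocalListAlg,
          A.ApproxLocallyListRecovers φ (LLR.tensorPow C t)
            (n * LLR.costFactor c t L α ε δ) (α * ε * (δ / c) ^ (c * t)) ε ℓ
            (2 ^ LLR.costFactor c t L α ε δ) ∧
          A.PreprocessingTime (Real.logb 2 n * 2 ^ LLR.costFactor c t L α ε δ)) ∧
        ∀ T : ℕ, LLR.GlobalListRecoveryInTime φ C α ℓ L T →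
          ∃ A : LLR.LocalListAlg,
            A.ApproxLocallyListRecovers φ (LLR.tensorPow C t)
              (n * LLR.costFactor c t L α ε δ) (α * ε * (δ / c) ^ (c * t)) ε ℓ
              (2 ^ LLR.costFactor c t L α ε δ) ∧
            A.PreprocessingTime (Real.logb 2 n * 2 ^ LLR.costFactor c t L α ε δ) ∧
            A.RunningTime φ (n ^ t) ℓ (T * LLR.costFactor c t L α ε δ) := by
  -- Only the lower bound on `c` is used; hiding its value keeps the numeral out of the exponents.
  obtain ⟨c, hc⟩ : ∃ c : ℕ, 2 ^ 20 ≤ c := ⟨_, le_rfl⟩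
  refine ⟨c, lt_of_lt_of_le (by positivity) hc, ?_⟩
  intro F _ _ φ k n t ℓ L C δ α ε hn ht _ hL hα hα1 hε hδ hC hrec
  obtain ⟨s, rfl⟩ : ∃ s, t = s + 1 := ⟨t - 1, by omega⟩
  refine ⟨?_, fun T ⟨G, hG⟩ => LLR.exists_alg hc hn hL hα hα1 hε hδ hC hG⟩
  -- The first claim makes no statement on running time, so the unspecified `T` of the decision tree
  -- is harmless.
  obtain ⟨T, G, hG⟩ := LLR.exists_globalProg φ hrec
  obtain ⟨A, h1, h2, -⟩ := LLR.exists_alg (s := s) hc hn hL hα hα1 hε hδ hC hG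
  exact ⟨A, h1, h2⟩
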